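/- **Setting and definitions.** All manifolds are smooth and finite-dimensional without boundary, and all metrics are smooth Riemannian metrics. Let $(M_1,g_{M_1})$, $(M_2,g_{M_2})$, $(N_1,g_{N_1})$, $(N_2,g_{N_2})$ be Riemannian manifolds, $m_2=\dim M_2$, and let $f:M_1\to\mathbb R^+$, $\rho:N_1\to\mathbb R^+$ be smooth. Let $M=M_1\times_f M_2$ be $M_1\times M_2$ with the metric $g_M=g_{M_1}+f^2g_{M_2}$, and $N=N_1\times_\rho N_2$ likewise. A smooth map $\varphi$ between Riemannian manifolds is a *Riemannian map* if its rank is positive at every point and $\varphi_*$ is isometric on the horizontal spaces $(\ker\varphi_*)^\perp$. It is a *Clairaut Riemannian map* if, moreover, there is a smooth positive function $r$ on its domain such that along every nonconstant geodesic $r\sin\theta$ is constant, where $\theta\in[0,\pi/2]$ is the angle between the velocity and the horizontal space. A *Clairaut Riemannian warped product map* is a Clairaut Riemannian map $\phi=\phi_1\times\phi_2:M\to N$ in which $\phi_i:M_i\to N_i$ ($i=1,2$) are Riemannian maps. $(M,g,\xi)$ is a *Ricci soliton* if $\tfrac12L_\xi g+\mathrm{Ric}+\lambda g=0$ for a constant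 $\lambda$. A submanifold $F$ of $(P,g)$ is an *almost Ricci soliton* (for the metric induced by $g$) with potential a vector field $X$ of $P$ if, for some smooth $\lambda:F\to\mathbb R$, $$\tfrac12(L_Xg)(U,V)+\mathrm{Ric}^F(U,V)+\lambda\, g(U,V)=0\qquad\text{for all } U,V \text{ tangent to } F,$$ where $\mathrm{Ric}^F$ is the Ricci tensor of the induced metric on $F$. (If $X$ is tangent to $F$, this is the usual notion.) **Theorem.** Let $\phi=\phi_1\times\phi_2:M_1\times_fM_2\to N_1\times_\rho N_2$ be a Clairaut Riemannian warped product map. Suppose that $(M,g_M,\xi)$ is a Ricci soliton whose smooth potential field $\xi=(\xi_1,\xi_2)$ is vertical ($\phi_*\xi=0$), and that the distribution $(\ker\phi_*)^\perp$ is integrable. Here $\xi_1(\cdot,y)$, for each $y\in M_2$, is regarded as a vector field on $M_1$, and $\xi_2(x,\cdot)$, for each $x\in M_1$, as one on $M_2$ (if $\xi_1,\xi_2$ are lifts from $M_1,M_2$, they do not depend on $y$, $x$). Then: 1. for every $y\in M_2$, the fibres of $\phi_1$, as submanifolds of $(M_1,g_{M_1})$ (equivalently of the leaf $M_1\times\{y\}\subset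 M$), are almost Ricci solitons with potential $\xi_1(\cdot,y)-m_2f\nabla f$; 2. for every $x\in M_1$, the fibres of $\phi_2$, as submanifolds of $\{x\}\times M_2\subset M$, that is, for the metric induced by $f(x)^2g_{M_2}$, are almost Ricci solitons with potential $\xi_2(x,\cdot)$; 3. if $\xi_2$ is a lift of a vector field on $M_2$, and $f$ is not constant or takes the value $1$ somewhere, then the fibres of $\phi_2$, as submanifolds of $(M_2,g_{M_2})$, are almost Ricci solitons with potential $\xi_2$. The fibres carry their submanifold structure; the assertions hold for every immersed submanifold $F$ contained in a fibre $\phi_i^{-1}(q)$ whose tangent spaces are the spaces $\ker\phi_{i*}$. -/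

import Mathlib

set_option maxSynthPendingDepth 3

open Set Manifold
open scoped ContDiff

noncomputable section

namespace WarpedClairaut

section General

variable {E : Type*} [NormedAddCommGroup E] [NormedSpace ℝ E]
  {H : Type*} [TopologicalSpace H] (I : ModelWithCorners ℝ E H)
  {M : Type*} [TopologicalSpace M] [ChartedSpace H M]
  {E' : Type*} [NormedAddCommGroup E'] [NormedSpace ℝ E']
  {H' : Type*} [TopologicalSpace H'] (J : ModelWithCorners ℝ E' H')
  {N : Type*} [TopologicalSpace N] [ChartedSpace H' N]

/-- A field of bilinear forms on the tangent spaces of `M`. It is only ever used for Riemannian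
metrics: Mathlib's `ContMDiffRiemannianMetric.inner`, warped products of such, and metrics induced
on immersed submanifolds. -/
abbrev MetricField (M : Type*) [TopologicalSpace M] [ChartedSpace H M] :=
  ∀ x : M, TangentSpace I x →L[ℝ] TangentSpace I x →L[ℝ] ℝ

variable {I J}

/-! ### Local coordinate expressions -/

/-- The metric in the preferred chart at `x₀`: `u ↦ ((chart)⁻¹)^* g` at `u`. -/
def coordMetric (g : MetricField I M) (x₀ : M) (u : E) : E →L[ℝ] E →L[ℝ] ℝ :=
  let ψ := (extChartAt I x₀).symm
  let D : E →L[ℝ] E := mfderivWithin 𝓘(ℝ, E) I ψ (range I) u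
  let B : E →L[ℝ] E →L[ℝ] ℝ := g (ψ u)
  B.bilinearComp D D

theorem coordMetric_apply (g : MetricField I M) (x₀ : M) (u v w : E) :
    coordMetric g x₀ u v w =
      g ((extChartAt I x₀).symm u)
        (mfderivWithin 𝓘(ℝ, E) I (extChartAt I x₀).symm (range I) u v)
        (mfderivWithin 𝓘(ℝ, E) I (extChartAt I x₀).symm (range I) u w) := rfl

/-- A vector field in the preferred chart at `x₀`. -/
def coordField (X : ∀ x : M, TangentSpace I x) (x₀ : M) : E → E :=
  VectorField.mpullbackWithin 𝓘(ℝ, E) I (extChartAt I x₀).symm X (range I)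

/-- Christoffel symbols of the first kind for a metric `G` on (a subset `S` of) `E`:
`v, w, z ↦ (D_v G(w, z) + D_w G(v, z) - D_z G(v, w)) / 2`. -/
def christoffelFirst (G : E → E →L[ℝ] E →L[ℝ] ℝ) (S : Set E) (u : E) :
    E →L[ℝ] E →L[ℝ] E →L[ℝ] ℝ :=
  let DG : E →L[ℝ] E →L[ℝ] E →L[ℝ] ℝ := fderivWithin ℝ G S u
  let flip : (E →L[ℝ] E →L[ℝ] ℝ) →L[ℝ] (E →L[ℝ] E →L[ℝ] ℝ) :=
    (ContinuousLinearMap.flipₗᵢ ℝ E E ℝ).toContinuousLinearEquiv.toContinuousLinearMap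
  let DG' : E →L[ℝ] E →L[ℝ] E →L[ℝ] ℝ := DG.flip
  (1 / 2 : ℝ) • (DG + DG' - flip.comp DG')

theorem christoffelFirst_apply (G : E → E →L[ℝ] E →L[ℝ] ℝ) (S : Set E) (u v w z : E) :
    christoffelFirst G S u v w z =
      (1 / 2) * (fderivWithin ℝ G S u v w z + fderivWithin ℝ G S u w v z
        - fderivWithin ℝ G S u z v w) := by
  simp [christoffelFirst]

/-- Christoffel symbols `Γ_u(v, w) ∈ E`, determined by
`G_u(Γ_u(v, w), z) = christoffelFirst G u v w z`; the index is raised with the inverse of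
`G_u : E → E^*`. -/
def christoffel (G : E → E →L[ℝ] E →L[ℝ] ℝ) (S : Set E) (u : E) : E →L[ℝ] E →L[ℝ] E :=
  (ContinuousLinearMap.compL ℝ E (E →L[ℝ] ℝ) E (ContinuousLinearMap.inverse (G u))).comp
    (christoffelFirst G S u)

theorem christoffel_apply (G : E → E →L[ℝ] E →L[ℝ] ℝ) (S : Set E) (u v w : E) :
    christoffel G S u v w =
      ContinuousLinearMap.inverse (G u) (christoffelFirst G S u v w) := rfl

/-- The linear map `a ↦ R(a, b) c`, where
`R(a, b) c = (D_a Γ)(b, c) - (D_b Γ)(a, c) + Γ(a, Γ(b, c)) - Γ(b, Γ(a, c))`, that is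
`R(X, Y) Z = ∇_X ∇_Y Z - ∇_Y ∇_X Z - ∇_[X,Y] Z`. -/
def coordCurvature (G : E → E →L[ℝ] E →L[ℝ] ℝ) (S : Set E) (u b c : E) : E →L[ℝ] E :=
  let Γ := christoffel G S u
  let DΓ : E →L[ℝ] E →L[ℝ] E →L[ℝ] E := fderivWithin ℝ (christoffel G S) S u
  (DΓ.flip b).flip c - (DΓ b).flip c + Γ.flip (Γ b c) - (Γ b).comp (Γ.flip c)

theorem coordCurvature_apply (G : E → E →L[ℝ] E →L[ℝ] ℝ) (S : Set E) (u a b c : E) :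
    coordCurvature G S u b c a =
      fderivWithin ℝ (christoffel G S) S u a b c - fderivWithin ℝ (christoffel G S) S u b a c
      + christoffel G S u a (christoffel G S u b c)
      - christoffel G S u b (christoffel G S u a c) := by
  simp [coordCurvature]

/-! ### Riemannian notions on manifolds -/

/-- The Ricci tensor `Ric(v, w) = tr (a ↦ R(a, v) w)` of the metric `g` at `x`, computed in the
preferred chart at `x`, through which Mathlib identifies `TangentSpace I x` with `E`. -/
def ricci (g : MetricField I M) (x : M) (v w : TangentSpace I x) : ℝ :=
  LinearMap.trace ℝ E
    (coordCurvature (coordMetric g x) (range I) (extChartAt I x x) v w : E →L[ℝ] E).toLinearMap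

/-- The Lie derivative `(L_X g)(v, w)` at `x`, in the preferred chart at `x`:
`(D_X G)(v, w) + G(D_v X, w) + G(v, D_w X)`. -/
def lieDerivMetric (g : MetricField I M) (X : ∀ x : M, TangentSpace I x) (x : M)
    (v w : TangentSpace I x) : ℝ :=
  let G := coordMetric g x
  let ξ := coordField X x
  let u : E := extChartAt I x x
  let DG : E →L[ℝ] E →L[ℝ] E →L[ℝ] ℝ := fderivWithin ℝ G (range I) u
  let Dξ : E →L[ℝ] E := fderivWithin ℝ ξ (range I) u
  DG (ξ u) v w + G u (Dξ v) w + G u v (Dξ w)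

/-- The gradient: `g (∇f, v) = df v`. -/
def gradient (g : MetricField I M) (f : M → ℝ) (x : M) : TangentSpace I x :=
  ContinuousLinearMap.inverse (g x)
    (mfderiv I 𝓘(ℝ, ℝ) f x : TangentSpace I x →L[ℝ] ℝ)

/-- The velocity vector of a curve. -/
def velocity (I : ModelWithCorners ℝ E H) (γ : ℝ → M) (t : ℝ) : TangentSpace I (γ t) :=
  mfderiv 𝓘(ℝ, ℝ) I γ t (1 : ℝ)

/-- `γ` is a geodesic of `g` on the open set `s` of parameters: it is smooth on `s` and
`c'' + Γ(c', c') = 0` at each `t ∈ s`, where `c` is `γ` in the preferred chart at `γ t`. -/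
def IsGeodesicOn (g : MetricField I M) (γ : ℝ → M) (s : Set ℝ) : Prop :=
  ContMDiffOn 𝓘(ℝ, ℝ) I ∞ γ s ∧
  ∀ t ∈ s,
    let c : ℝ → E := fun τ => extChartAt I (γ t) (γ τ)
    deriv (deriv c) t
      + christoffel (coordMetric g (γ t)) (range I) (c t) (deriv c t) (deriv c t) = 0

/-- The metric `ι^* g` induced by a smooth map `ι`. -/
def pullbackMetric (I : ModelWithCorners ℝ E H) (g : MetricField J N) (ι : M → N) :
    MetricField I M := fun x =>
  let D : E →L[ℝ] E' := mfderiv I J ι x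
  let B : E' →L[ℝ] E' →L[ℝ] ℝ := g (ι x)
  let P : E →L[ℝ] E →L[ℝ] ℝ := B.bilinearComp D D
  P

theorem pullbackMetric_apply (g : MetricField J N) (ι : M → N) (x : M) (v w : TangentSpace I x) :
    pullbackMetric I g ι x v w = g (ι x) (mfderiv I J ι x v) (mfderiv I J ι x w) := rfl

/-- The vector field `X` is smooth on the open set `U`. -/
def IsSmoothField [IsManifold I ∞ M] (X : ∀ x : M, TangentSpace I x) (U : Set M) : Prop :=
  ContMDiffOn I I.tangent ∞ (fun x => (⟨x, X x⟩ : TangentBundle I M)) U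

/-- `(M, g, X, lam)` is a Ricci soliton: `(1/2) L_X g + Ric + lam g = 0` with `lam` constant. -/
def IsRicciSoliton (g : MetricField I M) (X : ∀ x : M, TangentSpace I x) (lam : ℝ) : Prop :=
  ∀ (x : M) (v w : TangentSpace I x),
    (1 / 2) * lieDerivMetric g X x v w + ricci g x v w + lam * g x v w = 0

/-! ### Riemannian maps and Clairaut Riemannian maps -/

/-- The vertical space `ker φ_*` at `x`. -/
def IsVertical (I : ModelWithCorners ℝ E H) (J : ModelWithCorners ℝ E' H') (φ : M → N) (x : M)
    (v : TangentSpace I x) : Prop :=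
  mfderiv I J φ x v = 0

/-- The horizontal space `(ker φ_*)^⊥` at `x`. -/
def IsHorizontal (J : ModelWithCorners ℝ E' H') (g : MetricField I M) (φ : M → N) (x : M)
    (v : TangentSpace I x) : Prop :=
  ∀ w, IsVertical I J φ x w → g x v w = 0

/-- A Riemannian map `φ : (M, g) → (N, h)`: smooth, of positive rank at each point, and with
`φ_*` isometric on the horizontal spaces. -/
structure IsRiemannianMap (g : MetricField I M) (h : MetricField J N) (φ : M → N) : Prop where
  smooth : ContMDiff I J ∞ φ
  rank_pos : ∀ x, 0 < Module.finrank ℝ (LinearMap.range (mfderiv I J φ x).toLinearMap)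
  isometric : ∀ (x : M) (v w : TangentSpace I x), IsHorizontal J g φ x v → IsHorizontal J g φ x w →
    h (φ x) (mfderiv I J φ x v) (mfderiv I J φ x w) = g x v w

/-- The nonzero vector `v` makes the angle `θ ∈ [0, π/2]` with the horizontal space: the horizontal
component of `v` has length `‖v‖ cos θ`. -/
def MakesAngle (J : ModelWithCorners ℝ E' H') (g : MetricField I M) (φ : M → N) (x : M)
    (v : TangentSpace I x) (θ : ℝ) : Prop :=
  v ≠ 0 ∧ θ ∈ Icc 0 (Real.pi / 2) ∧
  ∃ a b : TangentSpace I x, v = a + b ∧ IsHorizontal J g φ x a ∧ IsVertical I J φ x b ∧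
    Real.sqrt (g x a a) = Real.sqrt (g x v v) * Real.cos θ

/-- A Clairaut Riemannian map: a Riemannian map with a positive function `r` such that `r sin θ` is
constant along every (nonconstant) geodesic segment, `θ` being its angle with the horizontal
spaces. -/
def IsClairautRiemannianMap (g : MetricField I M) (h : MetricField J N) (φ : M → N) : Prop :=
  IsRiemannianMap g h φ ∧
  ∃ r : M → ℝ, ContMDiff I 𝓘(ℝ, ℝ) ∞ r ∧ (∀ x, 0 < r x) ∧
    ∀ (a b : ℝ) (γ : ℝ → M), IsGeodesicOn g γ (Ioo a b) →
      ∀ t₁ ∈ Ioo a b, ∀ t₂ ∈ Ioo a b, ∀ θ₁ θ₂ : ℝ,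
        MakesAngle J g φ (γ t₁) (velocity I γ t₁) θ₁ →
        MakesAngle J g φ (γ t₂) (velocity I γ t₂) θ₂ →
        r (γ t₁) * Real.sin θ₁ = r (γ t₂) * Real.sin θ₂

/-- The horizontal distribution `(ker φ_*)^⊥` is integrable (involutive): the bracket of
horizontal fields, defined and smooth on an open set, is horizontal. -/
def HorizontalIntegrable [IsManifold I ∞ M] (J : ModelWithCorners ℝ E' H') (g : MetricField I M) (φ : M → N) : Prop :=
  ∀ (U : Set M), IsOpen U → ∀ X Y : (∀ x : M, TangentSpace I x),
    IsSmoothField X U → IsSmoothField Y U →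
    (∀ x ∈ U, IsHorizontal J g φ x (X x)) → (∀ x ∈ U, IsHorizontal J g φ x (Y x)) →
    ∀ x ∈ U, IsHorizontal J g φ x (VectorField.mlieBracket I X Y x)

/-- `ι : F → M` exhibits the manifold `F` as (an open part of) the fibre of `φ` over `q`, with its
submanifold structure: `ι` is an immersion into `φ⁻¹(q)` whose tangent spaces are the vertical
spaces. -/
structure IsFibre (I : ModelWithCorners ℝ E H) (J : ModelWithCorners ℝ E' H')
    {EF : Type*} [NormedAddCommGroup EF] [NormedSpace ℝ EF]
    {F : Type*} [TopologicalSpace F] [ChartedSpace EF F]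
    (φ : M → N) (q : N) (ι : F → M) : Prop where
  smooth : ContMDiff 𝓘(ℝ, EF) I ∞ ι
  immersive : ∀ s, Function.Injective (mfderiv 𝓘(ℝ, EF) I ι s)
  mem_fibre : ∀ s, φ (ι s) = q
  tangent : ∀ s v, IsVertical I J φ (ι s) v ↔ ∃ a, mfderiv 𝓘(ℝ, EF) I ι s a = v

/-- The submanifold `ι : F → (M, g)`, with the induced metric `ι^* g`, is an almost Ricci soliton
with potential field `X` (a vector field of `M`): for some smooth function `lam` on `F`,
`(1/2) (L_X g)(u, v) + Ric^F(u, v) + lam g(u, v) = 0` for all `u, v` tangent to `F`.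
If `X` is tangent to `F`, then `L_X g` restricted to `F` is the Lie derivative of the induced
metric, and this is the usual notion. -/
def IsAlmostRicciSolitonOn {EF : Type*} [NormedAddCommGroup EF] [NormedSpace ℝ EF]
    {F : Type*} [TopologicalSpace F] [ChartedSpace EF F]
    (g : MetricField I M) (X : ∀ x : M, TangentSpace I x) (ι : F → M) : Prop :=
  ∃ lam : F → ℝ, ContMDiff 𝓘(ℝ, EF) 𝓘(ℝ, ℝ) ∞ lam ∧
    ∀ (s : F) (u v : TangentSpace 𝓘(ℝ, EF) s),
      (1 / 2) * lieDerivMetric g X (ι s) (mfderiv 𝓘(ℝ, EF) I ι s u) (mfderiv 𝓘(ℝ, EF) I ι s v)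
        + ricci (pullbackMetric 𝓘(ℝ, EF) g ι) s u v
        + lam s * pullbackMetric 𝓘(ℝ, EF) g ι s u v = 0

end General

section Warped

variable {E₁ : Type*} [NormedAddCommGroup E₁] [NormedSpace ℝ E₁]
  {H₁ : Type*} [TopologicalSpace H₁] {I₁ : ModelWithCorners ℝ E₁ H₁}
  {M₁ : Type*} [TopologicalSpace M₁] [ChartedSpace H₁ M₁]
  {E₂ : Type*} [NormedAddCommGroup E₂] [NormedSpace ℝ E₂]
  {H₂ : Type*} [TopologicalSpace H₂] {I₂ : ModelWithCorners ℝ E₂ H₂}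
  {M₂ : Type*} [TopologicalSpace M₂] [ChartedSpace H₂ M₂]

/-- The warped product metric `π₁^* g₁ + (f ∘ π₁)² π₂^* g₂` on `M₁ × M₂`. -/
def warpedMetric (g₁ : MetricField I₁ M₁) (g₂ : MetricField I₂ M₂) (f : M₁ → ℝ) :
    MetricField (I₁.prod I₂) (M₁ × M₂) := fun p =>
  pullbackMetric (I₁.prod I₂) g₁ Prod.fst p
    + (f p.1) ^ 2 • pullbackMetric (I₁.prod I₂) g₂ Prod.snd p

/-- The metric `c² g₂`. For `c = f x` this is the metric which the warped product metric induces on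
`{x} × M₂`, seen on `M₂`. (On `M₁ × {y}` the induced metric is `g₁`.) -/
def scaledMetric (g₂ : MetricField I₂ M₂) (c : ℝ) : MetricField I₂ M₂ := fun y => c ^ 2 • g₂ y

/-- The component `ξ₁(·, y)` of `ξ = (ξ₁, ξ₂)`, a vector field on `M₁` (independent of `y` if `ξ₁`
is lifted from `M₁`). -/
def component₁ (ξ : ∀ p : M₁ × M₂, TangentSpace (I₁.prod I₂) p) (y : M₂) (x : M₁) :
    TangentSpace I₁ x :=
  mfderiv (I₁.prod I₂) I₁ (Prod.fst : M₁ × M₂ → M₁) (x, y) (ξ (x, y))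

/-- The component `ξ₂(x, ·)` of `ξ = (ξ₁, ξ₂)`, a vector field on `M₂` (independent of `x` if `ξ₂`
is lifted from `M₂`). -/
def component₂ (ξ : ∀ p : M₁ × M₂, TangentSpace (I₁.prod I₂) p) (x : M₁) (y : M₂) :
    TangentSpace I₂ y :=
  mfderiv (I₁.prod I₂) I₂ (Prod.snd : M₁ × M₂ → M₂) (x, y) (ξ (x, y))

end Warped

/-- `φ₁ × φ₂ : M₁ ×_f M₂ → N₁ ×_ρ N₂` is a Clairaut Riemannian warped product map: `φ₁` and `φ₂` are
Riemannian maps, and their product is a Clairaut Riemannian map for the warped metrics. -/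
structure IsClairautWarpedProductMap
    {E₁ : Type*} [NormedAddCommGroup E₁] [NormedSpace ℝ E₁]
    {H₁ : Type*} [TopologicalSpace H₁] {I₁ : ModelWithCorners ℝ E₁ H₁}
    {M₁ : Type*} [TopologicalSpace M₁] [ChartedSpace H₁ M₁]
    {E₂ : Type*} [NormedAddCommGroup E₂] [NormedSpace ℝ E₂]
    {H₂ : Type*} [TopologicalSpace H₂] {I₂ : ModelWithCorners ℝ E₂ H₂}
    {M₂ : Type*} [TopologicalSpace M₂] [ChartedSpace H₂ M₂]
    {E₃ : Type*} [NormedAddCommGroup E₃] [NormedSpace ℝ E₃]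
    {H₃ : Type*} [TopologicalSpace H₃] {J₁ : ModelWithCorners ℝ E₃ H₃}
    {N₁ : Type*} [TopologicalSpace N₁] [ChartedSpace H₃ N₁]
    {E₄ : Type*} [NormedAddCommGroup E₄] [NormedSpace ℝ E₄]
    {H₄ : Type*} [TopologicalSpace H₄] {J₂ : ModelWithCorners ℝ E₄ H₄}
    {N₂ : Type*} [TopologicalSpace N₂] [ChartedSpace H₄ N₂]
    (g₁ : MetricField I₁ M₁) (g₂ : MetricField I₂ M₂) (f : M₁ → ℝ)
    (h₁ : MetricField J₁ N₁) (h₂ : MetricField J₂ N₂) (ρ : N₁ → ℝ)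
    (φ₁ : M₁ → N₁) (φ₂ : M₂ → N₂) : Prop where
  left : IsRiemannianMap g₁ h₁ φ₁
  right : IsRiemannianMap g₂ h₂ φ₂
  clairaut : IsClairautRiemannianMap (warpedMetric g₁ g₂ f) (warpedMetric h₁ h₂ ρ)
    (Prod.map φ₁ φ₂)

end WarpedClairaut

end

set_option linter.unusedSectionVars false

noncomputable section

namespace WarpedClairaut

open Filter Topology

/-! ### Calculus of bilinear forms and Christoffel symbols in a vector space -/

section Calculus

variable {X : Type*} [NormedAddCommGroup X] [NormedSpace ℝ X]
  {E : Type*} [NormedAddCommGroup E] [NormedSpace ℝ E]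
  {Y : Type*} [NormedAddCommGroup Y] [NormedSpace ℝ Y]
  {Z : Type*} [NormedAddCommGroup Z] [NormedSpace ℝ Z]

/-! Put `β = g - φ^*h`. Since `φ_*` is isometric on horizontal vectors and kills vertical ones, `β =
g(P ·, ·)` with `P` the vertical projector, so `sin² θ · g(v, v) = β(v, v)`. Clairaut's relation
thus makes `r² β(γ', γ') / g(γ', γ')` constant along geodesics. As `g(γ', γ')` is constant too, with
`ℓ = log r` the tensor `e^{2ℓ} β` is Killing: the symmetrization of its covariant derivative
vanishes (`IsRiemannianMap.killing`).

The vertical distribution is involutive, being the kernel of `φ_*`, and the horizontal one is so by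
hypothesis. Together with the Killing equation this determines `∇β` completely
(`killing_form_derivative`, `IsSplittingOn.of_killing`): `dℓ` vanishes on vertical vectors, the
fibres are umbilic with mean curvature field `-grad ℓ`, and the horizontal spaces are totally
geodesic. The Gauss and Codazzi equations then give `Ric = Ric^F - (Δℓ) g` on vertical vectors
(`IsSplittingOn.trace_coordCurvature`).

For the product map, comparing lengths of horizontal vectors of the second factor forces `ρ ∘ φ₁ =
f` (`comp_eq`). Hence `β` is the warped sum of `β₁` and `β₂`, and the splitting of `M` passes to
both factors, with `ℓ` restricted to slices (`IsSplittingOn.fst`, `IsSplittingOn.snd`). On vectors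
tangent to one factor, the Ricci tensor of `M` is `Ric₁ - (m₂ / f) Hess f`, respectively `Ric₂ - κ
g₂` with `κ` depending only on the point of `M₁` (`trace_coordCurvature_warpForm_left`,
`trace_coordCurvature_warpForm_right`). As `f` is constant on the fibres of `φ₁`, `Hess f` and the
Lie derivative of `g₁` along `f ∇f` reduce to multiples of `g₁` on vertical vectors
(`coordHess_vertical`). So the soliton equation of `M` restricts to the fibres up to multiples of
the metric, and these are absorbed into a function `λ`; the constant of the soliton becomes a
function, whence almost solitons.

On the fibres of `φ₂` the outcome is `f(x)² · ½ L_{ξ₂} g₂ + Ric^F + A g₂ = 0`. This is the soliton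
equation for `f(x)² g₂`, since constant rescaling does not change Ricci tensors. For `g₂` itself the
coefficient `f(x)²` has to become `1`: either `f` takes the value `1`, or two such equations with
different values of `f` are combined.

All computations are made in charts. The notions at a point are defined through the preferred chart
there, so changes of chart matter only for geodesics, which leave their base point, and for the
smoothness of `λ`. -/

theorem differentiableAt_of_contDiffAt {f : X → Y} {s : X} (h : ContDiffAt ℝ ∞ f s) :
    DifferentiableAt ℝ f s :=
  h.differentiableAt (by simp)

theorem contDiffAt_fderiv {f : X → Y} {s : X} (h : ContDiffAt ℝ ∞ f s) :
    ContDiffAt ℝ ∞ (fderiv ℝ f) s :=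
  h.fderiv_right (by simp)

theorem fderiv_fderiv_comm {f : X → Y} {s : X} (h : ContDiffAt ℝ ∞ f s) (a b : X) :
    fderiv ℝ (fderiv ℝ f) s a b = fderiv ℝ (fderiv ℝ f) s b a :=
  (h.isSymmSndFDerivAt (by
    rw [minSmoothness_of_isRCLikeNormedField]
    exact WithTop.coe_le_coe.2 (le_top : (2 : ℕ∞) ≤ ⊤))) a b

theorem fderiv_apply_apply {A : X → E →L[ℝ] Y} {W : X → E} {s : X}
    (hA : DifferentiableAt ℝ A s) (hW : DifferentiableAt ℝ W s) (a : X) :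
    fderiv ℝ (fun t => A t (W t)) s a = fderiv ℝ A s a (W s) + A s (fderiv ℝ W s a) := by
  rw [fderiv_clm_apply hA hW]; simp [add_comm]

theorem fderiv_apply_const {A : X → E →L[ℝ] Y} {s : X}
    (hA : DifferentiableAt ℝ A s) (v : E) (a : X) :
    fderiv ℝ (fun t => A t v) s a = fderiv ℝ A s a v := by
  rw [fderiv_apply_apply hA (differentiableAt_const v)]; simp

theorem fderiv_apply₂_apply {A : X → E →L[ℝ] Z →L[ℝ] Y} {V : X → E} {W : X → Z} {s : X}
    (hA : DifferentiableAt ℝ A s) (hV : DifferentiableAt ℝ V s) (hW : DifferentiableAt ℝ W s)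
    (a : X) :
    fderiv ℝ (fun t => A t (V t) (W t)) s a
      = fderiv ℝ A s a (V s) (W s) + A s (fderiv ℝ V s a) (W s) + A s (V s) (fderiv ℝ W s a) := by
  rw [fderiv_apply_apply (hA.clm_apply hV) hW, fderiv_apply_apply hA hV]
  simp

theorem fderiv_apply₂_const {A : X → E →L[ℝ] Z →L[ℝ] Y} {s : X}
    (hA : DifferentiableAt ℝ A s) (v : E) (w : Z) (a : X) :
    fderiv ℝ (fun t => A t v w) s a = fderiv ℝ A s a v w := by
  rw [fderiv_apply₂_apply hA (differentiableAt_const v) (differentiableAt_const w)]; simp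

theorem fderiv_comp_apply {A : E → Y} {ι : X → E} {s : X} (hA : DifferentiableAt ℝ A (ι s))
    (hι : DifferentiableAt ℝ ι s) (a : X) :
    fderiv ℝ (fun t => A (ι t)) s a = fderiv ℝ A (ι s) (fderiv ℝ ι s a) := by
  have := fderiv_comp s hA hι
  simp only [Function.comp_def] at this
  rw [this]; rfl

end Calculus

/-- `G` is a smooth Riemannian metric on the open set `Ω` of the vector space `E`. -/
structure IsMetricOn {E : Type*} [NormedAddCommGroup E] [NormedSpace ℝ E]
    (G : E → E →L[ℝ] E →L[ℝ] ℝ) (Ω : Set E) : Prop where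
  isOpen : IsOpen Ω
  contDiffOn : ContDiffOn ℝ ∞ G Ω
  symm : ∀ u ∈ Ω, ∀ v w, G u v w = G u w v
  pos : ∀ u ∈ Ω, ∀ v, v ≠ 0 → 0 < G u v v

/-! ### Levi-Civita calculus of a metric on an open set of a vector space. -/

section Metric

variable {X : Type*} [NormedAddCommGroup X] [NormedSpace ℝ X]
  {E : Type*} [NormedAddCommGroup E] [NormedSpace ℝ E] [FiniteDimensional ℝ E]
  {G : E → E →L[ℝ] E →L[ℝ] ℝ} {Ω : Set E} {u : E}

/-- `ContinuousLinearMap.inverse` has a default value off the invertible maps, so all raising of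
indices rests on this: a positive form has trivial kernel, and the dual space has the same
dimension. -/
theorem exists_equiv_of_pos (B : E →L[ℝ] E →L[ℝ] ℝ) (hB : ∀ v, v ≠ 0 → 0 < B v v) :
    ∃ e : E ≃L[ℝ] (E →L[ℝ] ℝ), (e : E →L[ℝ] E →L[ℝ] ℝ) = B := by
  have hinj : Function.Injective B.toLinearMap := by
    rw [← LinearMap.ker_eq_bot, LinearMap.ker_eq_bot']
    intro v hv
    by_contra hne
    have h1 := hB v hne
    have h2 : B v = 0 := hv
    simp [h2] at h1
  have hdim : Module.finrank ℝ E = Module.finrank ℝ (E →L[ℝ] ℝ) := by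
    rw [← Subspace.dual_finrank_eq]
    exact (LinearMap.toContinuousLinearMap (𝕜 := ℝ) (E := E) (F' := ℝ)).finrank_eq
  refine ⟨(LinearMap.linearEquivOfInjective _ hinj hdim).toContinuousLinearEquiv, ?_⟩
  ext v w
  rfl

theorem apply_inverse_of_pos {B : E →L[ℝ] E →L[ℝ] ℝ} (hB : ∀ v, v ≠ 0 → 0 < B v v)
    (α : E →L[ℝ] ℝ) : B (ContinuousLinearMap.inverse B α) = α := by
  obtain ⟨e, he⟩ := exists_equiv_of_pos B hB
  rw [← he, ContinuousLinearMap.inverse_equiv]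
  simp

theorem eq_of_forall_apply_eq {B : E →L[ℝ] E →L[ℝ] ℝ} (hB : ∀ v, v ≠ 0 → 0 < B v v)
    {v w : E} (h : ∀ z, B v z = B w z) : v = w := by
  by_contra hne
  have h1 := hB (v - w) (sub_ne_zero.2 hne)
  simp only [map_sub, sub_apply, h, sub_self] at h1
  exact lt_irrefl _ h1

namespace IsMetricOn

theorem contDiffAt (hG : IsMetricOn G Ω) (hu : u ∈ Ω) : ContDiffAt ℝ ∞ G u :=
  hG.contDiffOn.contDiffAt (hG.isOpen.mem_nhds hu)

theorem differentiableAt (hG : IsMetricOn G Ω) (hu : u ∈ Ω) : DifferentiableAt ℝ G u :=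
  differentiableAt_of_contDiffAt (hG.contDiffAt hu)

theorem apply_inverse (hG : IsMetricOn G Ω) (hu : u ∈ Ω) (α : E →L[ℝ] ℝ) :
    G u (ContinuousLinearMap.inverse (G u) α) = α :=
  apply_inverse_of_pos (hG.pos u hu) α

/-- Identities between vectors are proved below by pairing with an arbitrary `z`, which replaces
Christoffel symbols, projectors and gradients by expressions without the inverse of `G`. -/
theorem ext (hG : IsMetricOn G Ω) (hu : u ∈ Ω) {v w : E} (h : ∀ z, G u v z = G u w z) : v = w := by
  by_contra hne
  have h1 := hG.pos u hu (v - w) (sub_ne_zero.2 hne)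
  simp only [map_sub, sub_apply, h, sub_self] at h1
  exact lt_irrefl _ h1

theorem contDiffAt_inverse (hG : IsMetricOn G Ω) (hu : u ∈ Ω) :
    ContDiffAt ℝ ∞ (fun u => ContinuousLinearMap.inverse (G u)) u := by
  obtain ⟨e, he⟩ := exists_equiv_of_pos (G u) (hG.pos u hu)
  have : ContDiffAt ℝ ∞ (ContinuousLinearMap.inverse (R := ℝ) (M := E) (M₂ := E →L[ℝ] ℝ)) (G u) := by
    rw [← he]; exact contDiffAt_map_inverse e
  exact this.comp u (hG.contDiffAt hu)

theorem fderiv_symm (hG : IsMetricOn G Ω) (hu : u ∈ Ω) (a v w : E) :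
    fderiv ℝ G u a v w = fderiv ℝ G u a w v := by
  rw [← fderiv_apply₂_const (hG.differentiableAt hu), ← fderiv_apply₂_const (hG.differentiableAt hu)]
  have : (fun t => G t v w) =ᶠ[𝓝 u] fun t => G t w v := by
    filter_upwards [hG.isOpen.mem_nhds hu] with t ht using hG.symm t ht v w
  rw [this.fderiv_eq]

theorem apply_christoffel (hG : IsMetricOn G Ω) (hu : u ∈ Ω) (v w z : E) :
    G u (christoffel G univ u v w) z =
      (1 / 2) * (fderiv ℝ G u v w z + fderiv ℝ G u w v z - fderiv ℝ G u z v w) := by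
  rw [christoffel_apply, hG.apply_inverse hu, christoffelFirst_apply]
  simp only [fderivWithin_univ]

theorem christoffel_symm (hG : IsMetricOn G Ω) (hu : u ∈ Ω) (v w : E) :
    christoffel G univ u v w = christoffel G univ u w v := by
  refine hG.ext hu fun z => ?_
  rw [hG.apply_christoffel hu, hG.apply_christoffel hu, hG.fderiv_symm hu z v w]
  ring

/-- In the sum of the two Koszul expressions the derivatives in the directions `v` and `w` cancel.
This is metric compatibility, `∇G = 0`. -/
theorem fderiv_apply (hG : IsMetricOn G Ω) (hu : u ∈ Ω) (a v w : E) :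
    fderiv ℝ G u a v w = G u (christoffel G univ u a v) w + G u v (christoffel G univ u a w) := by
  rw [hG.symm u hu v, hG.apply_christoffel hu, hG.apply_christoffel hu, hG.fderiv_symm hu a v w,
    hG.fderiv_symm hu v a w, hG.fderiv_symm hu w a v]
  ring

theorem contDiffAt_christoffelFirst (hG : IsMetricOn G Ω) (hu : u ∈ Ω) :
    ContDiffAt ℝ ∞ (christoffelFirst G univ) u := by
  unfold christoffelFirst
  simp only [fderivWithin_univ]
  have h := contDiffAt_fderiv (hG.contDiffAt hu)
  have hflip : ContDiffAt ℝ ∞ (fun u => (fderiv ℝ G u).flip) u :=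
    ((ContinuousLinearMap.flipₗᵢ ℝ E E (E →L[ℝ] ℝ)).contDiff.contDiffAt).comp u h
  exact ContDiffAt.const_smul (1 / 2 : ℝ)
    ((h.add hflip).sub (contDiffAt_const.clm_comp hflip))

theorem contDiffAt_christoffel (hG : IsMetricOn G Ω) (hu : u ∈ Ω) :
    ContDiffAt ℝ ∞ (christoffel G univ) u := by
  unfold christoffel
  exact ((ContinuousLinearMap.contDiff _).contDiffAt.comp u (hG.contDiffAt_inverse hu)).clm_comp
    (hG.contDiffAt_christoffelFirst hu)

theorem differentiableAt_christoffel (hG : IsMetricOn G Ω) (hu : u ∈ Ω) :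
    DifferentiableAt ℝ (christoffel G univ) u :=
  differentiableAt_of_contDiffAt (hG.contDiffAt_christoffel hu)

end IsMetricOn

/-- The covariant derivative `∇_a W` of a field `W` along the map `ι : X → E`. -/
def covDeriv (G : E → E →L[ℝ] E →L[ℝ] ℝ) (ι W : X → E) (s a : X) : E :=
  fderiv ℝ W s a + christoffel G univ (ι s) (fderiv ℝ ι s a) (W s)

theorem covDeriv_add {ι V W : X → E} {s : X} (hV : DifferentiableAt ℝ V s)
    (hW : DifferentiableAt ℝ W s) (a : X) :
    covDeriv G ι (fun t => V t + W t) s a = covDeriv G ι V s a + covDeriv G ι W s a := by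
  unfold covDeriv
  have : (fun t => V t + W t) = V + W := rfl
  rw [this, fderiv_add hV hW]
  simp only [add_apply, Pi.add_apply, map_add]
  abel

theorem covDeriv_smul {ι W : X → E} {q : X → ℝ} {s : X} (hq : DifferentiableAt ℝ q s)
    (hW : DifferentiableAt ℝ W s) (a : X) :
    covDeriv G ι (fun t => q t • W t) s a
      = fderiv ℝ q s a • W s + q s • covDeriv G ι W s a := by
  unfold covDeriv
  rw [fderiv_fun_smul hq hW]
  simp only [add_apply, smul_apply,
    ContinuousLinearMap.smulRight_apply, map_smul, smul_add]
  abel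

theorem covDeriv_congr {ι V W : X → E} {s : X} (h : V =ᶠ[𝓝 s] W) (a : X) :
    covDeriv G ι V s a = covDeriv G ι W s a := by
  unfold covDeriv
  rw [h.fderiv_eq, h.eq_of_nhds]

theorem covDeriv_comp {ι : X → E} {W : E → E} {s : X} (hι : DifferentiableAt ℝ ι s)
    (hW : DifferentiableAt ℝ W (ι s)) (a : X) :
    covDeriv G ι (fun t => W (ι t)) s a = covDeriv G id W (ι s) (fderiv ℝ ι s a) := by
  unfold covDeriv
  rw [fderiv_comp_apply hW hι]
  simp

namespace IsMetricOn

theorem fderiv_inner (hG : IsMetricOn G Ω) {ι V W : X → E} {s : X} (hs : ι s ∈ Ω)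
    (hι : DifferentiableAt ℝ ι s) (hV : DifferentiableAt ℝ V s) (hW : DifferentiableAt ℝ W s)
    (a : X) :
    fderiv ℝ (fun t => G (ι t) (V t) (W t)) s a
      = G (ι s) (covDeriv G ι V s a) (W s) + G (ι s) (V s) (covDeriv G ι W s a) := by
  have hGι : DifferentiableAt ℝ (fun t => G (ι t)) s := (hG.differentiableAt hs).comp s hι
  rw [fderiv_apply₂_apply hGι hV hW, fderiv_comp_apply (hG.differentiableAt hs) hι,
    hG.fderiv_apply hs]
  simp only [covDeriv, map_add, add_apply]
  ring

/-- The second derivatives of `W` and of `ι` are symmetric, so antisymmetrizing leaves only the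
terms of the curvature. The constant directions `a`, `b` commute, hence no bracket term. -/
theorem covDeriv_comm (hG : IsMetricOn G Ω) {ι W : X → E} {s : X} (hs : ι s ∈ Ω)
    (hι : ContDiffAt ℝ ∞ ι s) (hW : ContDiffAt ℝ ∞ W s) (a b : X) :
    covDeriv G ι (fun t => covDeriv G ι W t b) s a - covDeriv G ι (fun t => covDeriv G ι W t a) s b
      = coordCurvature G univ (ι s) (fderiv ℝ ι s b) (W s) (fderiv ℝ ι s a) := by
  have key : ∀ a b : X, fderiv ℝ (fun t => covDeriv G ι W t b) s a
      = fderiv ℝ (fderiv ℝ W) s a b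
        + (fderiv ℝ (christoffel G univ) (ι s) (fderiv ℝ ι s a) (fderiv ℝ ι s b) (W s)
          + christoffel G univ (ι s) (fderiv ℝ (fderiv ℝ ι) s a b) (W s)
          + christoffel G univ (ι s) (fderiv ℝ ι s b) (fderiv ℝ W s a)) := by
    intro a b
    have hDW := differentiableAt_of_contDiffAt (contDiffAt_fderiv hW)
    have hDι := differentiableAt_of_contDiffAt (contDiffAt_fderiv hι)
    have hι' := differentiableAt_of_contDiffAt hι
    have hW' := differentiableAt_of_contDiffAt hW
    have hΓ := hG.differentiableAt_christoffel hs
    have hΓι : DifferentiableAt ℝ (fun t => christoffel G univ (ι t)) s := hΓ.comp s hι'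
    have h1 : DifferentiableAt ℝ (fun t => fderiv ℝ W t b) s :=
      hDW.clm_apply (differentiableAt_const b)
    have h2 : DifferentiableAt ℝ (fun t => fderiv ℝ ι t b) s :=
      hDι.clm_apply (differentiableAt_const b)
    have h3 : DifferentiableAt ℝ
        (fun t => christoffel G univ (ι t) (fderiv ℝ ι t b) (W t)) s :=
      (hΓι.clm_apply h2).clm_apply hW'
    have : (fun t => covDeriv G ι W t b)
        = (fun t => fderiv ℝ W t b) + fun t => christoffel G univ (ι t) (fderiv ℝ ι t b) (W t) := rfl
    rw [this, fderiv_add h1 h3, add_apply, fderiv_apply_const hDW,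
      fderiv_apply₂_apply hΓι h2 hW', fderiv_comp_apply hΓ hι', fderiv_apply_const hDι]
  have e : ∀ (V : X → E) (c : X), covDeriv G ι V s c
      = fderiv ℝ V s c + christoffel G univ (ι s) (fderiv ℝ ι s c) (V s) := fun _ _ => rfl
  rw [e (fun t => covDeriv G ι W t b) a, e (fun t => covDeriv G ι W t a) b, key, key, coordCurvature_apply, fderiv_fderiv_comm hW a b,
    fderiv_fderiv_comm hι a b, fderivWithin_univ]
  simp only [covDeriv, map_add]
  abel

/-- The tangential part of the derivative of an isometric immersion is given by the Christoffel
symbols of the induced metric. -/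
theorem inner_covDeriv_fderiv (hG : IsMetricOn G Ω) [FiniteDimensional ℝ X]
    {GF : X → X →L[ℝ] X →L[ℝ] ℝ}
    {U : Set X} (hGF : IsMetricOn GF U) {ι : X → E} {s : X} (hs : ι s ∈ Ω) (hsU : s ∈ U)
    (hι : ContDiffAt ℝ ∞ ι s)
    (hiso : ∀ᶠ t in 𝓝 s, ∀ v w, GF t v w = G (ι t) (fderiv ℝ ι t v) (fderiv ℝ ι t w))
    (a b c : X) :
    G (ι s) (covDeriv G ι (fun t => fderiv ℝ ι t b) s a) (fderiv ℝ ι s c)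
      = G (ι s) (fderiv ℝ ι s (christoffel GF univ s a b)) (fderiv ℝ ι s c) := by
  have hι' := differentiableAt_of_contDiffAt hι
  have hDι : ∀ b, DifferentiableAt ℝ (fun t => fderiv ℝ ι t b) s := fun b =>
    (differentiableAt_of_contDiffAt (contDiffAt_fderiv hι)).clm_apply (differentiableAt_const b)
  -- Torsion-freeness along `ι`.
  have hsym : ∀ a b, covDeriv G ι (fun t => fderiv ℝ ι t b) s a
      = covDeriv G ι (fun t => fderiv ℝ ι t a) s b := by
    intro a b
    have hD := differentiableAt_of_contDiffAt (contDiffAt_fderiv hι)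
    rw [covDeriv, covDeriv, fderiv_apply_const hD, fderiv_apply_const hD, fderiv_fderiv_comm hι a b,
      hG.christoffel_symm hs]
  -- Metric compatibility along `ι` expresses the derivatives of the induced metric. With `hsym`,
  -- their Koszul combination collapses to a single term.
  have hder : ∀ a b c, fderiv ℝ GF s a b c
      = G (ι s) (covDeriv G ι (fun t => fderiv ℝ ι t b) s a) (fderiv ℝ ι s c)
        + G (ι s) (covDeriv G ι (fun t => fderiv ℝ ι t c) s a) (fderiv ℝ ι s b) := by
    intro a b c
    rw [← fderiv_apply₂_const (hGF.differentiableAt hsU)]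
    have : (fun t => GF t b c) =ᶠ[𝓝 s] fun t => G (ι t) (fderiv ℝ ι t b) (fderiv ℝ ι t c) := by
      filter_upwards [hiso] with t ht using ht b c
    rw [this.fderiv_eq, hG.fderiv_inner hs hι' (hDι b) (hDι c),
      hG.symm _ hs (fderiv ℝ ι s b)]
  rw [← hiso.self_of_nhds, hGF.apply_christoffel hsU, hder a b c, hder b a c, hder c a b,
    hsym b a, hsym c a, hsym c b]
  ring

end IsMetricOn

end Metric

/-! ### Riemannian splittings with umbilic vertical and totally geodesic horizontal spaces -/

section Splitting

variable {X : Type*} [NormedAddCommGroup X] [NormedSpace ℝ X] [FiniteDimensional ℝ X]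
  {E : Type*} [NormedAddCommGroup E] [NormedSpace ℝ E] [FiniteDimensional ℝ E]
  {G β : E → E →L[ℝ] E →L[ℝ] ℝ} {ℓ : E → ℝ} {Ω : Set E} {u : E}

/-- The endomorphism `P` with `β = G (P ·, ·)`. -/
def proj (G β : E → E →L[ℝ] E →L[ℝ] ℝ) (u : E) : E →L[ℝ] E :=
  (ContinuousLinearMap.inverse (G u)).comp (β u)

/-- The gradient of `ℓ` with respect to the metric `G` of `E`. -/
def coordGrad (G : E → E →L[ℝ] E →L[ℝ] ℝ) (ℓ : E → ℝ) (u : E) : E :=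
  ContinuousLinearMap.inverse (G u) (fderiv ℝ ℓ u)

/-- The divergence of the field `W` on `E`, as the trace of `a ↦ ∇_a W`. -/
def coordDiv (G : E → E →L[ℝ] E →L[ℝ] ℝ) (W : E → E) (u : E) : ℝ :=
  LinearMap.trace ℝ E
    (fderiv ℝ W u + (christoffel G univ u).flip (W u) : E →L[ℝ] E).toLinearMap

namespace IsMetricOn

theorem apply_proj (hG : IsMetricOn G Ω) (hu : u ∈ Ω) (v : E) : G u (proj G β u v) = β u v :=
  hG.apply_inverse hu _

theorem apply_coordGrad (hG : IsMetricOn G Ω) (hu : u ∈ Ω) :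
    G u (coordGrad G ℓ u) = fderiv ℝ ℓ u :=
  hG.apply_inverse hu _

theorem contDiffAt_proj (hG : IsMetricOn G Ω) (hu : u ∈ Ω) (hβ : ContDiffAt ℝ ∞ β u) :
    ContDiffAt ℝ ∞ (proj G β) u :=
  (hG.contDiffAt_inverse hu).clm_comp hβ

theorem contDiffAt_coordGrad (hG : IsMetricOn G Ω) (hu : u ∈ Ω) (hℓ : ContDiffAt ℝ ∞ ℓ u) :
    ContDiffAt ℝ ∞ (coordGrad G ℓ) u :=
  (hG.contDiffAt_inverse hu).clm_apply (contDiffAt_fderiv hℓ)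

end IsMetricOn

/-- The form `β = G (P ·, ·)` of the orthogonal projectors `P` of `(E, G)` onto the spaces of a
distribution, such that `P` kills the gradient of `ℓ` and
`(∇_a β)(b, c) = - dℓ(c) β(a, b) - dℓ(b) β(a, c)`: the distribution has umbilic integral manifolds
with mean curvature field `- grad ℓ`, and its orthogonal complement is totally geodesic. -/
structure IsSplittingOn (G β : E → E →L[ℝ] E →L[ℝ] ℝ) (ℓ : E → ℝ) (Ω : Set E) : Prop where
  metric : IsMetricOn G Ω
  contDiffOn : ContDiffOn ℝ ∞ β Ω
  contDiffOn_pot : ContDiffOn ℝ ∞ ℓ Ω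
  symm : ∀ u ∈ Ω, ∀ v w, β u v w = β u w v
  idem : ∀ u ∈ Ω, ∀ v, proj G β u (proj G β u v) = proj G β u v
  basic : ∀ u ∈ Ω, ∀ v, fderiv ℝ ℓ u (proj G β u v) = 0
  deriv : ∀ u ∈ Ω, ∀ a b c, fderiv ℝ β u a b c
      = β u (christoffel G univ u a b) c + β u b (christoffel G univ u a c)
        - fderiv ℝ ℓ u c * β u a b - fderiv ℝ ℓ u b * β u a c

namespace IsSplittingOn

theorem contDiffAt (h : IsSplittingOn G β ℓ Ω) (hu : u ∈ Ω) : ContDiffAt ℝ ∞ β u :=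
  h.contDiffOn.contDiffAt (h.metric.isOpen.mem_nhds hu)

theorem contDiffAt_pot (h : IsSplittingOn G β ℓ Ω) (hu : u ∈ Ω) : ContDiffAt ℝ ∞ ℓ u :=
  h.contDiffOn_pot.contDiffAt (h.metric.isOpen.mem_nhds hu)

theorem contDiffAt_proj (h : IsSplittingOn G β ℓ Ω) (hu : u ∈ Ω) : ContDiffAt ℝ ∞ (proj G β) u :=
  h.metric.contDiffAt_proj hu (h.contDiffAt hu)

theorem contDiffAt_coordGrad (h : IsSplittingOn G β ℓ Ω) (hu : u ∈ Ω) :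
    ContDiffAt ℝ ∞ (coordGrad G ℓ) u :=
  h.metric.contDiffAt_coordGrad hu (h.contDiffAt_pot hu)

theorem proj_coordGrad (h : IsSplittingOn G β ℓ Ω) (hu : u ∈ Ω) :
    proj G β u (coordGrad G ℓ u) = 0 := by
  refine h.metric.ext hu fun z => ?_
  rw [h.metric.apply_proj hu, h.symm u hu, ← h.metric.apply_proj hu, h.metric.symm u hu,
    h.metric.apply_coordGrad hu, h.basic u hu]
  simp

theorem form_coordGrad (h : IsSplittingOn G β ℓ Ω) (hu : u ∈ Ω) (v : E) :
    β u v (coordGrad G ℓ u) = 0 := by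
  rw [h.symm u hu, ← h.metric.apply_proj hu, h.proj_coordGrad hu]
  simp

/-- Differentiate `G (P W, z) = β (W, z)` along `ι` and insert the formula for the derivative of
`β`. Every later use of the splitting condition for second-order information goes through this
commutation rule for `∇` and `P`. -/
theorem covDeriv_proj (h : IsSplittingOn G β ℓ Ω) {ι W : X → E} {s : X} (hs : ι s ∈ Ω)
    (hι : DifferentiableAt ℝ ι s) (hW : DifferentiableAt ℝ W s) (a : X) :
    covDeriv G ι (fun t => proj G β (ι t) (W t)) s a
      = proj G β (ι s) (covDeriv G ι W s a)
        - β (ι s) (fderiv ℝ ι s a) (W s) • coordGrad G ℓ (ι s)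
        - fderiv ℝ ℓ (ι s) (W s) • proj G β (ι s) (fderiv ℝ ι s a) := by
  have hG := h.metric
  refine hG.ext hs fun z => ?_
  have hβ := differentiableAt_of_contDiffAt (h.contDiffAt hs)
  have hβι : DifferentiableAt ℝ (fun t => β (ι t)) s := hβ.comp s hι
  have hP := differentiableAt_of_contDiffAt (h.contDiffAt_proj hs)
  have hPι : DifferentiableAt ℝ (fun t => proj G β (ι t)) s := hP.comp s hι
  have h1 : fderiv ℝ (fun t => G (ι t) (proj G β (ι t) (W t)) z) s a
      = fderiv ℝ (fun t => β (ι t) (W t) z) s a := by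
    refine congrArg (fun L : X →L[ℝ] ℝ => L a) (EventuallyEq.fderiv_eq ?_)
    filter_upwards [hι.continuousAt (hG.isOpen.mem_nhds hs)] with t ht
    rw [hG.apply_proj ht]
  rw [hG.fderiv_inner hs hι (hPι.clm_apply hW) (differentiableAt_const z),
    fderiv_apply₂_apply hβι hW (differentiableAt_const z), fderiv_comp_apply hβ hι,
    hG.apply_proj hs, h.deriv _ hs] at h1
  simp only [map_sub, map_smul, sub_apply, smul_apply, hG.apply_proj hs, hG.apply_coordGrad hs,
    smul_eq_mul]
  simp only [covDeriv, map_add, add_apply, fderiv_fun_const, Pi.zero_apply,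
    zero_apply, map_zero, add_zero, zero_add] at h1 ⊢
  linear_combination h1

/-- The commutation rule applied to `grad ℓ`, which `P` kills. It is the shape operator of the
integral manifolds in the direction of their mean curvature. -/
theorem proj_covDeriv_coordGrad (h : IsSplittingOn G β ℓ Ω) (hu : u ∈ Ω) (a : E) :
    proj G β u (covDeriv G id (coordGrad G ℓ) u a)
      = fderiv ℝ ℓ u (coordGrad G ℓ u) • proj G β u a := by
  have hn := differentiableAt_of_contDiffAt (h.contDiffAt_coordGrad hu)
  have h1 := h.covDeriv_proj (ι := id) hu differentiableAt_id hn a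
  have h2 : (fun t => proj G β (id t) (coordGrad G ℓ t)) =ᶠ[𝓝 u] fun _ => (0 : E) := by
    filter_upwards [h.metric.isOpen.mem_nhds hu] with t ht using h.proj_coordGrad ht
  rw [covDeriv_congr h2] at h1
  simp only [covDeriv, fderiv_fun_const, Pi.zero_apply, zero_apply, map_zero,
    add_zero, id_eq, fderiv_id, ContinuousLinearMap.id_apply, h.form_coordGrad hu, zero_smul,
    sub_zero] at h1 ⊢
  exact (sub_eq_zero.1 h1.symm)

/-- The horizontal part of `R(a, b) w` for vertical `b`, `w` and arbitrary `a`: the Codazzi equation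
when `a` is vertical, the mixed curvature when `a` is horizontal. It comes from differentiating a
vertical extension of `w` twice by `covDeriv_proj` and discarding vertical terms. -/
theorem horizontal_curvature (h : IsSplittingOn G β ℓ Ω) (hu : u ∈ Ω) {b w : E}
    (hb : proj G β u b = b) (hw : proj G β u w = w) (a : E) :
    coordCurvature G univ u b w a - proj G β u (coordCurvature G univ u b w a)
      = β u a w • (covDeriv G id (coordGrad G ℓ) u b
            - proj G β u (covDeriv G id (coordGrad G ℓ) u b))
        - β u b w • (fderiv ℝ ℓ u a • coordGrad G ℓ u + (covDeriv G id (coordGrad G ℓ) u a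
            - proj G β u (covDeriv G id (coordGrad G ℓ) u a))) := by
  have hG := h.metric
  have hβ := differentiableAt_of_contDiffAt (h.contDiffAt hu)
  have hΓ := hG.differentiableAt_christoffel hu
  have hn := differentiableAt_of_contDiffAt (h.contDiffAt_coordGrad hu)
  have hP := differentiableAt_of_contDiffAt (h.contDiffAt_proj hu)
  have hDℓ := differentiableAt_of_contDiffAt (contDiffAt_fderiv (h.contDiffAt_pot hu))
  have hℓb : fderiv ℝ ℓ u b = 0 := by rw [← hb]; exact h.basic u hu b
  have hℓw : fderiv ℝ ℓ u w = 0 := by rw [← hw]; exact h.basic u hu w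
  -- The vector `w` is extended to the vertical field `t ↦ P t w`, whose value at `u` is `w`.
  have hW : ContDiffAt ℝ ∞ (fun t => proj G β t w) u :=
    (h.contDiffAt_proj hu).clm_apply contDiffAt_const
  have hcomm := hG.covDeriv_comm (ι := id) hu contDiffAt_id hW a b
  -- An identity of germs is needed, as this first derivative is differentiated once more.
  have hfst : ∀ b : E, (fun t => covDeriv G id (fun t => proj G β t w) t b) =ᶠ[𝓝 u]
      fun t => proj G β t (christoffel G univ t b w)
        + ((-β t b w) • coordGrad G ℓ t + (-fderiv ℝ ℓ t w) • proj G β t b) := by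
    intro b
    filter_upwards [hG.isOpen.mem_nhds hu] with t ht
    have := h.covDeriv_proj (ι := id) (W := fun _ => w) ht differentiableAt_id
      (differentiableAt_const w) b
    simp only [id_eq] at this
    rw [this]
    simp only [covDeriv, fderiv_fun_const, Pi.zero_apply, zero_apply, id_eq,
      fderiv_id, ContinuousLinearMap.id_apply, zero_add]
    module
  have hsnd : ∀ a b : E, covDeriv G id (fun t => covDeriv G id (fun t => proj G β t w) t b) u a
      - proj G β u (covDeriv G id (fun t => covDeriv G id (fun t => proj G β t w) t b) u a)
      = -(β u a (christoffel G univ u b w) + fderiv ℝ β u a b w) • coordGrad G ℓ u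
        - β u b w • (covDeriv G id (coordGrad G ℓ) u a
          - proj G β u (covDeriv G id (coordGrad G ℓ) u a)) := by
    intro a b
    have d1 : DifferentiableAt ℝ (fun t => christoffel G univ t b w) u :=
      (hΓ.clm_apply (differentiableAt_const b)).clm_apply (differentiableAt_const w)
    have d2 : DifferentiableAt ℝ (fun t => proj G β t (christoffel G univ t b w)) u :=
      hP.clm_apply d1
    have d3 : DifferentiableAt ℝ (fun t => -β t b w) u :=
      ((hβ.clm_apply (differentiableAt_const b)).clm_apply (differentiableAt_const w)).neg
    have d4 : DifferentiableAt ℝ (fun t => -fderiv ℝ ℓ t w) u :=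
      (hDℓ.clm_apply (differentiableAt_const w)).neg
    have d5 : DifferentiableAt ℝ (fun t => proj G β t b) u :=
      hP.clm_apply (differentiableAt_const b)
    have d6 : DifferentiableAt ℝ (fun t => (-β t b w) • coordGrad G ℓ t) u := d3.smul hn
    have d7 : DifferentiableAt ℝ (fun t => (-fderiv ℝ ℓ t w) • proj G β t b) u := d4.smul d5
    rw [covDeriv_congr (hfst b), covDeriv_add d2 (d6.fun_add d7), covDeriv_add d6 d7,
      covDeriv_smul d3 hn, covDeriv_smul d4 d5]
    have e1 := h.covDeriv_proj (ι := id) hu differentiableAt_id d1 a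
    have e2 := h.covDeriv_proj (ι := id) (W := fun _ => b) hu differentiableAt_id
      (differentiableAt_const b) a
    simp only [id_eq, fderiv_id, ContinuousLinearMap.id_apply] at e1 e2
    have e3 : fderiv ℝ (fun t => -β t b w) u a = -fderiv ℝ β u a b w := by
      rw [fderiv_fun_neg, neg_apply, fderiv_apply₂_const hβ]
    rw [e1, e2, e3, hℓw]
    simp only [map_add, map_sub, map_smul, h.proj_coordGrad hu, h.idem u hu, neg_zero, zero_smul,
      smul_zero, add_zero, sub_zero]
    module
  have hPc := congrArg (fun z => z - proj G β u z) hcomm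
  simp only [map_sub, id_eq, fderiv_id, ContinuousLinearMap.id_apply, hw] at hPc
  rw [← hPc, sub_sub_sub_comm, hsnd a b, hsnd b a, h.deriv u hu, h.deriv u hu,
    hG.christoffel_symm hu b a, hℓb, hℓw, h.symm u hu b (christoffel G univ u a w),
    h.symm u hu a (christoffel G univ u b w), h.symm u hu b a]
  module

end IsSplittingOn

end Splitting

/-! ### The Gauss equation and the Ricci tensor of umbilic integral manifolds. -/

section Fibre

variable {X : Type*} [NormedAddCommGroup X] [NormedSpace ℝ X] [FiniteDimensional ℝ X]
  {E : Type*} [NormedAddCommGroup E] [NormedSpace ℝ E] [FiniteDimensional ℝ E]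
  {G β : E → E →L[ℝ] E →L[ℝ] ℝ} {ℓ : E → ℝ} {Ω : Set E} {u : E}
  {GF : X → X →L[ℝ] X →L[ℝ] ℝ} {U : Set X} {ι : X → E} {s : X}

/-- The trace of an endomorphism compressed to the range of a projector. -/
theorem trace_comp_projector {P A : E →ₗ[ℝ] E} {D : X →ₗ[ℝ] E} {B : X →ₗ[ℝ] X}
    (hD : Function.Injective D) (hPD : ∀ v, P v = v ↔ ∃ a, D a = v) (hP : ∀ v, P (P v) = P v)
    (hA : ∀ a, P (A (D a)) = D (B a)) :
    LinearMap.trace ℝ E (P ∘ₗ A) = LinearMap.trace ℝ X B := by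
  have hex : ∀ v, ∃ a, D a = P v := fun v => (hPD (P v)).1 (hP v)
  choose f hL using hex
  let L : E →ₗ[ℝ] X :=
    { toFun := f
      map_add' := fun v w => hD (by simp [hL])
      map_smul' := fun c v => hD (by simp [hL]) }
  replace hL : ∀ v, D (L v) = P v := hL
  -- `P` factors as `D ∘ L`; cyclicity of the trace moves `D` to the other end, and `L ∘ A ∘ D = B`.
  have h1 : P ∘ₗ A = D ∘ₗ (L ∘ₗ A) := by
    ext v; simp [hL]
  rw [h1, LinearMap.trace_comp_comm' (L ∘ₗ A) D]
  congr 1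
  ext a
  exact hD (by simp [hL, hA])

theorem trace_smulRight_clm (f : E →L[ℝ] ℝ) (x : E) :
    LinearMap.trace ℝ E (f.smulRight x : E →L[ℝ] E).toLinearMap = f x :=
  LinearMap.trace_smulRight f.toLinearMap x

/-- `ι` parametrizes an integral manifold of the distribution of the spaces `range P`, with induced
metric `GF`, near `s`. -/
structure IsIntegralParam (G β : E → E →L[ℝ] E →L[ℝ] ℝ) (Ω : Set E)
    (GF : X → X →L[ℝ] X →L[ℝ] ℝ) (U : Set X) (ι : X → E) (s : X) : Prop where
  metric : IsMetricOn GF U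
  mem : s ∈ U
  smooth : ∀ᶠ t in 𝓝 s, ContDiffAt ℝ ∞ ι t
  maps : ∀ᶠ t in 𝓝 s, ι t ∈ Ω
  iso : ∀ᶠ t in 𝓝 s, ∀ v w, GF t v w = G (ι t) (fderiv ℝ ι t v) (fderiv ℝ ι t w)
  range : ∀ᶠ t in 𝓝 s, ∀ v, proj G β (ι t) v = v ↔ ∃ a, fderiv ℝ ι t a = v

namespace IsIntegralParam

/-- The conditions are open in the base point, so identities derived from them hold near `s` and may
be differentiated. -/
theorem eventually (h : IsIntegralParam G β Ω GF U ι s) :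
    ∀ᶠ t in 𝓝 s, IsIntegralParam G β Ω GF U ι t := by
  filter_upwards [h.smooth.eventually_nhds, h.maps.eventually_nhds, h.iso.eventually_nhds,
    h.range.eventually_nhds, h.metric.isOpen.mem_nhds h.mem] with t h1 h2 h3 h4 h5
  exact ⟨h.metric, h5, h1, h2, h3, h4⟩

theorem proj_fderiv (h : IsIntegralParam G β Ω GF U ι s) (a : X) :
    proj G β (ι s) (fderiv ℝ ι s a) = fderiv ℝ ι s a :=
  (h.range.self_of_nhds _).2 ⟨a, rfl⟩

theorem injective (h : IsIntegralParam G β Ω GF U ι s) : Function.Injective (fderiv ℝ ι s) := by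
  refine (injective_iff_map_eq_zero _).2 fun a ha => ?_
  by_contra hne
  have := h.metric.pos s h.mem a hne
  rw [h.iso.self_of_nhds, ha] at this
  simp at this

end IsIntegralParam

namespace IsSplittingOn

/-- The Gauss formula. Each field `∂_b ι` is fixed by `P`, so `covDeriv_proj` splits its derivative
into a vertical part and a multiple of `grad ℓ`; `inner_covDeriv_fderiv` identifies the vertical
part. -/
theorem covDeriv_fderiv (h : IsSplittingOn G β ℓ Ω) (hι : IsIntegralParam G β Ω GF U ι s)
    (a b : X) :
    covDeriv G ι (fun t => fderiv ℝ ι t b) s a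
      = fderiv ℝ ι s (christoffel GF univ s a b) - GF s a b • coordGrad G ℓ (ι s) := by
  have hG := h.metric
  have hs := hι.maps.self_of_nhds
  have hιs := hι.smooth.self_of_nhds
  have hι' := differentiableAt_of_contDiffAt hιs
  have hD : DifferentiableAt ℝ (fun t => fderiv ℝ ι t b) s :=
    (differentiableAt_of_contDiffAt (contDiffAt_fderiv hιs)).clm_apply (differentiableAt_const b)
  have h1 := h.covDeriv_proj hs hι' hD a
  have h2 : (fun t => proj G β (ι t) (fderiv ℝ ι t b)) =ᶠ[𝓝 s] fun t => fderiv ℝ ι t b := by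
    filter_upwards [hι.eventually] with t ht using ht.proj_fderiv b
  have hℓ : fderiv ℝ ℓ (ι s) (fderiv ℝ ι s b) = 0 := by
    rw [← hι.proj_fderiv b]; exact h.basic _ hs _
  have hβ : β (ι s) (fderiv ℝ ι s a) (fderiv ℝ ι s b) = GF s a b := by
    rw [← hG.apply_proj hs, hι.proj_fderiv, ← hι.iso.self_of_nhds]
  rw [covDeriv_congr h2, hℓ, hβ, zero_smul, sub_zero] at h1
  rw [h1]
  congr 1
  obtain ⟨z, hz⟩ := (hι.range.self_of_nhds _).1
    (h.idem _ hs (covDeriv G ι (fun t => fderiv ℝ ι t b) s a))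
  rw [← hz]
  congr 1
  refine hι.metric.ext hι.mem fun c => ?_
  have h3 := hG.inner_covDeriv_fderiv hι.metric hs hι.mem hιs hι.iso a b c
  rw [hι.iso.self_of_nhds, hι.iso.self_of_nhds, ← h3, hz, hG.apply_proj hs, h.symm _ hs,
    ← hG.apply_proj hs, hι.proj_fderiv, hG.symm _ hs]

/-- The Gauss equation: apply the Gauss formula twice and project. `P` kills `n = grad ℓ`, and the
vertical part of `∇_a n` is `|n|² a` for vertical `a`, which produces the correction. -/
theorem vertical_curvature (h : IsSplittingOn G β ℓ Ω) (hι : IsIntegralParam G β Ω GF U ι s)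
    (a b c : X) :
    proj G β (ι s) (coordCurvature G univ (ι s) (fderiv ℝ ι s b) (fderiv ℝ ι s c) (fderiv ℝ ι s a))
      = fderiv ℝ ι s (coordCurvature GF univ s b c a
          - fderiv ℝ ℓ (ι s) (coordGrad G ℓ (ι s)) • (GF s b c • a - GF s a c • b)) := by
  have hG := h.metric
  have hs := hι.maps.self_of_nhds
  have hιs := hι.smooth.self_of_nhds
  have hι' := differentiableAt_of_contDiffAt hιs
  have hD : ContDiffAt ℝ ∞ (fun t => fderiv ℝ ι t c) s :=
    (contDiffAt_fderiv hιs).clm_apply contDiffAt_const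
  have hn := differentiableAt_of_contDiffAt (h.contDiffAt_coordGrad hs)
  have hnι : DifferentiableAt ℝ (fun t => coordGrad G ℓ (ι t)) s := hn.comp s hι'
  have hΓ := hι.metric.differentiableAt_christoffel hι.mem
  have hcomm := hG.covDeriv_comm hs hιs hD a b
  have key : ∀ a b : X, proj G β (ι s)
      (covDeriv G ι (fun t => covDeriv G ι (fun t => fderiv ℝ ι t c) t b) s a)
      = fderiv ℝ ι s (fderiv ℝ (christoffel GF univ) s a b c
          + christoffel GF univ s a (christoffel GF univ s b c)
          - (GF s b c * fderiv ℝ ℓ (ι s) (coordGrad G ℓ (ι s))) • a) := by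
    intro a b
    have h1 : (fun t => covDeriv G ι (fun t => fderiv ℝ ι t c) t b) =ᶠ[𝓝 s]
        fun t => fderiv ℝ ι t (christoffel GF univ t b c) + (-GF t b c) • coordGrad G ℓ (ι t) := by
      filter_upwards [hι.eventually] with t ht
      rw [h.covDeriv_fderiv ht]
      module
    have dG : DifferentiableAt ℝ (fun t => -GF t b c) s :=
      (((hι.metric.differentiableAt hι.mem).clm_apply (differentiableAt_const b)).clm_apply
        (differentiableAt_const c)).neg
    have dZ : DifferentiableAt ℝ (fun t => christoffel GF univ t b c) s :=
      (hΓ.clm_apply (differentiableAt_const b)).clm_apply (differentiableAt_const c)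
    have dι := differentiableAt_of_contDiffAt (contDiffAt_fderiv hιs)
    have d1 : DifferentiableAt ℝ (fun t => fderiv ℝ ι t (christoffel GF univ t b c)) s :=
      dι.clm_apply dZ
    have d2 : DifferentiableAt ℝ (fun t => (-GF t b c) • coordGrad G ℓ (ι t)) s := dG.smul hnι
    have e1 : covDeriv G ι (fun t => fderiv ℝ ι t (christoffel GF univ t b c)) s a
        = fderiv ℝ ι s (fderiv ℝ (christoffel GF univ) s a b c)
          + covDeriv G ι (fun t => fderiv ℝ ι t (christoffel GF univ s b c)) s a := by
      simp only [covDeriv]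
      rw [fderiv_apply_apply dι dZ, fderiv_apply_const dι, fderiv_apply₂_const hΓ]
      abel
    rw [covDeriv_congr h1, covDeriv_add d1 d2, covDeriv_smul dG hnι, e1, h.covDeriv_fderiv hι,
      covDeriv_comp hι' hn]
    simp only [map_add, map_sub, map_smul, h.proj_coordGrad hs, h.proj_covDeriv_coordGrad hs,
      hι.proj_fderiv, smul_zero, sub_zero, zero_add, smul_smul]
    module
  rw [← hcomm, map_sub, key, key, ← map_sub, coordCurvature_apply, fderivWithin_univ]
  congr 1
  module

/-- The Ricci curvature of an umbilic fibre of a Riemannian splitting. -/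
theorem trace_coordCurvature (h : IsSplittingOn G β ℓ Ω) (hι : IsIntegralParam G β Ω GF U ι s)
    (b c : X) :
    LinearMap.trace ℝ E
        (coordCurvature G univ (ι s) (fderiv ℝ ι s b) (fderiv ℝ ι s c)).toLinearMap
      = LinearMap.trace ℝ X (coordCurvature GF univ s b c).toLinearMap
        - coordDiv G (coordGrad G ℓ) (ι s) * GF s b c := by
  have hG := h.metric
  have hs := hι.maps.self_of_nhds
  set P := proj G β (ι s) with hP
  set R := coordCurvature G univ (ι s) (fderiv ℝ ι s b) (fderiv ℝ ι s c) with hR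
  set n := coordGrad G ℓ (ι s) with hn
  set q := fderiv ℝ ℓ (ι s) n with hq
  set N : E →L[ℝ] E := fderiv ℝ (coordGrad G ℓ) (ι s)
    + (christoffel G univ (ι s)).flip (coordGrad G ℓ (ι s)) with hN
  have hNa : ∀ a, covDeriv G id (coordGrad G ℓ) (ι s) a = N a := by
    intro a; simp [covDeriv, hN]
  have hPP : ∀ v, P (P v) = P v := h.idem _ hs
  have hβ : β (ι s) (fderiv ℝ ι s b) (fderiv ℝ ι s c) = GF s b c := by
    rw [← hG.apply_proj hs, hι.proj_fderiv, ← hι.iso.self_of_nhds]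
  -- the vertical part of the trace
  have t1 := trace_comp_projector (P := P.toLinearMap) (A := R.toLinearMap)
    (D := (fderiv ℝ ι s).toLinearMap)
    (B := (coordCurvature GF univ s b c).toLinearMap
      - q • (GF s b c • LinearMap.id - ((GF s).flip c).toLinearMap.smulRight b))
    hι.injective hι.range.self_of_nhds hPP
    (fun a => by
      refine (h.vertical_curvature hι a b c).trans ?_
      simp [hq, hn])
  have t2 := trace_comp_projector (P := P.toLinearMap) (A := LinearMap.id)
    (D := (fderiv ℝ ι s).toLinearMap) (B := LinearMap.id)
    hι.injective hι.range.self_of_nhds hPP (fun a => hι.proj_fderiv a)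
  -- the horizontal part of the trace
  have t3 : R - P.comp R = ((β (ι s)).flip (fderiv ℝ ι s c)).smulRight
        (N (fderiv ℝ ι s b) - P (N (fderiv ℝ ι s b)))
      - GF s b c • ((fderiv ℝ ℓ (ι s)).smulRight n + (N - P.comp N)) := by
    ext a
    have := h.horizontal_curvature hs (hι.proj_fderiv b) (hι.proj_fderiv c) a
    rw [hβ] at this
    simp only [hNa] at this
    exact this
  have t4 : P.comp N = q • P := by
    ext a
    have := h.proj_covDeriv_coordGrad hs a
    rw [hNa] at this
    exact this
  -- The rank-one term of `t3` pairs a horizontal vector with a vertical one, so its trace is zero.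
  have t5 : β (ι s) (N (fderiv ℝ ι s b) - P (N (fderiv ℝ ι s b))) (fderiv ℝ ι s c) = 0 := by
    rw [← hG.apply_proj hs, map_sub, h.idem _ hs, sub_self]; simp
  simp only [map_sub, sub_apply] at t5
  have e3 := congrArg (fun L : E →L[ℝ] E => LinearMap.trace ℝ E L.toLinearMap) t3
  simp only [ContinuousLinearMap.toLinearMap_sub, ContinuousLinearMap.toLinearMap_add,
    ContinuousLinearMap.toLinearMap_smul, map_sub, map_add, map_smul, trace_smulRight_clm, t4,
    ContinuousLinearMap.flip_apply] at e3
  have e1 : LinearMap.trace ℝ E (P.comp R).toLinearMap = _ := t1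
  have e2 : LinearMap.trace ℝ E P.toLinearMap = _ := t2
  rw [e1, e2] at e3
  simp only [map_sub, map_smul, LinearMap.trace_smulRight, LinearMap.trace_id, smul_eq_mul,
    ContinuousLinearMap.coe_coe, ContinuousLinearMap.flip_apply] at e3
  have hdiv : coordDiv G (coordGrad G ℓ) (ι s) = LinearMap.trace ℝ E N.toLinearMap := rfl
  rw [hdiv]
  -- The terms in `q = |grad ℓ|²`, with coefficients `dim X` and `1`, cancel between the vertical
  -- and the horizontal trace. Only the Ricci tensor of the fibre and the divergence remain.
  linear_combination e3 + t5

end IsSplittingOn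

end Fibre

/-! ### Linear algebra of the Killing equation for a form with a projector. -/

section KillingForm

variable {E : Type*} [NormedAddCommGroup E] [NormedSpace ℝ E]

/-- A symmetric form `β` with projector `P`, whose derivative `T` satisfies the Killing equation
for `e^{2ℓ} β` and is symmetric on vertical and on horizontal vectors. -/
theorem killing_form_derivative {β : E →L[ℝ] E →L[ℝ] ℝ} {P : E →L[ℝ] E}
    {T : E →L[ℝ] E →L[ℝ] E →L[ℝ] ℝ} {dl : E →L[ℝ] ℝ}
    (hβ : ∀ v w, β v w = β w v) (hβP : ∀ v w, β (P v) w = β v w) (hP : ∀ v, P (P v) = P v)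
    (hpos : ∀ v, P v ≠ 0 → 0 < β v v) (hT : ∀ a b c, T a b c = T a c b)
    (hTP : ∀ a v w, T a v w = T a (P v) w + T a v (P w))
    (hK : ∀ v, 2 * dl v * β v v + T v v v = 0)
    (hvert : ∀ a b c, T (P a) (P b) (c - P c) = T (P b) (P a) (c - P c))
    (hhor : ∀ a b c, T (a - P a) (b - P b) (P c) = T (b - P b) (a - P a) (P c)) :
    (∀ v, dl (P v) = 0) ∧ ∀ a b c, T a b c = - dl c * β a b - dl b * β a c := by
  -- `hTP` is the derivative of `P² = P`: a derivative of a projector has no vertical-vertical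
  -- component, and no horizontal-horizontal one either (`hHH`).
  have hPP : ∀ a b c, T a (P b) (P c) = 0 := by
    intro a b c
    have := hTP a (P b) (P c)
    rw [hP, hP] at this
    linarith
  -- On a vertical vector the Killing equation loses its term in `T`, leaving `2 dl(v) β(v, v) = 0`.
  have hbasic : ∀ v, dl (P v) = 0 := by
    intro v
    by_cases h0 : P v = 0
    · rw [h0, map_zero]
    · have h1 := hK (P v)
      rw [hPP, add_zero] at h1
      have h2 := hpos (P v) (by rwa [hP])
      rcases mul_eq_zero.1 h1 with h3 | h3
      · linarith
      · exact absurd h3 h2.ne'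
  have hPH : ∀ v, P (v - P v) = 0 := fun v => by rw [map_sub, hP, sub_self]
  have hHH : ∀ a b c, T a (b - P b) (c - P c) = 0 := by
    intro a b c
    have := hTP a (b - P b) (c - P c)
    rw [hPH, hPH] at this
    simpa using this
  have hβH : ∀ v w, β (v - P v) w = 0 := fun v w => by rw [map_sub, sub_apply, hβP, sub_self]
  have hβH' : ∀ v w, β w (v - P v) = 0 := fun v w => by rw [hβ, hβH]
  -- Polarization of the cubic identity `hK`, by inclusion and exclusion over the sums of `a`, `b`,
  -- `c`.
  have K : ∀ a b c, 2 * (dl a * β b c + dl b * β a c + dl c * β a b)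
      + (T a b c + T b a c + T c a b) = 0 := by
    intro a b c
    have e1 := hK (a + b + c)
    have e2 := hK (a + b)
    have e3 := hK (a + c)
    have e4 := hK (b + c)
    have e5 := hK a
    have e6 := hK b
    have e7 := hK c
    simp only [map_add, add_apply] at e1 e2 e3 e4
    rw [hβ b a, hβ c a, hβ c b] at e1
    rw [hβ b a] at e2
    rw [hβ c a] at e3
    rw [hβ c b] at e4
    rw [hT a c b, hT b c a, hT c b a] at e1
    linear_combination (e1 - e2 - e3 - e4 + e5 + e6 + e7) / 2
  -- With two horizontal arguments and a vertical one the terms in `β` drop out and `K` reads `T(a,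
  -- b, c) + T(b, a, c) = 0`, while `hhor` says that the two summands agree: the horizontal spaces
  -- are totally geodesic.
  have hHHP : ∀ a b c, T (a - P a) (b - P b) (P c) = 0 := by
    intro a b c
    have := K (a - P a) (b - P b) (P c)
    rw [hβH, hβH, hβH, hHH, hhor b a c] at this
    linarith
  -- With two vertical arguments and a horizontal one, `hvert` makes the two surviving terms equal,
  -- and `K` can be solved for them: umbilicity.
  have hPPH : ∀ a b c, T (P b) (P c) (a - P a) = - dl a * β b c := by
    intro a b c
    have := K (a - P a) (P b) (P c)
    rw [hβH, hβH, hPP, hT (P b), hT (P c), hvert c b a, hβP, hβ b, hβP, hβ c] at this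
    rw [map_sub dl, hbasic] at this
    linarith
  refine ⟨hbasic, fun a b c => ?_⟩
  -- The only components of `T` left have a vertical first slot and one vertical and one horizontal
  -- slot among the last two.
  have h1 : T a b c = T (P a) (P b) (c - P c) + T (P a) (P c) (b - P b) := by
    have d1 := hHHP a b c
    have d2 := hHHP a c b
    have d3 := hHH a b c
    have d4 := hPP a b c
    rw [hT] at d2
    simp only [map_sub, sub_apply] at d1 d2 d3 d4 ⊢
    rw [hT (P a) (P c) b, hT (P a) (P c) (P b)]
    have d5 := hPP (P a) b c
    linear_combination d1 + d2 + d3 + d4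
  rw [h1, hPPH, hPPH, neg_mul, neg_mul, ← sub_eq_add_neg]

end KillingForm

/-! ### From a Killing form with involutive distributions to a splitting. -/

section OfKilling

variable {E : Type*} [NormedAddCommGroup E] [NormedSpace ℝ E] [FiniteDimensional ℝ E]
  {E' : Type*} [NormedAddCommGroup E'] [NormedSpace ℝ E']
  {G β : E → E →L[ℝ] E →L[ℝ] ℝ} {ℓ : E → ℝ} {Ω : Set E} {u : E}

/-- The projectors onto the kernels of the derivatives of a map are involutive. -/
theorem fderiv_proj_vertical {P : E → E →L[ℝ] E} {φ : E → E'} (hφ : ContDiffAt ℝ ∞ φ u)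
    (hP : DifferentiableAt ℝ P u) (hφP : ∀ᶠ t in 𝓝 u, ∀ v, fderiv ℝ φ t (P t v) = 0)
    (hker : ∀ v, fderiv ℝ φ u v = 0 → P u v = v) (hid : ∀ v, P u (P u v) = P u v) (a b : E) :
    P u (fderiv ℝ P u (P u a) (P u b) - fderiv ℝ P u (P u b) (P u a))
      = fderiv ℝ P u (P u a) (P u b) - fderiv ℝ P u (P u b) (P u a) := by
  apply hker
  have hD := differentiableAt_of_contDiffAt (contDiffAt_fderiv hφ)
  -- Differentiate `Dφ (P b) = 0`. The second derivative of `φ` is symmetric, so the antisymmetrized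
  -- derivative of `P` lies in the kernel of `Dφ`.
  have key : ∀ a b : E, fderiv ℝ (fderiv ℝ φ) u a (P u b) + fderiv ℝ φ u (fderiv ℝ P u a b) = 0 := by
    intro a b
    have h1 : (fun t => fderiv ℝ φ t (P t b)) =ᶠ[𝓝 u] fun _ => (0 : E') := by
      filter_upwards [hφP] with t ht using ht b
    have h2 : DifferentiableAt ℝ (fun t => P t b) u := hP.clm_apply (differentiableAt_const b)
    have h3 := congrArg (fun L : E →L[ℝ] E' => L a) h1.fderiv_eq
    simp only [fderiv_apply_apply hD h2, fderiv_apply_const hP] at h3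
    simpa using h3
  have h1 := key (P u a) (P u b)
  have h2 := key (P u b) (P u a)
  rw [hid] at h1 h2
  rw [fderiv_fderiv_comm hφ] at h2
  rw [map_sub, sub_eq_zero]
  exact add_left_cancel (h1.trans h2.symm)

/-- A Killing form `e^{2ℓ} β` whose vertical and horizontal distributions are involutive. -/
theorem IsSplittingOn.of_killing (hG : IsMetricOn G Ω) (hβs : ContDiffOn ℝ ∞ β Ω)
    (hℓ : ContDiffOn ℝ ∞ ℓ Ω) (hβ : ∀ u ∈ Ω, ∀ v w, β u v w = β u w v)
    (hP : ∀ u ∈ Ω, ∀ v, proj G β u (proj G β u v) = proj G β u v)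
    (hK : ∀ u ∈ Ω, ∀ v, 2 * fderiv ℝ ℓ u v * β u v v + fderiv ℝ β u v v v
      - 2 * β u (christoffel G univ u v v) v = 0)
    (hvert : ∀ u ∈ Ω, ∀ a b, let P := proj G β
      P u (fderiv ℝ P u (P u a) (P u b) - fderiv ℝ P u (P u b) (P u a))
        = fderiv ℝ P u (P u a) (P u b) - fderiv ℝ P u (P u b) (P u a))
    (hhor : ∀ u ∈ Ω, ∀ a b, let P := proj G β
      P u (fderiv ℝ P u (a - P u a) (b - P u b) - fderiv ℝ P u (b - P u b) (a - P u a)) = 0) :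
    IsSplittingOn G β ℓ Ω := by
  have main : ∀ u ∈ Ω, (∀ v, fderiv ℝ ℓ u (proj G β u v) = 0) ∧ ∀ a b c, fderiv ℝ β u a b c
      = β u (christoffel G univ u a b) c + β u b (christoffel G univ u a c)
        - fderiv ℝ ℓ u c * β u a b - fderiv ℝ ℓ u b * β u a c := by
    intro u hu
    have hβu : ContDiffAt ℝ ∞ β u := hβs.contDiffAt (hG.isOpen.mem_nhds hu)
    have hβd := differentiableAt_of_contDiffAt hβu
    have hPd := differentiableAt_of_contDiffAt (hG.contDiffAt_proj hu hβu)
    set P := proj G β with hPdef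
    have hGP : ∀ v, G u (P u v) = β u v := hG.apply_proj hu
    have hPsymm : ∀ v w, G u (P u v) w = G u v (P u w) := by
      intro v w; rw [hGP, hβ u hu, hG.symm u hu v, hGP]
    have hβP : ∀ v w, β u (P u v) w = β u v w := by
      intro v w; rw [← hGP, hP u hu, hGP]
    set Γ := christoffel G univ u with hΓ
    -- `N` is the covariant derivative of `P`. Since `∇G = 0`, the form `T = G (N ·, ·)` is that of
    -- `β`, which is `hTβ`.
    let N : E →L[ℝ] E →L[ℝ] E := fderiv ℝ P u + (Γ.flip.comp (P u)).flip
      - (ContinuousLinearMap.compL ℝ E E E (P u)).comp Γ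
    have hN : ∀ a b, N a b = fderiv ℝ P u a b + Γ a (P u b) - P u (Γ a b) := fun _ _ => rfl
    let T : E →L[ℝ] E →L[ℝ] E →L[ℝ] ℝ := (ContinuousLinearMap.compL ℝ E E (E →L[ℝ] ℝ) (G u)).comp N
    have hT : ∀ a b c, T a b c = G u (N a b) c := fun _ _ _ => rfl
    have hTβ : ∀ a b c, T a b c = fderiv ℝ β u a b c - β u (Γ a b) c - β u b (Γ a c) := by
      intro a b c
      have h1 : (fun t => β t b c) =ᶠ[𝓝 u] fun t => G t (P t b) c := by
        filter_upwards [hG.isOpen.mem_nhds hu] with t ht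
        rw [hPdef, hG.apply_proj ht]
      have h2 := congrArg (fun L : E →L[ℝ] ℝ => L a) h1.fderiv_eq
      rw [fderiv_apply₂_const hβd, fderiv_apply₂_apply (hG.differentiableAt hu)
        (hPd.clm_apply (differentiableAt_const b)) (differentiableAt_const c),
        fderiv_apply_const hPd, hG.fderiv_apply hu] at h2
      simp only [fderiv_fun_const, Pi.zero_apply, zero_apply, map_zero, add_zero] at h2
      rw [hT, hN, h2, map_sub, map_add, hGP (Γ a b), ← hGP b]
      simp only [sub_apply, add_apply]
      ring
    have hDP : ∀ a v, fderiv ℝ P u a (P u v) + P u (fderiv ℝ P u a v) = fderiv ℝ P u a v := by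
      intro a v
      have h1 : (fun t => P t (P t v)) =ᶠ[𝓝 u] fun t => P t v := by
        filter_upwards [hG.isOpen.mem_nhds hu] with t ht using hP t ht v
      have h2 := congrArg (fun L : E →L[ℝ] E => L a) h1.fderiv_eq
      rwa [fderiv_apply_apply hPd (hPd.clm_apply (differentiableAt_const v)),
        fderiv_apply_const hPd] at h2
    have hPH : ∀ v, P u (v - P u v) = 0 := fun v => by rw [map_sub, hP u hu, sub_self]
    have hΓs : ∀ a b, Γ a b = Γ b a := hG.christoffel_symm hu
    obtain ⟨h1, h2⟩ := killing_form_derivative (β := β u) (P := P u) (T := T) (dl := fderiv ℝ ℓ u)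
      (hβ u hu) hβP (hP u hu)
      (fun v hv => by rw [← hGP, ← hP u hu, hPsymm]; exact hG.pos u hu _ hv)
      (fun a b c => by
        rw [hTβ, hTβ, hβ u hu c, hβ u hu b]
        have : fderiv ℝ β u a b c = fderiv ℝ β u a c b := by
          rw [← fderiv_apply₂_const hβd, ← fderiv_apply₂_const hβd]
          have : (fun t => β t b c) =ᶠ[𝓝 u] fun t => β t c b := by
            filter_upwards [hG.isOpen.mem_nhds hu] with t ht using hβ t ht b c
          rw [this.fderiv_eq]
        rw [this]; ring)
      (fun a v w => by
        rw [hT, hT, hT, ← hPsymm, ← add_apply, ← map_add, hN, hN, hP u hu]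
        congr 2
        rw [map_sub, map_add, hP u hu]
        nth_rewrite 1 [← hDP a v]
        abel)
      (fun v => by
        have := hK u hu v
        rw [hTβ, hβ u hu v (Γ v v)]
        linarith)
      -- In this argument and the next, the symmetry of `Γ` cancels all Christoffel terms: the
      -- antisymmetric part of `N` is that of the ordinary derivative of `P`, which involutivity
      -- makes vertical, respectively horizontal.
      (fun a b c => by
        rw [hT, hT, ← sub_eq_zero, ← sub_apply, ← map_sub, hN, hN, hP u hu, hP u hu,
          hΓs (P u b) (P u a), sub_sub_sub_cancel_right, add_sub_add_right_eq_sub,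
          ← hvert u hu a b, hPsymm, hPH]
        simp)
      (fun a b c => by
        rw [hT, hT, ← sub_eq_zero, ← sub_apply, ← map_sub, hN, hN, hPH, hPH, map_zero, map_zero,
          hΓs (b - P u b), sub_sub_sub_cancel_right, add_zero, add_zero, ← hPsymm, hhor u hu]
        simp)
    refine ⟨h1, fun a b c => ?_⟩
    have h3 := h2 a b c
    rw [hTβ] at h3
    linarith
  exact ⟨hG, hβs, hℓ, hβ, hP, fun u hu => (main u hu).1, fun u hu => (main u hu).2⟩

end OfKilling

/-! ### Warped products of vector spaces -/

section Warped

variable {E₁ : Type*} [NormedAddCommGroup E₁] [NormedSpace ℝ E₁] [FiniteDimensional ℝ E₁]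
  {E₂ : Type*} [NormedAddCommGroup E₂] [NormedSpace ℝ E₂] [FiniteDimensional ℝ E₂]
  {Y : Type*} [NormedAddCommGroup Y] [NormedSpace ℝ Y]
  {B₁ G₁ β₁ : E₁ → E₁ →L[ℝ] E₁ →L[ℝ] ℝ} {B₂ G₂ β₂ : E₂ → E₂ →L[ℝ] E₂ →L[ℝ] ℝ} {F : E₁ → ℝ}
  {Ω₁ : Set E₁} {Ω₂ : Set E₂} {u₁ : E₁} {u₂ : E₂}

/-- The warped sum `B₁ + F² B₂` of two fields of bilinear forms. -/
def warpForm (B₁ : E₁ → E₁ →L[ℝ] E₁ →L[ℝ] ℝ) (B₂ : E₂ → E₂ →L[ℝ] E₂ →L[ℝ] ℝ) (F : E₁ → ℝ)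
    (u : E₁ × E₂) : E₁ × E₂ →L[ℝ] E₁ × E₂ →L[ℝ] ℝ :=
  (B₁ u.1).bilinearComp (.fst ℝ E₁ E₂) (.fst ℝ E₁ E₂)
    + (F u.1) ^ 2 • (B₂ u.2).bilinearComp (.snd ℝ E₁ E₂) (.snd ℝ E₁ E₂)

theorem warpForm_apply (u v w : E₁ × E₂) :
    warpForm B₁ B₂ F u v w = B₁ u.1 v.1 w.1 + F u.1 ^ 2 * B₂ u.2 v.2 w.2 := rfl

theorem contDiffOn_warpForm (h₁ : ContDiffOn ℝ ∞ B₁ Ω₁) (h₂ : ContDiffOn ℝ ∞ B₂ Ω₂)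
    (hF : ContDiffOn ℝ ∞ F Ω₁) : ContDiffOn ℝ ∞ (warpForm B₁ B₂ F) (Ω₁ ×ˢ Ω₂) := by
  have m₁ : MapsTo Prod.fst (Ω₁ ×ˢ Ω₂) Ω₁ := fun x hx => hx.1
  have m₂ : MapsTo Prod.snd (Ω₁ ×ˢ Ω₂) Ω₂ := fun x hx => hx.2
  refine contDiffOn_clm_apply.2 fun v => contDiffOn_clm_apply.2 fun w => ?_
  simp only [warpForm_apply]
  exact ((((h₁.comp contDiffOn_fst m₁).clm_apply contDiffOn_const).clm_apply contDiffOn_const)).add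
    (((hF.comp contDiffOn_fst m₁).pow 2).mul
      (((h₂.comp contDiffOn_snd m₂).clm_apply contDiffOn_const).clm_apply contDiffOn_const))

theorem fderiv_prod_left {f : E₁ × E₂ → Y} (hf : DifferentiableAt ℝ f (u₁, u₂)) (a : E₁) :
    fderiv ℝ f (u₁, u₂) (a, 0) = fderiv ℝ (fun s => f (s, u₂)) u₁ a := by
  have h : HasFDerivAt (fun s : E₁ => (s, u₂)) (ContinuousLinearMap.inl ℝ E₁ E₂) u₁ :=
    hasFDerivAt_prodMk_left u₁ u₂
  have h2 : HasFDerivAt (fun s => f (s, u₂)) _ u₁ := hf.hasFDerivAt.comp u₁ h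
  rw [h2.fderiv]; rfl

theorem fderiv_prod_right {f : E₁ × E₂ → Y} (hf : DifferentiableAt ℝ f (u₁, u₂)) (a : E₂) :
    fderiv ℝ f (u₁, u₂) (0, a) = fderiv ℝ (fun s => f (u₁, s)) u₂ a := by
  have h : HasFDerivAt (fun s : E₂ => (u₁, s)) (ContinuousLinearMap.inr ℝ E₁ E₂) u₂ :=
    hasFDerivAt_prodMk_right u₁ u₂
  have h2 : HasFDerivAt (fun s => f (u₁, s)) _ u₂ := hf.hasFDerivAt.comp u₂ h
  rw [h2.fderiv]; rfl

theorem fderiv_warpForm (h₁ : DifferentiableAt ℝ B₁ u₁) (h₂ : DifferentiableAt ℝ B₂ u₂)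
    (hF : DifferentiableAt ℝ F u₁) (hw : DifferentiableAt ℝ (warpForm B₁ B₂ F) (u₁, u₂))
    (a v w : E₁ × E₂) :
    fderiv ℝ (warpForm B₁ B₂ F) (u₁, u₂) a v w
      = fderiv ℝ B₁ u₁ a.1 v.1 w.1 + 2 * F u₁ * fderiv ℝ F u₁ a.1 * B₂ u₂ v.2 w.2
        + F u₁ ^ 2 * fderiv ℝ B₂ u₂ a.2 v.2 w.2 := by
  have e : ∀ a v w, fderiv ℝ (warpForm B₁ B₂ F) (u₁, u₂) a v w
      = fderiv ℝ (fun t => warpForm B₁ B₂ F t v w) (u₁, u₂) a := fun a v w =>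
    (fderiv_apply₂_const hw v w a).symm
  have hsum : a = (a.1, 0) + (0, a.2) := by simp
  have hd : DifferentiableAt ℝ (fun t => warpForm B₁ B₂ F t v w) (u₁, u₂) :=
    (hw.clm_apply (differentiableAt_const v)).clm_apply (differentiableAt_const w)
  have d₁ : DifferentiableAt ℝ (fun s => B₁ s v.1 w.1) u₁ :=
    (h₁.clm_apply (differentiableAt_const _)).clm_apply (differentiableAt_const _)
  have d₂ : DifferentiableAt ℝ (fun s => B₂ s v.2 w.2) u₂ :=
    (h₂.clm_apply (differentiableAt_const _)).clm_apply (differentiableAt_const _)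
  have d₃ : DifferentiableAt ℝ (fun s => F s ^ 2 * B₂ u₂ v.2 w.2) u₁ := (hF.pow 2).mul_const _
  have l : fderiv ℝ (fun s => warpForm B₁ B₂ F (s, u₂) v w) u₁ a.1
      = fderiv ℝ B₁ u₁ a.1 v.1 w.1 + 2 * F u₁ * fderiv ℝ F u₁ a.1 * B₂ u₂ v.2 w.2 := by
    simp only [warpForm_apply]
    rw [fderiv_fun_add d₁ d₃, add_apply, fderiv_apply₂_const h₁, fderiv_mul_const (hF.fun_pow 2)]
    have : fderiv ℝ (fun s => F s ^ 2) u₁ a.1 = 2 * F u₁ * fderiv ℝ F u₁ a.1 := by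
      rw [fderiv_fun_pow 2 hF]; simp
    rw [smul_apply, this, smul_eq_mul]
    ring
  have r : fderiv ℝ (fun s => warpForm B₁ B₂ F (u₁, s) v w) u₂ a.2
      = F u₁ ^ 2 * fderiv ℝ B₂ u₂ a.2 v.2 w.2 := by
    simp only [warpForm_apply]
    rw [fderiv_const_add, fderiv_const_mul d₂, smul_apply, fderiv_apply₂_const h₂, smul_eq_mul]
  rw [e]
  nth_rewrite 1 [hsum]
  rw [map_add, fderiv_prod_left hd, fderiv_prod_right hd, l, r]

/-- The trace of an endomorphism of a product. -/
theorem trace_prod (A : E₁ × E₂ →ₗ[ℝ] E₁ × E₂) :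
    LinearMap.trace ℝ (E₁ × E₂) A
      = LinearMap.trace ℝ E₁ (LinearMap.fst ℝ E₁ E₂ ∘ₗ A ∘ₗ LinearMap.inl ℝ E₁ E₂)
        + LinearMap.trace ℝ E₂ (LinearMap.snd ℝ E₁ E₂ ∘ₗ A ∘ₗ LinearMap.inr ℝ E₁ E₂) := by
  have h : A = LinearMap.inl ℝ E₁ E₂ ∘ₗ (LinearMap.fst ℝ E₁ E₂ ∘ₗ A)
      + LinearMap.inr ℝ E₁ E₂ ∘ₗ (LinearMap.snd ℝ E₁ E₂ ∘ₗ A) := by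
    ext <;> simp
  nth_rewrite 1 [h]
  rw [map_add, LinearMap.trace_comp_comm' _ (LinearMap.inl ℝ E₁ E₂),
    LinearMap.trace_comp_comm' _ (LinearMap.inr ℝ E₁ E₂)]
  rfl

namespace IsMetricOn

theorem warpForm (h₁ : IsMetricOn G₁ Ω₁) (h₂ : IsMetricOn G₂ Ω₂) (hF : ContDiffOn ℝ ∞ F Ω₁)
    (hpos : ∀ u ∈ Ω₁, 0 < F u) : IsMetricOn (warpForm G₁ G₂ F) (Ω₁ ×ˢ Ω₂) where
  isOpen := h₁.isOpen.prod h₂.isOpen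
  contDiffOn := contDiffOn_warpForm h₁.contDiffOn h₂.contDiffOn hF
  symm u hu v w := by
    rw [warpForm_apply, warpForm_apply, h₁.symm _ hu.1, h₂.symm _ hu.2]
  pos u hu v hv := by
    rw [warpForm_apply]
    have hF2 : 0 < F u.1 ^ 2 := pow_pos (hpos _ hu.1) 2
    have p₁ : 0 ≤ G₁ u.1 v.1 v.1 := by
      by_cases h : v.1 = 0
      · simp [h]
      · exact (h₁.pos _ hu.1 _ h).le
    have p₂ : 0 ≤ G₂ u.2 v.2 v.2 := by
      by_cases h : v.2 = 0
      · simp [h]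
      · exact (h₂.pos _ hu.2 _ h).le
    by_cases h : v.1 = 0
    · have h' : v.2 ≠ 0 := fun h' => hv (Prod.ext h h')
      have := mul_pos hF2 (h₂.pos _ hu.2 _ h')
      linarith
    · have := h₁.pos _ hu.1 _ h
      have := mul_nonneg hF2.le p₂
      linarith

/-- The connection of a warped product. Paired with `z`, both sides are Koszul expressions, and the
derivative of `F²` is what produces the gradient and the mixed terms. -/
theorem christoffel_warpForm (h₁ : IsMetricOn G₁ Ω₁) (h₂ : IsMetricOn G₂ Ω₂)
    (hF : ContDiffOn ℝ ∞ F Ω₁) (hpos : ∀ u ∈ Ω₁, 0 < F u) (hu₁ : u₁ ∈ Ω₁) (hu₂ : u₂ ∈ Ω₂)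
    (a b : E₁ × E₂) :
    christoffel (WarpedClairaut.warpForm G₁ G₂ F) univ (u₁, u₂) a b
      = (christoffel G₁ univ u₁ a.1 b.1 - (F u₁ * G₂ u₂ a.2 b.2) • coordGrad G₁ F u₁,
        christoffel G₂ univ u₂ a.2 b.2
          + ((F u₁)⁻¹ * fderiv ℝ F u₁ a.1) • b.2 + ((F u₁)⁻¹ * fderiv ℝ F u₁ b.1) • a.2) := by
  have hG := h₁.warpForm h₂ hF hpos
  have hu : (u₁, u₂) ∈ Ω₁ ×ˢ Ω₂ := ⟨hu₁, hu₂⟩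
  have hFd : DifferentiableAt ℝ F u₁ :=
    differentiableAt_of_contDiffAt (hF.contDiffAt (h₁.isOpen.mem_nhds hu₁))
  have hF0 : F u₁ ≠ 0 := (hpos _ hu₁).ne'
  have hd := fderiv_warpForm (h₁.differentiableAt hu₁) (h₂.differentiableAt hu₂) hFd
    (hG.differentiableAt hu)
  refine hG.ext hu fun z => ?_
  rw [hG.apply_christoffel hu, hd, hd, hd, warpForm_apply]
  simp only [map_sub, map_add, map_smul, sub_apply, add_apply, smul_apply,
    h₁.apply_christoffel hu₁, h₂.apply_christoffel hu₂, h₁.apply_coordGrad hu₁, smul_eq_mul]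
  rw [h₂.symm _ hu₂ b.2 z.2, h₂.symm _ hu₂ a.2 z.2, h₂.symm _ hu₂ a.2 b.2]
  rw [h₂.symm _ hu₂ z.2 b.2, h₂.symm _ hu₂ z.2 a.2]
  field_simp
  ring

end IsMetricOn

/-- The weight `F²` stands in both forms and cancels, so the projector of a warped sum is diagonal
and does not involve `F`. -/
theorem proj_warpForm (h₁ : IsMetricOn G₁ Ω₁) (h₂ : IsMetricOn G₂ Ω₂)
    (hF : ContDiffOn ℝ ∞ F Ω₁) (hpos : ∀ u ∈ Ω₁, 0 < F u) (hu₁ : u₁ ∈ Ω₁) (hu₂ : u₂ ∈ Ω₂)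
    (v : E₁ × E₂) :
    proj (warpForm G₁ G₂ F) (warpForm β₁ β₂ F) (u₁, u₂) v
      = (proj G₁ β₁ u₁ v.1, proj G₂ β₂ u₂ v.2) := by
  have hG := h₁.warpForm h₂ hF hpos
  refine hG.ext (show (u₁, u₂) ∈ Ω₁ ×ˢ Ω₂ from ⟨hu₁, hu₂⟩) fun z => ?_
  rw [hG.apply_proj ⟨hu₁, hu₂⟩, warpForm_apply, warpForm_apply, h₁.apply_proj hu₁,
    h₂.apply_proj hu₂]

namespace IsSplittingOn

variable {ℓ : E₁ × E₂ → ℝ}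

/-- A splitting of a warped product induces one of its first factor. -/
theorem fst (h₁ : IsMetricOn G₁ Ω₁) (h₂ : IsMetricOn G₂ Ω₂)
    (hF : ContDiffOn ℝ ∞ F Ω₁) (hpos : ∀ u ∈ Ω₁, 0 < F u)
    (hβ₁ : ContDiffOn ℝ ∞ β₁ Ω₁) (hβ₂ : ContDiffOn ℝ ∞ β₂ Ω₂)
    (h : IsSplittingOn (warpForm G₁ G₂ F) (warpForm β₁ β₂ F) ℓ (Ω₁ ×ˢ Ω₂)) (hu₂ : u₂ ∈ Ω₂) :
    IsSplittingOn G₁ β₁ (fun u => ℓ (u, u₂)) Ω₁ := by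
  have hℓ : ∀ u ∈ Ω₁, DifferentiableAt ℝ ℓ (u, u₂) := fun u hu =>
    differentiableAt_of_contDiffAt (h.contDiffAt_pot ⟨hu, hu₂⟩)
  refine ⟨h₁, hβ₁, h.contDiffOn_pot.comp (by fun_prop) fun u hu => ⟨hu, hu₂⟩, fun u hu v w => ?_,
    fun u hu v => ?_, fun u hu v => ?_, fun u hu a b c => ?_⟩
  · simpa [warpForm_apply] using h.symm (u, u₂) ⟨hu, hu₂⟩ (v, 0) (w, 0)
  · have := h.idem (u, u₂) ⟨hu, hu₂⟩ (v, 0)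
    simpa only [proj_warpForm h₁ h₂ hF hpos hu hu₂, map_zero] using congrArg Prod.fst this
  · have := h.basic (u, u₂) ⟨hu, hu₂⟩ (v, 0)
    rwa [proj_warpForm h₁ h₂ hF hpos hu hu₂, map_zero, fderiv_prod_left (hℓ u hu)] at this
  · have hFd : DifferentiableAt ℝ F u :=
      differentiableAt_of_contDiffAt (hF.contDiffAt (h₁.isOpen.mem_nhds hu))
    have := h.deriv (u, u₂) ⟨hu, hu₂⟩ (a, 0) (b, 0) (c, 0)
    rw [fderiv_warpForm
      (differentiableAt_of_contDiffAt (hβ₁.contDiffAt (h₁.isOpen.mem_nhds hu)))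
      (differentiableAt_of_contDiffAt (hβ₂.contDiffAt (h₂.isOpen.mem_nhds hu₂))) hFd
      (differentiableAt_of_contDiffAt (h.contDiffAt ⟨hu, hu₂⟩)),
      h₁.christoffel_warpForm h₂ hF hpos hu hu₂, h₁.christoffel_warpForm h₂ hF hpos hu hu₂,
      fderiv_prod_left (hℓ u hu), fderiv_prod_left (hℓ u hu)] at this
    simpa [warpForm_apply] using this

/-- A splitting of a warped product induces one of its second factor. -/
theorem snd (h₁ : IsMetricOn G₁ Ω₁) (h₂ : IsMetricOn G₂ Ω₂)
    (hF : ContDiffOn ℝ ∞ F Ω₁) (hpos : ∀ u ∈ Ω₁, 0 < F u)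
    (hβ₁ : ContDiffOn ℝ ∞ β₁ Ω₁) (hβ₂ : ContDiffOn ℝ ∞ β₂ Ω₂)
    (h : IsSplittingOn (warpForm G₁ G₂ F) (warpForm β₁ β₂ F) ℓ (Ω₁ ×ˢ Ω₂)) (hu₁ : u₁ ∈ Ω₁) :
    IsSplittingOn G₂ β₂ (fun u => ℓ (u₁, u)) Ω₂ := by
  have hℓ : ∀ u ∈ Ω₂, DifferentiableAt ℝ ℓ (u₁, u) := fun u hu =>
    differentiableAt_of_contDiffAt (h.contDiffAt_pot ⟨hu₁, hu⟩)
  have hF2 : F u₁ ^ 2 ≠ 0 := (pow_pos (hpos _ hu₁) 2).ne'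
  refine ⟨h₂, hβ₂, h.contDiffOn_pot.comp (by fun_prop) fun u hu => ⟨hu₁, hu⟩, fun u hu v w => ?_,
    fun u hu v => ?_, fun u hu v => ?_, fun u hu a b c => ?_⟩
  · have := h.symm (u₁, u) ⟨hu₁, hu⟩ (0, v) (0, w)
    simp only [warpForm_apply, map_zero, zero_add] at this
    exact mul_left_cancel₀ hF2 this
  · have := h.idem (u₁, u) ⟨hu₁, hu⟩ (0, v)
    simpa only [proj_warpForm h₁ h₂ hF hpos hu₁ hu, map_zero] using congrArg Prod.snd this
  · have := h.basic (u₁, u) ⟨hu₁, hu⟩ (0, v)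
    rwa [proj_warpForm h₁ h₂ hF hpos hu₁ hu, map_zero, fderiv_prod_right (hℓ u hu)] at this
  · have hFd : DifferentiableAt ℝ F u₁ :=
      differentiableAt_of_contDiffAt (hF.contDiffAt (h₁.isOpen.mem_nhds hu₁))
    have := h.deriv (u₁, u) ⟨hu₁, hu⟩ (0, a) (0, b) (0, c)
    rw [fderiv_warpForm
      (differentiableAt_of_contDiffAt (hβ₁.contDiffAt (h₁.isOpen.mem_nhds hu₁)))
      (differentiableAt_of_contDiffAt (hβ₂.contDiffAt (h₂.isOpen.mem_nhds hu))) hFd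
      (differentiableAt_of_contDiffAt (h.contDiffAt ⟨hu₁, hu⟩)),
      h₁.christoffel_warpForm h₂ hF hpos hu₁ hu, h₁.christoffel_warpForm h₂ hF hpos hu₁ hu,
      fderiv_prod_right (hℓ u hu), fderiv_prod_right (hℓ u hu)] at this
    -- The Christoffel symbol has a component along `grad F` in the first factor, but it is paired
    -- with vectors of the second factor and contributes nothing.
    simp only [warpForm_apply, map_zero, zero_apply, mul_zero, zero_mul, zero_smul, add_zero, zero_add,
      zero_sub] at this
    refine mul_left_cancel₀ hF2 (this.trans ?_)
    ring

end IsSplittingOn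

end Warped

/-! ### The Ricci tensor of a warped product of vector spaces. -/

section WarpedRicci

variable {E₁ : Type*} [NormedAddCommGroup E₁] [NormedSpace ℝ E₁] [FiniteDimensional ℝ E₁]
  {E₂ : Type*} [NormedAddCommGroup E₂] [NormedSpace ℝ E₂] [FiniteDimensional ℝ E₂]
  {G₁ : E₁ → E₁ →L[ℝ] E₁ →L[ℝ] ℝ} {G₂ : E₂ → E₂ →L[ℝ] E₂ →L[ℝ] ℝ} {F : E₁ → ℝ}
  {Ω₁ : Set E₁} {Ω₂ : Set E₂} {u₁ : E₁} {u₂ : E₂}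

/-- The Hessian `D²F(b, c) - DF(Γ(b, c))`. -/
def coordHess (G : E₁ → E₁ →L[ℝ] E₁ →L[ℝ] ℝ) (F : E₁ → ℝ) (u b c : E₁) : ℝ :=
  fderiv ℝ (fderiv ℝ F) u b c - fderiv ℝ F u (christoffel G univ u b c)

/-- The warping coefficient `κ` in `Ric(v, w) = Ric₂(v, w) - κ G₂(v, w)` for `v, w` tangent to the
second factor of a warped product with `n`-dimensional second factor. -/
def warpCoeff (G : E₁ → E₁ →L[ℝ] E₁ →L[ℝ] ℝ) (F : E₁ → ℝ) (n : ℕ) (u : E₁) : ℝ :=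
  coordDiv G (fun s => F s • coordGrad G F s) u + ((n : ℝ) - 2) * fderiv ℝ F u (coordGrad G F u)

namespace IsMetricOn

/-- The trace is the sum of two diagonal blocks. The block of the first factor is its own curvature,
because the slices are totally geodesic; the block of the second is `-(Hess F / F)` times the
identity. -/
theorem trace_coordCurvature_warpForm_left (h₁ : IsMetricOn G₁ Ω₁) (h₂ : IsMetricOn G₂ Ω₂)
    (hF : ContDiffOn ℝ ∞ F Ω₁) (hpos : ∀ u ∈ Ω₁, 0 < F u) (hu₁ : u₁ ∈ Ω₁) (hu₂ : u₂ ∈ Ω₂)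
    (b c : E₁) :
    LinearMap.trace ℝ (E₁ × E₂)
        (coordCurvature (WarpedClairaut.warpForm G₁ G₂ F) univ (u₁, u₂) (b, 0) (c, 0)).toLinearMap
      = LinearMap.trace ℝ E₁ (coordCurvature G₁ univ u₁ b c).toLinearMap
        - Module.finrank ℝ E₂ * (F u₁)⁻¹ * coordHess G₁ F u₁ b c := by
  have hG := h₁.warpForm h₂ hF hpos
  have hu : (u₁, u₂) ∈ Ω₁ ×ˢ Ω₂ := ⟨hu₁, hu₂⟩
  have hF0 : F u₁ ≠ 0 := (hpos _ hu₁).ne'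
  have hFs : ContDiffAt ℝ ∞ F u₁ := hF.contDiffAt (h₁.isOpen.mem_nhds hu₁)
  have hFd := differentiableAt_of_contDiffAt hFs
  have hDF := differentiableAt_of_contDiffAt (contDiffAt_fderiv hFs)
  have hΓ := hG.differentiableAt_christoffel hu
  have hΓ₁ := h₁.differentiableAt_christoffel hu₁
  have chr := fun {s t} (hs : s ∈ Ω₁) (ht : t ∈ Ω₂) => h₁.christoffel_warpForm h₂ hF hpos hs ht
  have hΓbc : ∀ b c : E₁ × E₂, DifferentiableAt ℝ
      (fun t => christoffel (WarpedClairaut.warpForm G₁ G₂ F) univ t b c) (u₁, u₂) := fun b c =>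
    (hΓ.clm_apply (differentiableAt_const b)).clm_apply (differentiableAt_const c)
  have hΓ₁bc : ∀ b c : E₁, DifferentiableAt ℝ (fun s => christoffel G₁ univ s b c) u₁ := fun b c =>
    (hΓ₁.clm_apply (differentiableAt_const b)).clm_apply (differentiableAt_const c)
  -- Only those derivatives of the Christoffel symbols that enter the two diagonal blocks are
  -- computed.
  have d₁ : ∀ a b c : E₁, fderiv ℝ (christoffel (WarpedClairaut.warpForm G₁ G₂ F) univ) (u₁, u₂)
      (a, 0) (b, 0) (c, 0) = (fderiv ℝ (christoffel G₁ univ) u₁ a b c, 0) := by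
    intro a b c
    rw [← fderiv_apply₂_const hΓ, fderiv_prod_left (hΓbc _ _)]
    have : (fun s => christoffel (WarpedClairaut.warpForm G₁ G₂ F) univ (s, u₂) (b, 0) (c, 0))
        =ᶠ[𝓝 u₁] fun s => (christoffel G₁ univ s b c, 0) := by
      filter_upwards [h₁.isOpen.mem_nhds hu₁] with s hs
      rw [chr hs hu₂]
      simp
    rw [this.fderiv_eq, DifferentiableAt.fderiv_prodMk (hΓ₁bc b c) (differentiableAt_const _)]
    simp [fderiv_apply₂_const hΓ₁]
  have d₂ : ∀ (a : E₂) (b c : E₁),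
      fderiv ℝ (christoffel (WarpedClairaut.warpForm G₁ G₂ F) univ) (u₁, u₂)
      (0, a) (b, 0) (c, 0) = 0 := by
    intro a b c
    rw [← fderiv_apply₂_const hΓ, fderiv_prod_right (hΓbc _ _)]
    have : (fun s => christoffel (WarpedClairaut.warpForm G₁ G₂ F) univ (u₁, s) (b, 0) (c, 0))
        =ᶠ[𝓝 u₂] fun s => (christoffel G₁ univ u₁ b c, 0) := by
      filter_upwards [h₂.isOpen.mem_nhds hu₂] with s hs
      rw [chr hu₁ hs]
      simp
    rw [this.fderiv_eq]
    simp
  have d₃ : ∀ (a : E₂) (b c : E₁),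
      fderiv ℝ (christoffel (WarpedClairaut.warpForm G₁ G₂ F) univ) (u₁, u₂)
      (b, 0) (0, a) (c, 0) = (0, ((F u₁)⁻¹ * fderiv ℝ (fderiv ℝ F) u₁ b c
        - (F u₁ ^ 2)⁻¹ * fderiv ℝ F u₁ b * fderiv ℝ F u₁ c) • a) := by
    intro a b c
    rw [← fderiv_apply₂_const hΓ, fderiv_prod_left (hΓbc _ _)]
    have : (fun s => christoffel (WarpedClairaut.warpForm G₁ G₂ F) univ (s, u₂) (0, a) (c, 0))
        =ᶠ[𝓝 u₁] fun s => ((0 : E₁), ((F s)⁻¹ * fderiv ℝ F s c) • a) := by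
      filter_upwards [h₁.isOpen.mem_nhds hu₁] with s hs
      rw [chr hs hu₂]
      simp
    have e₁ : DifferentiableAt ℝ (fun s => (F s)⁻¹) u₁ := hFd.fun_inv hF0
    have e₂ : DifferentiableAt ℝ (fun s => fderiv ℝ F s c) u₁ :=
      hDF.clm_apply (differentiableAt_const c)
    rw [this.fderiv_eq, DifferentiableAt.fderiv_prodMk (differentiableAt_const _)
      ((e₁.fun_mul e₂).smul_const a), fderiv_smul_const (e₁.fun_mul e₂), fderiv_fun_mul e₁ e₂]
    have e₃ : fderiv ℝ (fun s => (F s)⁻¹) u₁ b = -(F u₁ ^ 2)⁻¹ * fderiv ℝ F u₁ b := by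
      rw [fderiv_comp_apply (A := fun x : ℝ => x⁻¹) (differentiableAt_inv hF0) hFd, fderiv_inv]
      simp [mul_comm]
    simp [e₃, fderiv_apply_const hDF]
    congr 1
    ring
  rw [trace_prod]
  have t₁ : LinearMap.fst ℝ E₁ E₂ ∘ₗ (coordCurvature (WarpedClairaut.warpForm G₁ G₂ F) univ (u₁, u₂)
      (b, 0) (c, 0)).toLinearMap ∘ₗ LinearMap.inl ℝ E₁ E₂
      = (coordCurvature G₁ univ u₁ b c).toLinearMap := by
    ext a
    simp only [LinearMap.comp_apply, LinearMap.inl_apply, LinearMap.fst_apply,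
      ContinuousLinearMap.coe_coe, coordCurvature_apply, fderivWithin_univ, d₁, chr hu₁ hu₂]
    simp
  have t₂ : LinearMap.snd ℝ E₁ E₂ ∘ₗ (coordCurvature (WarpedClairaut.warpForm G₁ G₂ F) univ (u₁, u₂)
      (b, 0) (c, 0)).toLinearMap ∘ₗ LinearMap.inr ℝ E₁ E₂
      = (-((F u₁)⁻¹ * coordHess G₁ F u₁ b c)) • LinearMap.id := by
    ext a
    simp only [LinearMap.comp_apply, LinearMap.inr_apply, LinearMap.snd_apply,
      ContinuousLinearMap.coe_coe, coordCurvature_apply, fderivWithin_univ, d₂, d₃, chr hu₁ hu₂]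
    simp only [Prod.snd_sub, Prod.snd_add, Prod.snd_zero, map_zero, zero_apply, mul_zero, zero_smul,
      smul_zero, add_zero, sub_zero, zero_add, LinearMap.smul_apply, LinearMap.id_apply, smul_smul,
      coordHess]
    match_scalars
    field_simp
    ring
  rw [t₁, t₂, map_smul, LinearMap.trace_id, smul_eq_mul]
  ring

/-- The first block is `-G₂(b, c)` times `∇(F grad F) - dF ⊗ grad F`; the second is the curvature of
the second factor corrected by `|grad F|²`, as for an umbilic slice. As `div (F grad F) = F ΔF +
|grad F|²`, the coefficient is the classical `F ΔF + (n - 1) |grad F|²`. -/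
theorem trace_coordCurvature_warpForm_right (h₁ : IsMetricOn G₁ Ω₁) (h₂ : IsMetricOn G₂ Ω₂)
    (hF : ContDiffOn ℝ ∞ F Ω₁) (hpos : ∀ u ∈ Ω₁, 0 < F u) (hu₁ : u₁ ∈ Ω₁) (hu₂ : u₂ ∈ Ω₂)
    (b c : E₂) :
    LinearMap.trace ℝ (E₁ × E₂)
        (coordCurvature (WarpedClairaut.warpForm G₁ G₂ F) univ (u₁, u₂) (0, b) (0, c)).toLinearMap
      = LinearMap.trace ℝ E₂ (coordCurvature G₂ univ u₂ b c).toLinearMap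
        - warpCoeff G₁ F (Module.finrank ℝ E₂) u₁ * G₂ u₂ b c := by
  have hG := h₁.warpForm h₂ hF hpos
  have hu : (u₁, u₂) ∈ Ω₁ ×ˢ Ω₂ := ⟨hu₁, hu₂⟩
  have hF0 : F u₁ ≠ 0 := (hpos _ hu₁).ne'
  have hFs : ContDiffAt ℝ ∞ F u₁ := hF.contDiffAt (h₁.isOpen.mem_nhds hu₁)
  have hFd := differentiableAt_of_contDiffAt hFs
  have hDF := differentiableAt_of_contDiffAt (contDiffAt_fderiv hFs)
  have hn := differentiableAt_of_contDiffAt (h₁.contDiffAt_coordGrad hu₁ hFs)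
  have hΓ := hG.differentiableAt_christoffel hu
  have hΓ₂ := h₂.differentiableAt_christoffel hu₂
  have chr := fun {s t} (hs : s ∈ Ω₁) (ht : t ∈ Ω₂) => h₁.christoffel_warpForm h₂ hF hpos hs ht
  have hΓbc : ∀ b c : E₁ × E₂, DifferentiableAt ℝ
      (fun t => christoffel (WarpedClairaut.warpForm G₁ G₂ F) univ t b c) (u₁, u₂) := fun b c =>
    (hΓ.clm_apply (differentiableAt_const b)).clm_apply (differentiableAt_const c)
  have hΓ₂bc : ∀ b c : E₂, DifferentiableAt ℝ (fun s => christoffel G₂ univ s b c) u₂ := fun b c =>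
    (hΓ₂.clm_apply (differentiableAt_const b)).clm_apply (differentiableAt_const c)
  have hW : DifferentiableAt ℝ (fun s => F s • coordGrad G₁ F s) u₁ := hFd.smul hn
  have d₁ : ∀ (a : E₁) (b c : E₂),
      (fderiv ℝ (christoffel (WarpedClairaut.warpForm G₁ G₂ F) univ) (u₁, u₂)
      (a, 0) (0, b) (0, c)).1 = -G₂ u₂ b c • fderiv ℝ (fun s => F s • coordGrad G₁ F s) u₁ a := by
    intro a b c
    rw [← fderiv_apply₂_const hΓ, fderiv_prod_left (hΓbc _ _)]
    have : (fun s => christoffel (WarpedClairaut.warpForm G₁ G₂ F) univ (s, u₂) (0, b) (0, c))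
        =ᶠ[𝓝 u₁] fun s => ((-G₂ u₂ b c) • (F s • coordGrad G₁ F s),
          christoffel G₂ univ u₂ b c) := by
      filter_upwards [h₁.isOpen.mem_nhds hu₁] with s hs
      rw [chr hs hu₂]
      simp [smul_smul, mul_comm]
    rw [this.fderiv_eq, DifferentiableAt.fderiv_prodMk (hW.fun_const_smul _)
      (differentiableAt_const _), fderiv_fun_const_smul hW]
    simp
  have d₂ : ∀ (a : E₁) (b c : E₂),
      (fderiv ℝ (christoffel (WarpedClairaut.warpForm G₁ G₂ F) univ) (u₁, u₂)
      (0, b) (a, 0) (0, c)).1 = 0 := by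
    intro a b c
    rw [← fderiv_apply₂_const hΓ, fderiv_prod_right (hΓbc _ _)]
    have : (fun s => christoffel (WarpedClairaut.warpForm G₁ G₂ F) univ (u₁, s) (a, 0) (0, c))
        =ᶠ[𝓝 u₂] fun s => ((0 : E₁), ((F u₁)⁻¹ * fderiv ℝ F u₁ a) • c) := by
      filter_upwards [h₂.isOpen.mem_nhds hu₂] with s hs
      rw [chr hu₁ hs]
      simp
    rw [this.fderiv_eq]
    simp
  have d₃ : ∀ (a b c : E₂),
      (fderiv ℝ (christoffel (WarpedClairaut.warpForm G₁ G₂ F) univ) (u₁, u₂)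
      (0, a) (0, b) (0, c)).2 = fderiv ℝ (christoffel G₂ univ) u₂ a b c := by
    intro a b c
    rw [← fderiv_apply₂_const hΓ, fderiv_prod_right (hΓbc _ _)]
    have : (fun s => christoffel (WarpedClairaut.warpForm G₁ G₂ F) univ (u₁, s) (0, b) (0, c))
        =ᶠ[𝓝 u₂] fun s => (-(F u₁ * G₂ s b c) • coordGrad G₁ F u₁, christoffel G₂ univ s b c) := by
      filter_upwards [h₂.isOpen.mem_nhds hu₂] with s hs
      rw [chr hu₁ hs]
      simp
    have e : DifferentiableAt ℝ (fun s => -(F u₁ * G₂ s b c) • coordGrad G₁ F u₁) u₂ :=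
      ((((h₂.differentiableAt hu₂).clm_apply (differentiableAt_const b)).clm_apply
        (differentiableAt_const c)).const_mul (F u₁)).neg.smul_const _
    rw [this.fderiv_eq, DifferentiableAt.fderiv_prodMk e (hΓ₂bc b c), ← fderiv_apply₂_const hΓ₂]
    simp
  rw [trace_prod]
  have t₁ : LinearMap.fst ℝ E₁ E₂ ∘ₗ (coordCurvature (WarpedClairaut.warpForm G₁ G₂ F) univ (u₁, u₂)
      (0, b) (0, c)).toLinearMap ∘ₗ LinearMap.inl ℝ E₁ E₂
      = (-G₂ u₂ b c) • ((fderiv ℝ (fun s => F s • coordGrad G₁ F s) u₁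
            + (christoffel G₁ univ u₁).flip (F u₁ • coordGrad G₁ F u₁) : E₁ →L[ℝ] E₁).toLinearMap
          - ((fderiv ℝ F u₁).smulRight (coordGrad G₁ F u₁) : E₁ →L[ℝ] E₁).toLinearMap) := by
    ext a
    simp only [LinearMap.comp_apply, LinearMap.inl_apply, LinearMap.fst_apply,
      ContinuousLinearMap.coe_coe, coordCurvature_apply, fderivWithin_univ, d₁, d₂, chr hu₁ hu₂,
      Prod.fst_sub, Prod.fst_add]
    simp only [map_zero, zero_apply, mul_zero, zero_smul, smul_zero, add_zero, sub_zero, zero_add,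
      zero_sub, LinearMap.smul_apply, LinearMap.sub_apply, ContinuousLinearMap.coe_coe, add_apply,
      ContinuousLinearMap.flip_apply, ContinuousLinearMap.smulRight_apply, map_smul, map_neg,
      smul_apply, smul_eq_mul]
    match_scalars <;> field_simp
  have t₂ : LinearMap.snd ℝ E₁ E₂ ∘ₗ (coordCurvature (WarpedClairaut.warpForm G₁ G₂ F) univ (u₁, u₂)
      (0, b) (0, c)).toLinearMap ∘ₗ LinearMap.inr ℝ E₁ E₂
      = (coordCurvature G₂ univ u₂ b c).toLinearMap
        - fderiv ℝ F u₁ (coordGrad G₁ F u₁) • (G₂ u₂ b c • LinearMap.id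
          - (((G₂ u₂).flip c).smulRight b : E₂ →L[ℝ] E₂).toLinearMap) := by
    ext a
    simp only [LinearMap.comp_apply, LinearMap.inr_apply, LinearMap.snd_apply,
      ContinuousLinearMap.coe_coe, coordCurvature_apply, fderivWithin_univ, d₃, chr hu₁ hu₂,
      Prod.snd_sub, Prod.snd_add]
    simp only [map_zero, mul_zero, zero_smul, add_zero,
      zero_sub, LinearMap.smul_apply, LinearMap.sub_apply, ContinuousLinearMap.coe_coe,
      ContinuousLinearMap.flip_apply, ContinuousLinearMap.smulRight_apply, map_smul, map_neg,
      smul_eq_mul, LinearMap.id_apply, coordCurvature_apply, fderivWithin_univ]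
    match_scalars <;> field_simp
  simp only [t₁, t₂, map_smul, map_sub, trace_smulRight_clm, LinearMap.trace_id, warpCoeff,
    coordDiv, smul_eq_mul, ContinuousLinearMap.flip_apply]
  ring

end IsMetricOn

end WarpedRicci

/-! ### Transformation of Christoffel symbols, gradients and divergences under local isometries. -/

section ChartChange

variable {X : Type*} [NormedAddCommGroup X] [NormedSpace ℝ X] [FiniteDimensional ℝ X]
  {E : Type*} [NormedAddCommGroup E] [NormedSpace ℝ E] [FiniteDimensional ℝ E]
  {G' : E → E →L[ℝ] E →L[ℝ] ℝ} {G : X → X →L[ℝ] X →L[ℝ] ℝ} {Ω' : Set E} {Ω : Set X}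
  {τ : X → E} {u : X}

namespace IsMetricOn

/-- The transformation law of the Christoffel symbols. -/
theorem christoffel_transform (hG' : IsMetricOn G' Ω') (hG : IsMetricOn G Ω) (hu : u ∈ Ω)
    (hτu : τ u ∈ Ω') (hτ : ContDiffAt ℝ ∞ τ u) (hsurj : Function.Surjective (fderiv ℝ τ u))
    (hiso : ∀ᶠ t in 𝓝 u, ∀ v w, G t v w = G' (τ t) (fderiv ℝ τ t v) (fderiv ℝ τ t w)) (a b : X) :
    fderiv ℝ (fderiv ℝ τ) u a b + christoffel G' univ (τ u) (fderiv ℝ τ u a) (fderiv ℝ τ u b)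
      = fderiv ℝ τ u (christoffel G univ u a b) := by
  refine hG'.ext hτu fun z => ?_
  obtain ⟨c, rfl⟩ := hsurj z
  rw [← hG'.inner_covDeriv_fderiv hG hτu hu hτ hiso, covDeriv,
    fderiv_apply_const (differentiableAt_of_contDiffAt (contDiffAt_fderiv hτ))]

theorem coordGrad_transform {ℓ' : E → ℝ} {ℓ : X → ℝ} (hG' : IsMetricOn G' Ω')
    (hG : IsMetricOn G Ω) (hu : u ∈ Ω)
    (hτu : τ u ∈ Ω') (hτ : ContDiffAt ℝ ∞ τ u) (hsurj : Function.Surjective (fderiv ℝ τ u))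
    (hiso : ∀ v w, G u v w = G' (τ u) (fderiv ℝ τ u v) (fderiv ℝ τ u w))
    (hℓ' : DifferentiableAt ℝ ℓ' (τ u)) (hℓ : ℓ =ᶠ[𝓝 u] fun t => ℓ' (τ t)) :
    coordGrad G' ℓ' (τ u) = fderiv ℝ τ u (coordGrad G ℓ u) := by
  refine hG'.ext hτu fun z => ?_
  obtain ⟨c, rfl⟩ := hsurj z
  rw [← hiso, hG'.apply_coordGrad hτu, hG.apply_coordGrad hu, hℓ.fderiv_eq,
    fderiv_comp_apply hℓ' (differentiableAt_of_contDiffAt hτ)]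

theorem coordDiv_transform {W' : E → E} {W : X → X} (hG' : IsMetricOn G' Ω')
    (hG : IsMetricOn G Ω) (hu : u ∈ Ω)
    (hτu : τ u ∈ Ω') (hτ : ContDiffAt ℝ ∞ τ u) (hbij : Function.Bijective (fderiv ℝ τ u))
    (hiso : ∀ᶠ t in 𝓝 u, ∀ v w, G t v w = G' (τ t) (fderiv ℝ τ t v) (fderiv ℝ τ t w))
    (hW' : DifferentiableAt ℝ W' (τ u)) (hW : DifferentiableAt ℝ W u)
    (h : ∀ᶠ t in 𝓝 u, W' (τ t) = fderiv ℝ τ t (W t)) :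
    coordDiv G' W' (τ u) = coordDiv G W u := by
  have hD := differentiableAt_of_contDiffAt (contDiffAt_fderiv hτ)
  have h1 : ∀ a, fderiv ℝ W' (τ u) (fderiv ℝ τ u a)
      = fderiv ℝ (fderiv ℝ τ) u a (W u) + fderiv ℝ τ u (fderiv ℝ W u a) := by
    intro a
    have h2 : (fun t => W' (τ t)) =ᶠ[𝓝 u] fun t => fderiv ℝ τ t (W t) := h
    rw [← fderiv_comp_apply hW' (differentiableAt_of_contDiffAt hτ), h2.fderiv_eq,
      fderiv_apply_apply hD hW]
  unfold coordDiv
  -- Invariance of the trace under conjugation is the case of the identity projector in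
  -- `trace_comp_projector`.
  rw [← LinearMap.id_comp (ContinuousLinearMap.toLinearMap (fderiv ℝ W' (τ u) + _))]
  refine trace_comp_projector (D := (fderiv ℝ τ u).toLinearMap) hbij.injective
    (fun v => ⟨fun _ => hbij.surjective v, fun _ => rfl⟩) (fun v => rfl) fun a => ?_
  have h3 := hG'.christoffel_transform hG hu hτu hτ hbij.surjective hiso a (W u)
  simp only [ContinuousLinearMap.coe_coe, LinearMap.id_apply, add_apply,
    ContinuousLinearMap.flip_apply, map_add, h1, h.self_of_nhds, ← h3]
  abel

end IsMetricOn

end ChartChange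

/-! ### Hessians of basic functions, and Lie derivatives along multiples of gradients. -/

section Potentials

variable {E : Type*} [NormedAddCommGroup E] [NormedSpace ℝ E] [FiniteDimensional ℝ E]
  {G β : E → E →L[ℝ] E →L[ℝ] ℝ} {ℓ F : E → ℝ} {Ω : Set E} {u : E}

/-- The Hessian of a basic function on the vertical spaces. -/
theorem IsSplittingOn.coordHess_vertical (h : IsSplittingOn G β ℓ Ω) (hu : u ∈ Ω)
    (hF : ContDiffAt ℝ ∞ F u) (hFP : ∀ᶠ t in 𝓝 u, ∀ v, fderiv ℝ F t (proj G β t v) = 0)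
    {v w : E} (hv : proj G β u v = v) (hw : proj G β u w = w) :
    coordHess G F u v w = G u v w * fderiv ℝ F u (coordGrad G ℓ u) := by
  have hDF := differentiableAt_of_contDiffAt (contDiffAt_fderiv hF)
  have hP := differentiableAt_of_contDiffAt (h.contDiffAt_proj hu)
  -- Differentiate `dF (P w) = 0` in the direction `v`. By `h3`, the covariant derivative of `P w`
  -- has horizontal part `-β(v, w) grad ℓ`, and `dF` sees nothing else.
  have h1 : (fun t => fderiv ℝ F t (proj G β t w)) =ᶠ[𝓝 u] fun _ => (0 : ℝ) := by
    filter_upwards [hFP] with t ht using ht w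
  have h2 := congrArg (fun L : E →L[ℝ] ℝ => L v) h1.fderiv_eq
  simp only [fderiv_apply_apply hDF (hP.clm_apply (differentiableAt_const w)),
    fderiv_apply_const hP] at h2
  have h3 := h.covDeriv_proj (ι := id) (W := fun _ => w) hu differentiableAt_id
    (differentiableAt_const w) v
  have hℓw : fderiv ℝ ℓ u w = 0 := by rw [← hw]; exact h.basic u hu w
  simp only [covDeriv, fderiv_apply_const hP, id_eq, fderiv_id, ContinuousLinearMap.id_apply,
    fderiv_fun_const, Pi.zero_apply, zero_apply, zero_add, hw, hℓw, zero_smul, sub_zero] at h3 h2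
  have h4 := congrArg (fderiv ℝ F u) h3
  have hβ : β u v w = G u v w := by rw [← h.metric.apply_proj hu, hv]
  rw [map_add, map_sub, hFP.self_of_nhds, map_smul, hβ, smul_eq_mul] at h4
  rw [coordHess]
  linear_combination h2 - h4

/-- The Lie derivative of the metric along the field `c F grad F`. -/
theorem IsMetricOn.lieDeriv_smul_coordGrad (hG : IsMetricOn G Ω) (hu : u ∈ Ω)
    (hF : ContDiffAt ℝ ∞ F u) (c : ℝ) (v w : E) :
    fderiv ℝ G u ((c * F u) • coordGrad G F u) v w
        + G u (fderiv ℝ (fun s => (c * F s) • coordGrad G F s) u v) w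
        + G u v (fderiv ℝ (fun s => (c * F s) • coordGrad G F s) u w)
      = 2 * c * (fderiv ℝ F u v * fderiv ℝ F u w + F u * coordHess G F u v w) := by
  have hDF := differentiableAt_of_contDiffAt (contDiffAt_fderiv hF)
  have hFd := differentiableAt_of_contDiffAt hF
  have hn := differentiableAt_of_contDiffAt (hG.contDiffAt_coordGrad hu hF)
  have hq : DifferentiableAt ℝ (fun s => c * F s) u := hFd.const_mul c
  have hY : DifferentiableAt ℝ (fun s => (c * F s) • coordGrad G F s) u := hq.smul hn
  have key : ∀ v w, fderiv ℝ G u v (coordGrad G F u) w + G u (fderiv ℝ (coordGrad G F) u v) w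
      = fderiv ℝ (fderiv ℝ F) u v w := by
    intro v w
    have h1 : (fun t => G t (coordGrad G F t) w) =ᶠ[𝓝 u] fun t => fderiv ℝ F t w := by
      filter_upwards [hG.isOpen.mem_nhds hu] with t ht
      rw [hG.apply_coordGrad ht]
    have h2 := congrArg (fun L : E →L[ℝ] ℝ => L v) h1.fderiv_eq
    simpa [fderiv_apply_const hDF,
      fderiv_apply₂_apply (hG.differentiableAt hu) hn (differentiableAt_const w)] using h2
  have hY' : ∀ v, fderiv ℝ (fun s => (c * F s) • coordGrad G F s) u v
      = (c * fderiv ℝ F u v) • coordGrad G F u + (c * F u) • fderiv ℝ (coordGrad G F) u v := by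
    intro v
    rw [fderiv_fun_smul hq hn, fderiv_const_mul hFd]
    simp [add_comm]
  have k1 := key v w
  have k2 := key w v
  rw [fderiv_fderiv_comm hF w v] at k2
  rw [hY', hY', hG.symm u hu v, coordHess]
  have hΓ : fderiv ℝ F u (christoffel G univ u v w)
      = (1 / 2) * (fderiv ℝ G u v (coordGrad G F u) w + fderiv ℝ G u w (coordGrad G F u) v
        - fderiv ℝ G u (coordGrad G F u) v w) := by
    rw [← hG.apply_coordGrad hu, hG.symm u hu, hG.apply_christoffel hu,
      hG.fderiv_symm hu v w, hG.fderiv_symm hu w v]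
  rw [hΓ]
  simp only [map_add, map_smul, add_apply, smul_apply, smul_eq_mul, hG.apply_coordGrad hu]
  linear_combination c * F u * (k1 + k2)

end Potentials

/-! ### Local existence and smoothness of geodesics. -/

section Geodesics

variable {E : Type*} [NormedAddCommGroup E] [NormedSpace ℝ E] [FiniteDimensional ℝ E]
  {G : E → E →L[ℝ] E →L[ℝ] ℝ} {Ω : Set E} {u : E}

/-- Existence of geodesics with given initial velocity. -/
theorem IsMetricOn.exists_geodesic (hG : IsMetricOn G Ω) (hu : u ∈ Ω) (v : E) :
    ∃ c : ℝ → E, ∃ ε > 0, c 0 = u ∧ deriv c 0 = v ∧ ContDiffOn ℝ ∞ c (Ioo (-ε) ε) ∧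
      ∀ t ∈ Ioo (-ε) ε, c t ∈ Ω ∧
        deriv (deriv c) t = -christoffel G univ (c t) (deriv c t) (deriv c t) := by
  -- The geodesic equation as a first-order system for position and velocity.
  let f : E × E → E × E := fun p => (p.2, -christoffel G univ p.1 p.2 p.2)
  have hf : ContDiffOn ℝ ∞ f (Ω ×ˢ univ) := by
    have hΓ : ContDiffOn ℝ ∞ (fun p : E × E => christoffel G univ p.1) (Ω ×ˢ univ) :=
      ContDiffOn.comp (fun x hx => (hG.contDiffAt_christoffel hx).contDiffWithinAt)
        contDiffOn_fst fun p hp => hp.1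
    exact contDiffOn_snd.prodMk
      ((hΓ.clm_apply contDiffOn_snd).clm_apply contDiffOn_snd).neg
  have hopen : IsOpen (Ω ×ˢ (univ : Set E)) := hG.isOpen.prod isOpen_univ
  have hf0 : ContDiffAt ℝ 1 f (u, v) :=
    (hf.contDiffAt (hopen.mem_nhds ⟨hu, mem_univ _⟩)).of_le (by exact_mod_cast le_top)
  obtain ⟨α, hα0, ε, hε, hα⟩ :=
    hf0.exists_forall_mem_closedBall_exists_eq_forall_mem_Ioo_hasDerivAt₀ 0
  have hcont : ContinuousAt α 0 := (hα 0 (by simp [hε])).continuousAt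
  have hmem : ∀ᶠ t in 𝓝 (0 : ℝ), α t ∈ Ω ×ˢ (univ : Set E) :=
    hcont (hopen.mem_nhds (by rw [hα0]; exact ⟨hu, mem_univ _⟩))
  obtain ⟨δ, hδ, hball⟩ := Metric.eventually_nhds_iff.1 hmem
  -- Halving puts the closed interval `Icc (-η) η` inside both open ones; smoothness of the solution
  -- is obtained on a closed interval.
  set η := min (ε / 2) (δ / 2) with hη
  have hηpos : 0 < η := lt_min (by linarith) (by linarith)
  have hηε : η < ε := (min_le_left _ _).trans_lt (by linarith)
  have hηδ : η < δ := (min_le_right _ _).trans_lt (by linarith)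
  have hα' : ∀ t ∈ Icc (-η) η, HasDerivAt α (f (α t)) t := fun t ht =>
    hα t ⟨by linarith [ht.1], by linarith [ht.2]⟩
  have hm : ∀ t ∈ Icc (-η) η, α t ∈ Ω ×ˢ (univ : Set E) := fun t ht => hball (by
    rw [Real.dist_eq, sub_zero, abs_lt]; exact ⟨by linarith [ht.1], by linarith [ht.2]⟩)
  have hsmooth : ContDiffOn ℝ ∞ α (Icc (-η) η) := by
    refine ODE.contDiffOn_enat_Icc_of_hasDerivWithinAt (f := fun _ => f) (n := ⊤)
      (u := Ω ×ˢ (univ : Set E)) ?_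
      (fun t ht => (hα' t ht).hasDerivWithinAt) hm
    exact hf.comp contDiffOn_snd fun p hp => hp.2
  have hd1 : ∀ t ∈ Ioo (-η) η, deriv (fun s => (α s).1) t = (α t).2 := fun t ht =>
    ((ContinuousLinearMap.fst ℝ E E).hasFDerivAt.comp_hasDerivAt t
      (hα' t (Ioo_subset_Icc_self ht))).deriv
  have h0 : (0 : ℝ) ∈ Ioo (-η) η := ⟨by linarith, hηpos⟩
  refine ⟨fun s => (α s).1, η, hηpos, by simp [hα0], by rw [hd1 0 h0, hα0],
    (contDiff_fst.comp_contDiffOn hsmooth).mono Ioo_subset_Icc_self, fun t ht =>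
    ⟨(hm t (Ioo_subset_Icc_self ht)).1, ?_⟩⟩
  have h1 : deriv (fun s => (α s).1) =ᶠ[𝓝 t] fun s => (α s).2 := by
    filter_upwards [isOpen_Ioo.mem_nhds ht] with s hs using hd1 s hs
  rw [h1.deriv_eq, hd1 t ht]
  exact ((ContinuousLinearMap.snd ℝ E E).hasFDerivAt.comp_hasDerivAt t
    (hα' t (Ioo_subset_Icc_self ht))).deriv

end Geodesics

/-! ### Charts -/

section Charts

variable {E : Type*} [NormedAddCommGroup E] [NormedSpace ℝ E] [FiniteDimensional ℝ E]
  {H : Type*} [TopologicalSpace H] {I : ModelWithCorners ℝ E H} [I.Boundaryless]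
  {M : Type*} [TopologicalSpace M] [ChartedSpace H M] [IsManifold I ∞ M]
  {E' : Type*} [NormedAddCommGroup E'] [NormedSpace ℝ E'] [FiniteDimensional ℝ E']
  {H' : Type*} [TopologicalSpace H'] {J : ModelWithCorners ℝ E' H'} [J.Boundaryless]
  {N : Type*} [TopologicalSpace N] [ChartedSpace H' N] [IsManifold J ∞ N]

/-- The derivative of `φ` at `p`, as a linear map of the model spaces. -/
def tangentMapAt (I : ModelWithCorners ℝ E H) (J : ModelWithCorners ℝ E' H') (φ : M → N) (p : M) :
    E →L[ℝ] E' :=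
  mfderiv I J φ p

/-- The derivative of the inverse of the preferred chart at `x₀`. -/
def chartDeriv (I : ModelWithCorners ℝ E H) (x₀ : M) (u : E) : E →L[ℝ] E :=
  mfderiv 𝓘(ℝ, E) I (extChartAt I x₀).symm u

/-- The value of a metric, as a form on the model space. -/
def formAt (g : MetricField I M) (p : M) : E →L[ℝ] E →L[ℝ] ℝ := g p

/-- The map `φ` in the preferred charts at `x₀` and `y₀`. -/
def coordMap (I : ModelWithCorners ℝ E H) (J : ModelWithCorners ℝ E' H') (φ : M → N) (x₀ : M)
    (y₀ : N) (u : E) : E' :=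
  extChartAt J y₀ (φ ((extChartAt I x₀).symm u))

variable {x₀ : M} {u : E}

theorem coordMetric_eq (g : MetricField I M) (x₀ : M) (u v w : E) :
    coordMetric g x₀ u v w
      = formAt g ((extChartAt I x₀).symm u) (chartDeriv I x₀ u v) (chartDeriv I x₀ u w) := by
  rw [coordMetric_apply, I.range_eq_univ]
  simp only [mfderivWithin_univ]
  rfl

theorem contMDiffAt_extChartAt_symm (hu : u ∈ (extChartAt I x₀).target) :
    ContMDiffAt 𝓘(ℝ, E) I ∞ (extChartAt I x₀).symm u :=
  (contMDiffOn_extChartAt_symm x₀).contMDiffAt ((isOpen_extChartAt_target x₀).mem_nhds hu)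

theorem mdifferentiableAt_extChartAt_symm (hu : u ∈ (extChartAt I x₀).target) :
    MDifferentiableAt 𝓘(ℝ, E) I (extChartAt I x₀).symm u :=
  (contMDiffAt_extChartAt_symm hu).mdifferentiableAt (by simp)

theorem chartDeriv_bijective (hu : u ∈ (extChartAt I x₀).target) :
    Function.Bijective (chartDeriv I x₀ u) := by
  have h := isInvertible_mfderivWithin_extChartAt_symm (I := I) (x := x₀) hu
  rw [I.range_eq_univ, mfderivWithin_univ] at h
  exact h.bijective

/-- `TangentSpace I x` is the model space by way of the preferred chart at `x`, so values at the
centre of a chart are read off without a change of frame. -/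
theorem chartDeriv_self (x : M) : chartDeriv I x (extChartAt I x x) = ContinuousLinearMap.id ℝ E := by
  have h := mfderivWithin_range_extChartAt_symm (I := I) (x := x)
  rw [I.range_eq_univ, mfderivWithin_univ] at h
  exact h

theorem contDiffAt_coordMap {φ : M → N} {y₀ : N} (hu : u ∈ (extChartAt I x₀).target)
    (hφ : ContMDiffAt I J ∞ φ ((extChartAt I x₀).symm u))
    (hy : φ ((extChartAt I x₀).symm u) ∈ (extChartAt J y₀).source) :
    ContDiffAt ℝ ∞ (coordMap I J φ x₀ y₀) u := by
  rw [← contMDiffAt_iff_contDiffAt]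
  have h1 : ContMDiffAt J 𝓘(ℝ, E') ∞ (extChartAt J y₀) (φ ((extChartAt I x₀).symm u)) :=
    contMDiffAt_extChartAt' (by rwa [← extChartAt_source J])
  exact h1.comp u (hφ.comp u (contMDiffAt_extChartAt_symm hu))

theorem coordMap_symm {φ : M → N} {y₀ : N}
    (hy : φ ((extChartAt I x₀).symm u) ∈ (extChartAt J y₀).source) :
    (extChartAt J y₀).symm (coordMap I J φ x₀ y₀ u) = φ ((extChartAt I x₀).symm u) :=
  (extChartAt J y₀).left_inv hy

theorem coordMap_mem {φ : M → N} {y₀ : N}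
    (hy : φ ((extChartAt I x₀).symm u) ∈ (extChartAt J y₀).source) :
    coordMap I J φ x₀ y₀ u ∈ (extChartAt J y₀).target :=
  (extChartAt J y₀).map_source hy

theorem eventually_coordMap_source {φ : M → N} {y₀ : N} (hu : u ∈ (extChartAt I x₀).target)
    (hφ : ContinuousAt φ ((extChartAt I x₀).symm u))
    (hy : φ ((extChartAt I x₀).symm u) ∈ (extChartAt J y₀).source) :
    ∀ᶠ t in 𝓝 u, t ∈ (extChartAt I x₀).target ∧
      φ ((extChartAt I x₀).symm t) ∈ (extChartAt J y₀).source := by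
  have h1 : ContinuousAt (fun t => φ ((extChartAt I x₀).symm t)) u :=
    ContinuousAt.comp (f := (extChartAt I x₀).symm) hφ (contMDiffAt_extChartAt_symm hu).continuousAt
  exact Filter.Eventually.and ((isOpen_extChartAt_target x₀).mem_nhds hu)
    (h1 ((isOpen_extChartAt_source y₀).mem_nhds hy))

/-- The chain rule for a map in charts. -/
theorem chartDeriv_fderiv_coordMap {φ : M → N} {y₀ : N} (hu : u ∈ (extChartAt I x₀).target)
    (hφ : ContMDiffAt I J ∞ φ ((extChartAt I x₀).symm u))
    (hy : φ ((extChartAt I x₀).symm u) ∈ (extChartAt J y₀).source) (v : E) :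
    chartDeriv J y₀ (coordMap I J φ x₀ y₀ u) (fderiv ℝ (coordMap I J φ x₀ y₀) u v)
      = tangentMapAt I J φ ((extChartAt I x₀).symm u) (chartDeriv I x₀ u v) := by
  have h1 : MDifferentiableAt 𝓘(ℝ, E) 𝓘(ℝ, E') (coordMap I J φ x₀ y₀) u :=
    ((contDiffAt_coordMap hu hφ hy).differentiableAt (by simp)).mdifferentiableAt
  have h2 := mdifferentiableAt_extChartAt_symm (I := J) (coordMap_mem hy)
  have h3 : MDifferentiableAt I J φ ((extChartAt I x₀).symm u) := hφ.mdifferentiableAt (by simp)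
  have h4 := mdifferentiableAt_extChartAt_symm hu
  have e : (extChartAt J y₀).symm ∘ coordMap I J φ x₀ y₀ =ᶠ[𝓝 u] φ ∘ (extChartAt I x₀).symm := by
    filter_upwards [eventually_coordMap_source hu hφ.continuousAt hy] with t ht
    exact coordMap_symm ht.2
  have e2 := e.mfderiv_eq (I := 𝓘(ℝ, E)) (I' := J)
  have c1 := mfderiv_comp_apply u h2 h1 v
  have c2 := mfderiv_comp_apply u h3 h4 v
  rw [mfderiv_eq_fderiv] at c1
  have e3 : (mfderiv 𝓘(ℝ, E) J ((extChartAt J y₀).symm ∘ coordMap I J φ x₀ y₀) u : E →L[ℝ] E') v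
      = (mfderiv 𝓘(ℝ, E) J (φ ∘ (extChartAt I x₀).symm) u : E →L[ℝ] E') v :=
    congrArg (fun L : E →L[ℝ] E' => L v) e2
  exact c1.symm.trans (e3.trans c2)

theorem coordMetric_pullback {φ : M → N} {y₀ : N} (h : MetricField J N)
    (hu : u ∈ (extChartAt I x₀).target)
    (hφ : ContMDiffAt I J ∞ φ ((extChartAt I x₀).symm u))
    (hy : φ ((extChartAt I x₀).symm u) ∈ (extChartAt J y₀).source) (v w : E) :
    coordMetric (pullbackMetric I h φ) x₀ u v w
      = coordMetric h y₀ (coordMap I J φ x₀ y₀ u) (fderiv ℝ (coordMap I J φ x₀ y₀) u v)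
        (fderiv ℝ (coordMap I J φ x₀ y₀) u w) := by
  rw [coordMetric_eq, coordMetric_eq, chartDeriv_fderiv_coordMap hu hφ hy,
    chartDeriv_fderiv_coordMap hu hφ hy, coordMap_symm hy]
  rfl

end Charts

/-! ### Smooth metrics -/

section SmoothMetric

variable {E : Type*} [NormedAddCommGroup E] [NormedSpace ℝ E] [FiniteDimensional ℝ E]
  {H : Type*} [TopologicalSpace H] {I : ModelWithCorners ℝ E H} [I.Boundaryless]
  {M : Type*} [TopologicalSpace M] [ChartedSpace H M] [IsManifold I ∞ M]
  {E' : Type*} [NormedAddCommGroup E'] [NormedSpace ℝ E'] [FiniteDimensional ℝ E']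
  {H' : Type*} [TopologicalSpace H'] {J : ModelWithCorners ℝ E' H'} [J.Boundaryless]
  {N : Type*} [TopologicalSpace N] [ChartedSpace H' N] [IsManifold J ∞ N]

/-- A metric field is a smooth Riemannian metric: its expressions in charts are. -/
def IsSmoothMetric (g : MetricField I M) : Prop :=
  ∀ x₀ : M, IsMetricOn (coordMetric g x₀) (extChartAt I x₀).target

theorem contMDiffAt_mfderiv_extChartAt_symm {x₀ : M} {u : E} (hu : u ∈ (extChartAt I x₀).target)
    (v : E) :
    ContMDiffAt 𝓘(ℝ, E) I.tangent ∞
      (fun t : E => (⟨(extChartAt I x₀).symm t,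
        mfderiv 𝓘(ℝ, E) I (extChartAt I x₀).symm t v⟩ : TangentBundle I M)) u := by
  have h1 := (contMDiffOn_extChartAt_symm (I := I) (n := ∞) x₀).contMDiffOn_tangentMapWithin
    (m := ∞) (by simp) (isOpen_extChartAt_target (I := I) x₀).uniqueMDiffOn
  have h2 : ContMDiffAt 𝓘(ℝ, E) 𝓘(ℝ, E).tangent ∞
      (fun t : E => (⟨t, v⟩ : TangentBundle 𝓘(ℝ, E) E)) u :=
    contMDiffAt_vectorSpace_iff_contDiffAt.2 contDiffAt_const
  have hop : IsOpen (Bundle.TotalSpace.proj ⁻¹' (extChartAt I x₀).target :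
      Set (TangentBundle 𝓘(ℝ, E) E)) :=
    (isOpen_extChartAt_target (I := I) x₀).preimage (FiberBundle.continuous_proj E _)
  have h3 := (h1.contMDiffAt (x := (⟨u, v⟩ : TangentBundle 𝓘(ℝ, E) E))
    (hop.mem_nhds hu)).comp u h2
  refine h3.congr_of_eventuallyEq ?_
  filter_upwards [(isOpen_extChartAt_target (I := I) x₀).mem_nhds hu] with t ht
  simp only [Function.comp_apply, tangentMapWithin]
  rw [mfderivWithin_of_isOpen (isOpen_extChartAt_target (I := I) x₀) ht]

/-- The bundled metrics enter the proof only through this lemma. The chartwise notion is stable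
under warped products, immersions and rescaling, and is the one used from here on. -/
theorem isSmoothMetric_inner
    (g : Bundle.ContMDiffRiemannianMetric I ∞ E (fun x : M => TangentSpace I x)) :
    IsSmoothMetric (I := I) g.inner := by
  intro x₀
  refine ⟨isOpen_extChartAt_target x₀, ?_, ?_, ?_⟩
  · rw [contDiffOn_clm_apply]
    intro v
    rw [contDiffOn_clm_apply]
    intro w u hu
    refine ContDiffAt.contDiffWithinAt ?_
    rw [← contMDiffAt_iff_contDiffAt]
    have : ContMDiffAt 𝓘(ℝ, E) (I.prod 𝓘(ℝ)) ∞
        (fun t : E ↦ Bundle.TotalSpace.mk' ℝ (E := Bundle.Trivial M ℝ) ((extChartAt I x₀).symm t)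
          (g.inner ((extChartAt I x₀).symm t) (mfderiv 𝓘(ℝ, E) I (extChartAt I x₀).symm t v)
            (mfderiv 𝓘(ℝ, E) I (extChartAt I x₀).symm t w))) u := by
      apply ContMDiffAt.clm_bundle_apply₂ (F₁ := E) (F₂ := E)
      · exact ContMDiffAt.comp u g.contMDiff.contMDiffAt (contMDiffAt_extChartAt_symm hu)
      · exact contMDiffAt_mfderiv_extChartAt_symm hu v
      · exact contMDiffAt_mfderiv_extChartAt_symm hu w
    rw [Bundle.contMDiffAt_totalSpace] at this
    refine this.2.congr_of_eventuallyEq (Eventually.of_forall fun t => ?_)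
    exact coordMetric_eq _ _ _ _ _
  · intro u hu v w
    rw [coordMetric_eq, coordMetric_eq]
    exact g.symm _ _ _
  · intro u hu v hv
    rw [coordMetric_eq]
    refine g.pos _ _ ?_
    intro h0
    exact hv ((chartDeriv_bijective hu).1 (h0.trans (map_zero (chartDeriv I x₀ u)).symm))

theorem IsSmoothMetric.symm {g : MetricField I M} (hg : IsSmoothMetric g) (x : M)
    (v w : E) : formAt g x v w = formAt g x w v := by
  have h := (hg x).symm _ (mem_extChartAt_target x) v w
  rw [coordMetric_eq, coordMetric_eq, chartDeriv_self, extChartAt_to_inv] at h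
  exact h

theorem IsSmoothMetric.pos {g : MetricField I M} (hg : IsSmoothMetric g) (x : M)
    (v : E) (hv : v ≠ 0) : 0 < formAt g x v v := by
  have h := (hg x).pos _ (mem_extChartAt_target x) v hv
  rw [coordMetric_eq, chartDeriv_self, extChartAt_to_inv] at h
  exact h

/-- Stated without injectivity of the derivative, since it also serves for the form `φ^*h` of a
Riemannian map, which may degenerate. -/
theorem contDiffOn_coordMetric_pullback {h : MetricField J N} (hh : IsSmoothMetric h) {φ : M → N}
    (x₀ : M) (hφ : ContMDiff I J ∞ φ) :
    ContDiffOn ℝ ∞ (coordMetric (pullbackMetric I h φ) x₀) (extChartAt I x₀).target := by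
  rw [contDiffOn_clm_apply]
  intro v
  rw [contDiffOn_clm_apply]
  intro w u hu
  set y₀ := φ ((extChartAt I x₀).symm u) with hy₀
  have hy : φ ((extChartAt I x₀).symm u) ∈ (extChartAt J y₀).source := mem_extChartAt_source y₀
  have hc := contDiffAt_coordMap hu hφ.contMDiffAt hy
  have hD : ContDiffAt ℝ ∞ (fderiv ℝ (coordMap I J φ x₀ y₀)) u := hc.fderiv_right (by simp)
  have hG := ((hh y₀).contDiffAt (coordMap_mem hy)).comp u hc
  refine ContDiffAt.contDiffWithinAt (((hG.clm_apply
    (hD.clm_apply contDiffAt_const (g := fun _ => v))).clm_apply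
    (hD.clm_apply contDiffAt_const (g := fun _ => w))).congr_of_eventuallyEq ?_)
  filter_upwards [eventually_coordMap_source hu hφ.continuous.continuousAt hy] with t ht
  exact coordMetric_pullback h ht.1 hφ.contMDiffAt ht.2 v w

theorem IsSmoothMetric.pullback {h : MetricField J N} (hh : IsSmoothMetric h) {φ : M → N}
    (hφ : ContMDiff I J ∞ φ) (hinj : ∀ x, Function.Injective (tangentMapAt I J φ x)) :
    IsSmoothMetric (pullbackMetric I h φ) := by
  intro x₀
  refine ⟨isOpen_extChartAt_target x₀, contDiffOn_coordMetric_pullback hh x₀ hφ, ?_, ?_⟩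
  · intro u hu v w
    rw [coordMetric_eq, coordMetric_eq]
    exact hh.symm _ _ _
  · intro u hu v hv
    rw [coordMetric_eq]
    refine hh.pos _ _ ?_
    intro h0
    refine hv ((chartDeriv_bijective hu).1 ?_)
    rw [map_zero]
    exact hinj _ (h0.trans (map_zero (tangentMapAt I J φ _)).symm)

end SmoothMetric

/-! ### Dependence on germs -/

section Germ

variable {E : Type*} [NormedAddCommGroup E] [NormedSpace ℝ E] [FiniteDimensional ℝ E]
  {G G' β β' : E → E →L[ℝ] E →L[ℝ] ℝ} {ℓ : E → ℝ} {Ω : Set E} {u : E}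

theorem christoffel_congr (h : G =ᶠ[𝓝 u] G') : christoffel G univ u = christoffel G' univ u := by
  simp only [christoffel, christoffelFirst, fderivWithin_univ, h.fderiv_eq, h.self_of_nhds]

theorem christoffel_eventuallyEq (h : G =ᶠ[𝓝 u] G') :
    christoffel G univ =ᶠ[𝓝 u] christoffel G' univ := by
  filter_upwards [h.eventuallyEq_nhds] with t ht
  exact christoffel_congr ht

theorem coordCurvature_congr (h : G =ᶠ[𝓝 u] G') (b c : E) :
    coordCurvature G univ u b c = coordCurvature G' univ u b c := by
  simp only [coordCurvature, fderivWithin_univ, (christoffel_eventuallyEq h).fderiv_eq,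
    christoffel_congr h]

theorem IsMetricOn.congr (h : IsMetricOn G Ω) (e : EqOn G' G Ω) : IsMetricOn G' Ω := by
  refine ⟨h.isOpen, h.contDiffOn.congr e, fun u hu v w => ?_, fun u hu v hv => ?_⟩
  · rw [e hu]; exact h.symm u hu v w
  · rw [e hu]; exact h.pos u hu v hv

theorem proj_congr (h : G u = G' u) (h' : β u = β' u) : proj G β u = proj G' β' u := by
  simp only [proj, h, h']

theorem IsSplittingOn.congr (h : IsSplittingOn G β ℓ Ω) (e : EqOn G' G Ω) (e' : EqOn β' β Ω) :
    IsSplittingOn G' β' ℓ Ω := by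
  have hp : ∀ u ∈ Ω, proj G' β' u = proj G β u := fun u hu => proj_congr (e hu) (e' hu)
  have n : ∀ u ∈ Ω, Ω ∈ 𝓝 u := fun u hu => h.metric.isOpen.mem_nhds hu
  refine ⟨h.metric.congr e, h.contDiffOn.congr e', h.contDiffOn_pot, fun u hu v w => ?_,
    fun u hu v => ?_, fun u hu v => ?_, fun u hu a b c => ?_⟩
  · rw [e' hu]; exact h.symm u hu v w
  · rw [hp u hu]; exact h.idem u hu v
  · rw [hp u hu]; exact h.basic u hu v
  · rw [(e'.eventuallyEq_of_mem (n u hu)).fderiv_eq, e' hu,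
      christoffel_congr (e.eventuallyEq_of_mem (n u hu))]
    exact h.deriv u hu a b c

end Germ

/-! ### Products -/

section Product

variable {E₁ : Type*} [NormedAddCommGroup E₁] [NormedSpace ℝ E₁] [FiniteDimensional ℝ E₁]
  {H₁ : Type*} [TopologicalSpace H₁] {I₁ : ModelWithCorners ℝ E₁ H₁} [I₁.Boundaryless]
  {M₁ : Type*} [TopologicalSpace M₁] [ChartedSpace H₁ M₁] [IsManifold I₁ ∞ M₁]
  {E₂ : Type*} [NormedAddCommGroup E₂] [NormedSpace ℝ E₂] [FiniteDimensional ℝ E₂]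
  {H₂ : Type*} [TopologicalSpace H₂] {I₂ : ModelWithCorners ℝ E₂ H₂} [I₂.Boundaryless]
  {M₂ : Type*} [TopologicalSpace M₂] [ChartedSpace H₂ M₂] [IsManifold I₂ ∞ M₂]
  {E₃ : Type*} [NormedAddCommGroup E₃] [NormedSpace ℝ E₃] [FiniteDimensional ℝ E₃]
  {H₃ : Type*} [TopologicalSpace H₃] {J₁ : ModelWithCorners ℝ E₃ H₃} [J₁.Boundaryless]
  {N₁ : Type*} [TopologicalSpace N₁] [ChartedSpace H₃ N₁] [IsManifold J₁ ∞ N₁]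
  {E₄ : Type*} [NormedAddCommGroup E₄] [NormedSpace ℝ E₄] [FiniteDimensional ℝ E₄]
  {H₄ : Type*} [TopologicalSpace H₄] {J₂ : ModelWithCorners ℝ E₄ H₄} [J₂.Boundaryless]
  {N₂ : Type*} [TopologicalSpace N₂] [ChartedSpace H₄ N₂] [IsManifold J₂ ∞ N₂]

theorem extChartAt_prod_target (p : M₁ × M₂) :
    (extChartAt (I₁.prod I₂) p).target
      = (extChartAt I₁ p.1).target ×ˢ (extChartAt I₂ p.2).target := by
  rw [extChartAt_prod]; rfl

theorem extChartAt_prod_symm_apply (p : M₁ × M₂) (u : E₁ × E₂) :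
    (extChartAt (I₁.prod I₂) p).symm u
      = ((extChartAt I₁ p.1).symm u.1, (extChartAt I₂ p.2).symm u.2) := by
  rw [extChartAt_prod]; rfl

theorem extChartAt_prod_apply (p q : M₁ × M₂) :
    extChartAt (I₁.prod I₂) p q = (extChartAt I₁ p.1 q.1, extChartAt I₂ p.2 q.2) := by
  rw [extChartAt_prod]; rfl

theorem tangentMapAt_prodMap {φ₁ : M₁ → N₁} {φ₂ : M₂ → N₂} {p : M₁ × M₂}
    (h₁ : MDifferentiableAt I₁ J₁ φ₁ p.1) (h₂ : MDifferentiableAt I₂ J₂ φ₂ p.2) (v : E₁ × E₂) :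
    tangentMapAt (I₁.prod I₂) (J₁.prod J₂) (Prod.map φ₁ φ₂) p v
      = (tangentMapAt I₁ J₁ φ₁ p.1 v.1, tangentMapAt I₂ J₂ φ₂ p.2 v.2) := by
  have h := mfderiv_prodMap h₁ h₂
  exact congrArg (fun L : E₁ × E₂ →L[ℝ] E₃ × E₄ => L v) h

theorem chartDeriv_prod {p : M₁ × M₂} {u : E₁ × E₂} (h₁ : u.1 ∈ (extChartAt I₁ p.1).target)
    (h₂ : u.2 ∈ (extChartAt I₂ p.2).target) (v : E₁ × E₂) :
    chartDeriv (I₁.prod I₂) p u v = (chartDeriv I₁ p.1 u.1 v.1, chartDeriv I₂ p.2 u.2 v.2) := by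
  have h := mfderiv_prodMap (mdifferentiableAt_extChartAt_symm h₁)
    (mdifferentiableAt_extChartAt_symm h₂)
  -- The product of the model structures of `E₁` and `E₂` is replaced by the model structure of `E₁
  -- × E₂` itself, in which `chartDeriv` is formed.
  rw [← modelWithCornersSelf_prod, chartedSpaceSelf_prod] at h
  have e : ((extChartAt (I₁.prod I₂) p).symm : E₁ × E₂ → M₁ × M₂)
      = Prod.map (extChartAt I₁ p.1).symm (extChartAt I₂ p.2).symm := by
    funext t; exact extChartAt_prod_symm_apply p t
  unfold chartDeriv
  rw [e]
  exact congrArg (fun L : E₁ × E₂ →L[ℝ] E₁ × E₂ => L v) h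

theorem formAt_warpedMetric (g₁ : MetricField I₁ M₁) (g₂ : MetricField I₂ M₂) (f : M₁ → ℝ)
    (p : M₁ × M₂) (v w : E₁ × E₂) :
    formAt (warpedMetric g₁ g₂ f) p v w
      = formAt g₁ p.1 v.1 w.1 + f p.1 ^ 2 * formAt g₂ p.2 v.2 w.2 := by
  have h₁ := mfderiv_fst (I := I₁) (I' := I₂) (x := p)
  have h₂ := mfderiv_snd (I := I₁) (I' := I₂) (x := p)
  have e₁ : ∀ v : E₁ × E₂, tangentMapAt (I₁.prod I₂) I₁ (Prod.fst : M₁ × M₂ → M₁) p v = v.1 :=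
    fun v => congrArg (fun L : E₁ × E₂ →L[ℝ] E₁ => L v) h₁
  have e₂ : ∀ v : E₁ × E₂, tangentMapAt (I₁.prod I₂) I₂ (Prod.snd : M₁ × M₂ → M₂) p v = v.2 :=
    fun v => congrArg (fun L : E₁ × E₂ →L[ℝ] E₂ => L v) h₂
  have : formAt (warpedMetric g₁ g₂ f) p v w
      = formAt g₁ p.1 (tangentMapAt (I₁.prod I₂) I₁ (Prod.fst : M₁ × M₂ → M₁) p v)
          (tangentMapAt (I₁.prod I₂) I₁ (Prod.fst : M₁ × M₂ → M₁) p w)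
        + f p.1 ^ 2 * formAt g₂ p.2 (tangentMapAt (I₁.prod I₂) I₂ (Prod.snd : M₁ × M₂ → M₂) p v)
          (tangentMapAt (I₁.prod I₂) I₂ (Prod.snd : M₁ × M₂ → M₂) p w) := rfl
  rw [this, e₁, e₁, e₂, e₂]

theorem coordMetric_warpedMetric (g₁ : MetricField I₁ M₁) (g₂ : MetricField I₂ M₂) (f : M₁ → ℝ)
    (p : M₁ × M₂) :
    EqOn (coordMetric (warpedMetric g₁ g₂ f) p)
      (warpForm (coordMetric g₁ p.1) (coordMetric g₂ p.2)
        (fun t => f ((extChartAt I₁ p.1).symm t)))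
      ((extChartAt I₁ p.1).target ×ˢ (extChartAt I₂ p.2).target) := by
  intro u hu
  refine ContinuousLinearMap.ext fun v => ContinuousLinearMap.ext fun w => ?_
  rw [coordMetric_eq, chartDeriv_prod hu.1 hu.2, chartDeriv_prod hu.1 hu.2, formAt_warpedMetric,
    warpForm_apply, coordMetric_eq, coordMetric_eq, extChartAt_prod_symm_apply]

theorem formAt_pullbackMetric {E : Type*} [NormedAddCommGroup E] [NormedSpace ℝ E]
    {H : Type*} [TopologicalSpace H] {I : ModelWithCorners ℝ E H}
    {M : Type*} [TopologicalSpace M] [ChartedSpace H M] (h : MetricField J₁ N₁) (φ : M → N₁)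
    (x : M) (v w : E) :
    formAt (pullbackMetric I h φ) x v w
      = formAt h (φ x) (tangentMapAt I J₁ φ x v) (tangentMapAt I J₁ φ x w) := rfl

/-- The compatibility of the warping functions is what makes the pulled-back metric a warped sum
with the same weight `f`, and with it the vertical form of the product map. -/
theorem pullbackMetric_prodMap {φ₁ : M₁ → N₁} {φ₂ : M₂ → N₂} {f : M₁ → ℝ} {ρ : N₁ → ℝ}
    (hf : ∀ x, ρ (φ₁ x) = f x)
    (h₁ : MDifferentiable I₁ J₁ φ₁) (h₂ : MDifferentiable I₂ J₂ φ₂) (k₁ : MetricField J₁ N₁)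
    (k₂ : MetricField J₂ N₂) :
    pullbackMetric (I₁.prod I₂) (warpedMetric k₁ k₂ ρ) (Prod.map φ₁ φ₂)
      = warpedMetric (pullbackMetric I₁ k₁ φ₁) (pullbackMetric I₂ k₂ φ₂) f := by
  funext p
  have h : ∀ v w, formAt (pullbackMetric (I₁.prod I₂) (warpedMetric k₁ k₂ ρ) (Prod.map φ₁ φ₂)) p v w
      = formAt (warpedMetric (pullbackMetric I₁ k₁ φ₁) (pullbackMetric I₂ k₂ φ₂) f) p v w := by
    intro v w
    rw [formAt_warpedMetric, formAt_pullbackMetric, formAt_pullbackMetric, formAt_pullbackMetric,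
      tangentMapAt_prodMap (h₁ _) (h₂ _), tangentMapAt_prodMap (h₁ _) (h₂ _), formAt_warpedMetric,
      ← hf]
    rfl
  exact ContinuousLinearMap.ext fun v => ContinuousLinearMap.ext fun w => h v w

theorem contDiffOn_comp_extChartAt_symm {f : M₁ → ℝ} (hf : ContMDiff I₁ 𝓘(ℝ, ℝ) ∞ f) (x₀ : M₁) :
    ContDiffOn ℝ ∞ (fun t => f ((extChartAt I₁ x₀).symm t)) (extChartAt I₁ x₀).target := by
  rw [← contMDiffOn_iff_contDiffOn]
  exact hf.comp_contMDiffOn (contMDiffOn_extChartAt_symm x₀)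

theorem IsSmoothMetric.warpedMetric {g₁ : MetricField I₁ M₁} {g₂ : MetricField I₂ M₂} {f : M₁ → ℝ}
    (h₁ : IsSmoothMetric g₁) (h₂ : IsSmoothMetric g₂) (hf : ContMDiff I₁ 𝓘(ℝ, ℝ) ∞ f)
    (hpos : ∀ x, 0 < f x) : IsSmoothMetric (warpedMetric g₁ g₂ f) := by
  intro p
  rw [extChartAt_prod_target]
  exact ((h₁ p.1).warpForm (h₂ p.2) (contDiffOn_comp_extChartAt_symm hf p.1)
    fun u _ => hpos _).congr (coordMetric_warpedMetric g₁ g₂ f p)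

end Product

/-! ### Riemannian maps in charts -/

/-- The vector `b` represents the functional `g(v, ·)` on the kernel of `L`, where `g` is still
positive and hence invertible. -/
theorem exists_orthogonal_decomposition {E E' : Type*} [NormedAddCommGroup E] [NormedSpace ℝ E]
    [FiniteDimensional ℝ E] [NormedAddCommGroup E'] [NormedSpace ℝ E'] (g : E →L[ℝ] E →L[ℝ] ℝ)
    (hg : ∀ v, v ≠ 0 → 0 < g v v) (L : E →L[ℝ] E') (v : E) :
    ∃ a b, v = a + b ∧ (∀ w, L w = 0 → g a w = 0) ∧ L b = 0 := by
  let K : Submodule ℝ E := LinearMap.ker L.toLinearMap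
  let gK : K →L[ℝ] K →L[ℝ] ℝ := g.bilinearComp K.subtypeL K.subtypeL
  have hgK : ∀ v, v ≠ 0 → 0 < gK v v := fun v hv => hg v (by simpa using hv)
  let b : K := ContinuousLinearMap.inverse gK ((g v).comp K.subtypeL)
  have hb : gK b = (g v).comp K.subtypeL := apply_inverse_of_pos hgK _
  refine ⟨v - b, b, by simp, fun w hw => ?_, b.2⟩
  have h : g b w = g v w := congrArg (fun l : K →L[ℝ] ℝ => l ⟨w, hw⟩) hb
  simp [h]

section RiemannianMap

variable {E : Type*} [NormedAddCommGroup E] [NormedSpace ℝ E] [FiniteDimensional ℝ E]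
  {H : Type*} [TopologicalSpace H] {I : ModelWithCorners ℝ E H} [I.Boundaryless]
  {M : Type*} [TopologicalSpace M] [ChartedSpace H M] [IsManifold I ∞ M]
  {E' : Type*} [NormedAddCommGroup E'] [NormedSpace ℝ E'] [FiniteDimensional ℝ E']
  {H' : Type*} [TopologicalSpace H'] {J : ModelWithCorners ℝ E' H'} [J.Boundaryless]
  {N : Type*} [TopologicalSpace N] [ChartedSpace H' N] [IsManifold J ∞ N]
  {g : MetricField I M} {h : MetricField J N} {φ : M → N} {x₀ : M} {u : E}

/-- The form `g - φ^* h` in the preferred chart at `x₀`. -/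
def verticalForm (g : MetricField I M) (h : MetricField J N) (φ : M → N) (x₀ : M) (u : E) :
    E →L[ℝ] E →L[ℝ] ℝ :=
  coordMetric g x₀ u - coordMetric (pullbackMetric I h φ) x₀ u

theorem verticalForm_apply (g : MetricField I M) (h : MetricField J N) (φ : M → N) (x₀ : M)
    (u v w : E) : verticalForm g h φ x₀ u v w
      = coordMetric g x₀ u v w - coordMetric (pullbackMetric I h φ) x₀ u v w := rfl

/-- The vertical projector of `φ` in the preferred chart at `x₀`. -/
def verticalProj (g : MetricField I M) (h : MetricField J N) (φ : M → N) (x₀ : M) :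
    E → E →L[ℝ] E :=
  proj (coordMetric g x₀) (verticalForm g h φ x₀)

/-- The derivative of `φ` composed with that of the inverse of the preferred chart at `x₀`. -/
def chartTangentMap (I : ModelWithCorners ℝ E H) (J : ModelWithCorners ℝ E' H') (φ : M → N)
    (x₀ : M) (u : E) : E →L[ℝ] E' :=
  (tangentMapAt I J φ ((extChartAt I x₀).symm u)).comp (chartDeriv I x₀ u)

theorem isHorizontal_chartDeriv_iff (hu : u ∈ (extChartAt I x₀).target) (v : E) :
    IsHorizontal J g φ ((extChartAt I x₀).symm u) (chartDeriv I x₀ u v) ↔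
      ∀ w, chartTangentMap I J φ x₀ u w = 0 → coordMetric g x₀ u v w = 0 := by
  constructor
  · intro hv w hw
    rw [coordMetric_eq]
    exact hv _ hw
  · intro hv w hw
    obtain ⟨w', rfl⟩ := (chartDeriv_bijective hu).2 w
    have := hv w' hw
    rw [coordMetric_eq] at this
    exact this

namespace IsRiemannianMap

/-- On horizontal vectors `g` and `φ^*h` agree, and `φ^*h` kills vertical ones, so `g - φ^*h`
retains exactly the vertical component. The vertical projector is thereby an algebraic expression in
smooth forms, and its smoothness needs no constant-rank argument. -/
theorem exists_splitting (hφ : IsRiemannianMap g h φ) (hg : IsSmoothMetric g)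
    (hu : u ∈ (extChartAt I x₀).target) (v : E) :
    ∃ a b, v = a + b ∧
      (∀ w, chartTangentMap I J φ x₀ u w = 0 → coordMetric g x₀ u a w = 0) ∧
      chartTangentMap I J φ x₀ u b = 0 ∧
      ∀ w, verticalForm g h φ x₀ u v w = coordMetric g x₀ u b w := by
  have dec := exists_orthogonal_decomposition (coordMetric g x₀ u) ((hg x₀).pos u hu)
    (chartTangentMap I J φ x₀ u)
  have pb : ∀ v w, coordMetric (pullbackMetric I h φ) x₀ u v w
      = formAt h (φ ((extChartAt I x₀).symm u)) (chartTangentMap I J φ x₀ u v)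
        (chartTangentMap I J φ x₀ u w) := by
    intro v w
    rw [coordMetric_eq]
    rfl
  obtain ⟨a, b, hv, ha, hb⟩ := dec v
  refine ⟨a, b, hv, ha, hb, fun w => ?_⟩
  obtain ⟨a', b', rfl, ha', hb'⟩ := dec w
  have e1 : formAt h (φ ((extChartAt I x₀).symm u)) (chartTangentMap I J φ x₀ u a)
      (chartTangentMap I J φ x₀ u a') = coordMetric g x₀ u a a' := by
    rw [coordMetric_eq]
    exact hφ.isometric _ _ _ ((isHorizontal_chartDeriv_iff hu a).2 ha)
      ((isHorizontal_chartDeriv_iff hu a').2 ha')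
  rw [verticalForm_apply, pb, hv, map_add (chartTangentMap I J φ x₀ u),
    map_add (chartTangentMap I J φ x₀ u), hb, hb', add_zero, add_zero, e1]
  simp only [map_add, add_apply, ha b' hb', (hg x₀).symm u hu b a', ha' b hb]
  ring

theorem verticalProj_splitting (hφ : IsRiemannianMap g h φ) (hg : IsSmoothMetric g)
    (hu : u ∈ (extChartAt I x₀).target) (v : E) :
    (∀ w, chartTangentMap I J φ x₀ u w = 0 →
      coordMetric g x₀ u (v - verticalProj g h φ x₀ u v) w = 0) ∧
      chartTangentMap I J φ x₀ u (verticalProj g h φ x₀ u v) = 0 := by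
  obtain ⟨a, b, hv, ha, hb, hβ⟩ := hφ.exists_splitting hg hu v
  have : verticalProj g h φ x₀ u v = b :=
    (hg x₀).ext hu fun z => by rw [verticalProj, (hg x₀).apply_proj hu, hβ]
  rw [this]
  refine ⟨?_, hb⟩
  rw [hv, add_sub_cancel_right]
  exact ha

theorem verticalProj_eq_self_iff (hφ : IsRiemannianMap g h φ) (hg : IsSmoothMetric g)
    (hu : u ∈ (extChartAt I x₀).target) (v : E) :
    verticalProj g h φ x₀ u v = v ↔ chartTangentMap I J φ x₀ u v = 0 := by
  obtain ⟨h1, h2⟩ := hφ.verticalProj_splitting hg hu v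
  constructor
  · intro hv
    rwa [hv] at h2
  · intro hv
    by_contra hne
    have h3 := (hg x₀).pos u hu (v - verticalProj g h φ x₀ u v) (sub_ne_zero.2 (Ne.symm hne))
    rw [h1 _ (by rw [map_sub, hv, h2, sub_zero])] at h3
    exact lt_irrefl _ h3

theorem verticalProj_idem (hφ : IsRiemannianMap g h φ) (hg : IsSmoothMetric g)
    (hu : u ∈ (extChartAt I x₀).target) (v : E) :
    verticalProj g h φ x₀ u (verticalProj g h φ x₀ u v) = verticalProj g h φ x₀ u v :=
  (hφ.verticalProj_eq_self_iff hg hu _).2 (hφ.verticalProj_splitting hg hu v).2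

theorem verticalProj_eq_zero (hφ : IsRiemannianMap g h φ) (hg : IsSmoothMetric g)
    (hu : u ∈ (extChartAt I x₀).target) {v : E}
    (hv : ∀ w, chartTangentMap I J φ x₀ u w = 0 → coordMetric g x₀ u v w = 0) :
    verticalProj g h φ x₀ u v = 0 := by
  obtain ⟨h1, h2⟩ := hφ.verticalProj_splitting hg hu v
  by_contra hne
  have h3 := (hg x₀).pos u hu _ hne
  have h4 := h1 _ h2
  rw [map_sub, sub_apply, hv _ h2] at h4
  linarith

theorem verticalForm_symm (hg : IsSmoothMetric g)
    (hh : IsSmoothMetric h) (hu : u ∈ (extChartAt I x₀).target) (v w : E) :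
    verticalForm g h φ x₀ u v w = verticalForm g h φ x₀ u w v := by
  rw [verticalForm_apply, verticalForm_apply, (hg x₀).symm u hu,
    coordMetric_eq (pullbackMetric I h φ), coordMetric_eq (pullbackMetric I h φ),
    formAt_pullbackMetric, formAt_pullbackMetric, hh.symm]

theorem contDiffOn_verticalForm (hφ : IsRiemannianMap g h φ) (hg : IsSmoothMetric g)
    (hh : IsSmoothMetric h) :
    ContDiffOn ℝ ∞ (verticalForm g h φ x₀) (extChartAt I x₀).target :=
  (hg x₀).contDiffOn.sub (contDiffOn_coordMetric_pullback hh x₀ hφ.smooth)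

theorem contDiffAt_verticalProj (hφ : IsRiemannianMap g h φ) (hg : IsSmoothMetric g)
    (hh : IsSmoothMetric h) (hu : u ∈ (extChartAt I x₀).target) :
    ContDiffAt ℝ ∞ (verticalProj g h φ x₀) u :=
  (hg x₀).contDiffAt_proj hu ((hφ.contDiffOn_verticalForm hg hh).contDiffAt
    ((isOpen_extChartAt_target x₀).mem_nhds hu))

theorem fderiv_coordMap_eq_zero_iff {y₀ : N} (hφ : IsRiemannianMap g h φ)
    (hu : u ∈ (extChartAt I x₀).target)
    (hy : φ ((extChartAt I x₀).symm u) ∈ (extChartAt J y₀).source) (v : E) :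
    fderiv ℝ (coordMap I J φ x₀ y₀) u v = 0 ↔ chartTangentMap I J φ x₀ u v = 0 := by
  have h1 := chartDeriv_fderiv_coordMap hu hφ.smooth.contMDiffAt hy v
  have h2 := (chartDeriv_bijective (coordMap_mem hy)).1
  constructor
  · intro h0
    rw [h0, map_zero] at h1
    exact h1.symm
  · intro h0
    have h3 : tangentMapAt I J φ ((extChartAt I x₀).symm u) (chartDeriv I x₀ u v) = 0 := h0
    rw [h3] at h1
    exact h2 (h1.trans (map_zero _).symm)

theorem fderiv_verticalProj_vertical (hφ : IsRiemannianMap g h φ) (hg : IsSmoothMetric g)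
    (hh : IsSmoothMetric h) (hu : u ∈ (extChartAt I x₀).target) (a b : E) :
    let P := verticalProj g h φ x₀
    P u (fderiv ℝ P u (P u a) (P u b) - fderiv ℝ P u (P u b) (P u a))
      = fderiv ℝ P u (P u a) (P u b) - fderiv ℝ P u (P u b) (P u a) := by
  have hy : φ ((extChartAt I x₀).symm u)
      ∈ (extChartAt J (φ ((extChartAt I x₀).symm u))).source := mem_extChartAt_source _
  refine fderiv_proj_vertical (contDiffAt_coordMap hu hφ.smooth.contMDiffAt hy)
    (differentiableAt_of_contDiffAt (hφ.contDiffAt_verticalProj hg hh hu)) ?_ ?_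
    (hφ.verticalProj_idem hg hu) a b
  · filter_upwards [eventually_coordMap_source hu hφ.smooth.continuous.continuousAt hy] with t ht v
    rw [hφ.fderiv_coordMap_eq_zero_iff ht.1 ht.2]
    exact (hφ.verticalProj_splitting hg ht.1 v).2
  · intro v hv
    rw [hφ.fderiv_coordMap_eq_zero_iff hu hy] at hv
    exact (hφ.verticalProj_eq_self_iff hg hu v).2 hv

end IsRiemannianMap

end RiemannianMap

/-! ### Clairaut Riemannian maps in charts -/

section Clairaut

variable {E : Type*} [NormedAddCommGroup E] [NormedSpace ℝ E] [FiniteDimensional ℝ E]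

/-- Differentiate the conservation law at `0`. The right side contributes nothing, because geodesics
have constant speed; the left side is `R²` times the claim. -/
theorem IsMetricOn.killing_of_conserved {G β : E → E →L[ℝ] E →L[ℝ] ℝ} {Ω : Set E} {R : E → ℝ}
    {c : ℝ → E} {u v : E} {K : ℝ}
    (hG : IsMetricOn G Ω) (hu : u ∈ Ω) (hβ : DifferentiableAt ℝ β u)
    (hsymm : ∀ v w, β u v w = β u w v) (hR : DifferentiableAt ℝ R u) (hpos : 0 < R u)
    (h0 : c 0 = u) (h1 : deriv c 0 = v) (hc : ContDiffAt ℝ ∞ c 0)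
    (h2 : deriv (deriv c) 0 = -christoffel G univ u v v)
    (hcons : ∀ᶠ t in 𝓝 (0 : ℝ), R (c t) ^ 2 * β (c t) (deriv c t) (deriv c t)
      = K * G (c t) (deriv c t) (deriv c t)) :
    2 * fderiv ℝ (fun t => Real.log (R t)) u v * β u v v + fderiv ℝ β u v v v
      - 2 * β u (christoffel G univ u v v) v = 0 := by
  have hc1 : HasDerivAt c v 0 := h1 ▸ (differentiableAt_of_contDiffAt hc).hasDerivAt
  have hdc : ContDiffAt ℝ ∞ (deriv c) 0 := by
    have : deriv c = fun t => fderiv ℝ c t 1 := by funext t; exact (fderiv_apply_one_eq_deriv).symm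
    rw [this]
    exact (contDiffAt_fderiv hc).clm_apply contDiffAt_const
  have hc2 : HasDerivAt (deriv c) (-christoffel G univ u v v) 0 :=
    h2 ▸ (differentiableAt_of_contDiffAt hdc).hasDerivAt
  subst h0
  -- Used for `B = β` and for `B = G`; the acceleration is eliminated by the geodesic equation.
  have form : ∀ B : E → E →L[ℝ] E →L[ℝ] ℝ, DifferentiableAt ℝ B (c 0) →
      (∀ v w, B (c 0) v w = B (c 0) w v) →
      HasDerivAt (fun t => B (c t) (deriv c t) (deriv c t))
        (fderiv ℝ B (c 0) v v v - 2 * B (c 0) (christoffel G univ (c 0) v v) v) 0 := by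
    intro B hB hs
    have e1 : HasDerivAt (fun t => B (c t)) (fderiv ℝ B (c 0) v) 0 :=
      hB.hasFDerivAt.comp_hasDerivAt 0 hc1
    have e2 := (e1.clm_apply hc2).clm_apply hc2
    rw [h1] at e2
    refine e2.congr_deriv ?_
    simp only [add_apply, map_neg, neg_apply, hs v]
    ring
  have r1 : HasDerivAt (fun t => R (c t)) (fderiv ℝ R (c 0) v) 0 :=
    hR.hasFDerivAt.comp_hasDerivAt 0 hc1
  have r2 := (r1.fun_pow 2).fun_mul (form β hβ hsymm)
  have r3 := (form G (hG.differentiableAt hu) (hG.symm _ hu)).const_mul K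
  have r4 := r3.congr_of_eventuallyEq hcons
  have r5 := r2.unique r4
  rw [hG.fderiv_apply hu, hG.symm _ hu v, h1] at r5
  have r6 : fderiv ℝ (fun t => Real.log (R t)) (c 0) v = (R (c 0))⁻¹ * fderiv ℝ R (c 0) v := by
    rw [fderiv.log hR hpos.ne']; rfl
  rw [r6]
  have hne := hpos.ne'
  field_simp
  have : R (c 0) * (2 * fderiv ℝ R (c 0) v * β (c 0) v v + R (c 0) * (fderiv ℝ β (c 0) v v v)
      - R (c 0) * (2 * β (c 0) (christoffel G univ (c 0) v v) v)) = 0 := by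
    norm_num at r5
    linear_combination r5
  rcases mul_eq_zero.1 this with h | h
  · exact absurd h hne
  · linear_combination h

variable {H : Type*} [TopologicalSpace H] {I : ModelWithCorners ℝ E H} [I.Boundaryless]
  {M : Type*} [TopologicalSpace M] [ChartedSpace H M] [IsManifold I ∞ M]
  {E' : Type*} [NormedAddCommGroup E'] [NormedSpace ℝ E'] [FiniteDimensional ℝ E']
  {H' : Type*} [TopologicalSpace H'] {J : ModelWithCorners ℝ E' H'} [J.Boundaryless]
  {N : Type*} [TopologicalSpace N] [ChartedSpace H' N] [IsManifold J ∞ N]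
  {g : MetricField I M} {h : MetricField J N} {φ : M → N} {x₀ : M} {u : E}

/-- A change of charts is the coordinate expression of the identity map, so this is a pullback by
`id`. -/
theorem coordMetric_change (g : MetricField I M) {y₀ : M} (hu : u ∈ (extChartAt I x₀).target)
    (hy : (extChartAt I x₀).symm u ∈ (extChartAt I y₀).source) (v w : E) :
    coordMetric g x₀ u v w
      = coordMetric g y₀ (coordMap I I id x₀ y₀ u) (fderiv ℝ (coordMap I I id x₀ y₀) u v)
        (fderiv ℝ (coordMap I I id x₀ y₀) u w) := by
  have h : pullbackMetric I g (id : M → M) = g := by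
    funext x
    have e : ∀ v, tangentMapAt I I (id : M → M) x v = v := fun v =>
      congrArg (fun L : E →L[ℝ] E => L v) (mfderiv_id (I := I) (x := x))
    have : ∀ v w, formAt g x (tangentMapAt I I (id : M → M) x v)
        (tangentMapAt I I (id : M → M) x w) = formAt g x v w := fun v w => by rw [e, e]
    exact ContinuousLinearMap.ext fun v => ContinuousLinearMap.ext fun w => this v w
  have := coordMetric_pullback (φ := (id : M → M)) g hu contMDiffAt_id hy v w
  rwa [h] at this

theorem bijective_fderiv_coordMap_id {y₀ : M} (hu : u ∈ (extChartAt I x₀).target)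
    (hy : (extChartAt I x₀).symm u ∈ (extChartAt I y₀).source) :
    Function.Bijective (fderiv ℝ (coordMap I I id x₀ y₀) u) := by
  have e : ∀ v, chartDeriv I y₀ (coordMap I I id x₀ y₀ u) (fderiv ℝ (coordMap I I id x₀ y₀) u v)
      = chartDeriv I x₀ u v := fun v =>
    (chartDeriv_fderiv_coordMap (φ := (id : M → M)) hu contMDiffAt_id hy v).trans
      (congrArg (fun L : E →L[ℝ] E => L _)
        (mfderiv_id (I := I) (x := (extChartAt I x₀).symm u)))
  have h1 := chartDeriv_bijective (I := I) (coordMap_mem (φ := (id : M → M)) hy)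
  have h2 := chartDeriv_bijective hu
  constructor
  · intro v w hvw
    apply h2.1
    rw [← e, ← e, hvw]
  · intro z
    obtain ⟨v, hv⟩ := h2.2 (chartDeriv I y₀ (coordMap I I id x₀ y₀ u) z)
    exact ⟨v, h1.1 ((e v).trans hv)⟩

/-- The solution lives in the single chart at `x₀`, whereas `IsGeodesicOn` asks for the equation in
the preferred chart at each of its points. The transition map is an isometry, and the transformation
law of the Christoffel symbols carries the equation over. -/
theorem isGeodesicOn_of_coord (hg : IsSmoothMetric g) {c : ℝ → E} {a b : ℝ}
    (hc : ContDiffOn ℝ ∞ c (Ioo a b))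
    (h : ∀ t ∈ Ioo a b, c t ∈ (extChartAt I x₀).target ∧
      deriv (deriv c) t = -christoffel (coordMetric g x₀) univ (c t) (deriv c t) (deriv c t)) :
    IsGeodesicOn g (fun t => (extChartAt I x₀).symm (c t)) (Ioo a b) := by
  refine ⟨?_, fun t ht => ?_⟩
  · exact (contMDiffOn_extChartAt_symm x₀).comp hc.contMDiffOn fun t ht => (h t ht).1
  · obtain ⟨hct, hode⟩ := h t ht
    set y₀ := (extChartAt I x₀).symm (c t) with hy₀
    set τ := coordMap I I id x₀ y₀ with hτ
    have hy : (extChartAt I x₀).symm (c t) ∈ (extChartAt I y₀).source := mem_extChartAt_source y₀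
    have hnhds : Ioo a b ∈ 𝓝 t := isOpen_Ioo.mem_nhds ht
    have hcd : ∀ s ∈ Ioo a b, ContDiffAt ℝ ∞ c s := fun s hs =>
      hc.contDiffAt (isOpen_Ioo.mem_nhds hs)
    have hsrc := eventually_coordMap_source (φ := (id : M → M)) hct continuousAt_id hy
    have hτs : ContDiffAt ℝ ∞ τ (c t) := contDiffAt_coordMap hct contMDiffAt_id hy
    have hev : ∀ᶠ s in 𝓝 t, deriv (fun s => τ (c s)) s = fderiv ℝ τ (c s) (deriv c s) := by
      filter_upwards [hnhds, (hcd t ht).continuousAt.eventually hsrc] with s hs hs2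
      have h1 : HasDerivAt c (deriv c s) s := (differentiableAt_of_contDiffAt (hcd s hs)).hasDerivAt
      have h2 : DifferentiableAt ℝ τ (c s) :=
        differentiableAt_of_contDiffAt (contDiffAt_coordMap hs2.1 contMDiffAt_id hs2.2)
      exact (h2.hasFDerivAt.comp_hasDerivAt s h1).deriv
    have hdc : DifferentiableAt ℝ (deriv c) t := by
      have : deriv c = fun t => fderiv ℝ c t 1 := by
        funext t; exact (fderiv_apply_one_eq_deriv).symm
      rw [this]
      exact (differentiableAt_of_contDiffAt (contDiffAt_fderiv (hcd t ht))).clm_apply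
        (differentiableAt_const _)
    have hc1 : HasDerivAt c (deriv c t) t :=
      (differentiableAt_of_contDiffAt (hcd t ht)).hasDerivAt
    have hD := differentiableAt_of_contDiffAt (contDiffAt_fderiv hτs)
    have h2 : HasDerivAt (fun s => fderiv ℝ τ (c s) (deriv c s))
        (fderiv ℝ (fderiv ℝ τ) (c t) (deriv c t) (deriv c t)
          + fderiv ℝ τ (c t) (deriv (deriv c) t)) t :=
      (hD.hasFDerivAt.comp_hasDerivAt t hc1).clm_apply hdc.hasDerivAt
    have tr := (hg y₀).christoffel_transform (hg x₀) hct (coordMap_mem hy) hτs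
      (bijective_fderiv_coordMap_id hct hy).2
      (hsrc.mono fun s hs v w => coordMetric_change g hs.1 hs.2 v w) (deriv c t) (deriv c t)
    have e : (fun s => extChartAt I y₀ ((extChartAt I x₀).symm (c s))) = fun s => τ (c s) := rfl
    have hev' : deriv (fun s => τ (c s)) =ᶠ[𝓝 t] fun s => fderiv ℝ τ (c s) (deriv c s) := hev
    simp only [I.range_eq_univ]
    rw [e, hev'.deriv_eq, h2.deriv, hev.self_of_nhds, hode]
    rw [map_neg]
    have tr' : fderiv ℝ (fderiv ℝ τ) (c t) (deriv c t) (deriv c t)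
        + christoffel (coordMetric g y₀) univ (τ (c t)) (fderiv ℝ τ (c t) (deriv c t))
          (fderiv ℝ τ (c t) (deriv c t))
        = fderiv ℝ τ (c t)
          (christoffel (coordMetric g x₀) univ (c t) (deriv c t) (deriv c t)) := tr
    have hz : ∀ x y z : E, x + y = z → x + -z + y = 0 := by
      rintro x y _ rfl
      abel
    exact hz _ _ _ tr'

theorem velocity_comp_extChartAt_symm {c : ℝ → E} {t : ℝ} (hc : DifferentiableAt ℝ c t)
    (hct : c t ∈ (extChartAt I x₀).target) :
    velocity I (fun s => (extChartAt I x₀).symm (c s)) t = chartDeriv I x₀ (c t) (deriv c t) := by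
  have h := mfderiv_comp_apply t (mdifferentiableAt_extChartAt_symm hct) hc.mdifferentiableAt
    (1 : ℝ)
  rw [mfderiv_eq_fderiv] at h
  rw [← fderiv_apply_one_eq_deriv]
  exact h

/-- This turns Clairaut's relation into a statement on quadratic forms: the squared length of the
vertical component is both `sin² θ · g(w, w)` and `β(w, w)`. -/
theorem IsRiemannianMap.exists_angle (hφ : IsRiemannianMap g h φ) (hg : IsSmoothMetric g)
    (hu : u ∈ (extChartAt I x₀).target) {w : E} (hw : w ≠ 0) :
    ∃ θ, MakesAngle J g φ ((extChartAt I x₀).symm u) (chartDeriv I x₀ u w) θ ∧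
      Real.sin θ ^ 2 * coordMetric g x₀ u w w = verticalForm g h φ x₀ u w w := by
  obtain ⟨a, b, rfl, ha, hb, hβ⟩ := hφ.exists_splitting hg hu w
  set G := coordMetric g x₀ u with hGdef
  have nn : ∀ v, 0 ≤ G v v := by
    intro v
    by_cases h0 : v = 0
    · simp [h0]
    · exact ((hg x₀).pos u hu v h0).le
  have hpos : 0 < G (a + b) (a + b) := (hg x₀).pos u hu _ hw
  have hab : G a b = 0 := ha b hb
  have hba : G b a = 0 := by rw [(hg x₀).symm u hu]; exact hab
  have hsum : G (a + b) (a + b) = G a a + G b b := by simp [hab, hba]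
  -- The cosine of the angle; it lies in `[0, 1]` by orthogonality of `a` and `b`.
  set q := √(G a a) / √(G (a + b) (a + b)) with hq
  have hsq : 0 < √(G (a + b) (a + b)) := Real.sqrt_pos.2 hpos
  have hq0 : 0 ≤ q := div_nonneg (Real.sqrt_nonneg _) (Real.sqrt_nonneg _)
  have hq1 : q ≤ 1 := (div_le_one hsq).2 (Real.sqrt_le_sqrt (by rw [hsum]; linarith [nn b]))
  refine ⟨Real.arccos q, ⟨?_, ⟨Real.arccos_nonneg _, Real.arccos_le_pi_div_two.2 hq0⟩,
    chartDeriv I x₀ u a, chartDeriv I x₀ u b, map_add _ _ _,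
    (isHorizontal_chartDeriv_iff hu a).2 ha, hb, ?_⟩, ?_⟩
  · intro h0
    exact hw ((chartDeriv_bijective hu).1 (h0.trans (map_zero (chartDeriv I x₀ u)).symm))
  · have e : ∀ v, formAt g ((extChartAt I x₀).symm u) (chartDeriv I x₀ u v) (chartDeriv I x₀ u v)
        = G v v := fun v => (coordMetric_eq g x₀ u v v).symm
    have : √(G a a) = √(G (a + b) (a + b)) * Real.cos (Real.arccos q) := by
      rw [Real.cos_arccos (by linarith) hq1, hq]
      field_simp
    rw [← e, ← e] at this
    exact this
  · rw [hβ, Real.sin_sq, Real.cos_arccos (by linarith) hq1, hq, div_pow, Real.sq_sqrt (nn a),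
      Real.sq_sqrt hpos.le, sub_mul, div_mul_cancel₀ _ hpos.ne', hsum]
    simp [hba]

/-- Every nonzero vector is the initial velocity of a geodesic, along which `r² β(c', c') = r² sin²
θ · g(c', c')` with `r sin θ` constant. So `killing_of_conserved` applies, with the speed left
arbitrary. -/
theorem IsRiemannianMap.killing (hφ : IsRiemannianMap g h φ) (hg : IsSmoothMetric g)
    (hh : IsSmoothMetric h) {r : M → ℝ} (hr : ContMDiff I 𝓘(ℝ, ℝ) ∞ r) (hrpos : ∀ x, 0 < r x)
    (hcl : ∀ (a b : ℝ) (γ : ℝ → M), IsGeodesicOn g γ (Ioo a b) →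
      ∀ t₁ ∈ Ioo a b, ∀ t₂ ∈ Ioo a b, ∀ θ₁ θ₂ : ℝ,
        MakesAngle J g φ (γ t₁) (velocity I γ t₁) θ₁ →
        MakesAngle J g φ (γ t₂) (velocity I γ t₂) θ₂ →
        r (γ t₁) * Real.sin θ₁ = r (γ t₂) * Real.sin θ₂)
    (hu : u ∈ (extChartAt I x₀).target) (v : E) :
    2 * fderiv ℝ (fun t => Real.log (r ((extChartAt I x₀).symm t))) u v
        * verticalForm g h φ x₀ u v v + fderiv ℝ (verticalForm g h φ x₀) u v v v
      - 2 * verticalForm g h φ x₀ u (christoffel (coordMetric g x₀) univ u v v) v = 0 := by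
  by_cases hv : v = 0
  · simp [hv]
  obtain ⟨c, ε, hε, h0, h1, hc, hode⟩ := (hg x₀).exists_geodesic hu v
  have h0mem : (0 : ℝ) ∈ Ioo (-ε) ε := ⟨by linarith, hε⟩
  have hc0 : ContDiffAt ℝ ∞ c 0 := hc.contDiffAt (isOpen_Ioo.mem_nhds h0mem)
  have hdc : ContinuousAt (deriv c) 0 := by
    have : deriv c = fun t => fderiv ℝ c t 1 := by funext t; exact (fderiv_apply_one_eq_deriv).symm
    rw [this]
    exact ((contDiffAt_fderiv hc0).clm_apply contDiffAt_const).continuousAt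
  have hgeo := isGeodesicOn_of_coord hg hc hode
  have hangle : ∀ t ∈ Ioo (-ε) ε, deriv c t ≠ 0 → ∃ θ,
      MakesAngle J g φ ((extChartAt I x₀).symm (c t))
        (velocity I (fun s => (extChartAt I x₀).symm (c s)) t) θ ∧
      Real.sin θ ^ 2 * coordMetric g x₀ (c t) (deriv c t) (deriv c t)
        = verticalForm g h φ x₀ (c t) (deriv c t) (deriv c t) := by
    intro t ht hne
    rw [velocity_comp_extChartAt_symm (differentiableAt_of_contDiffAt
      (hc.contDiffAt (isOpen_Ioo.mem_nhds ht))) (hode t ht).1]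
    exact hφ.exists_angle hg (hode t ht).1 hne
  obtain ⟨θ₀, hθ₀, -⟩ := hangle 0 h0mem (by rwa [h1])
  refine (hg x₀).killing_of_conserved (K := (r ((extChartAt I x₀).symm (c 0)) * Real.sin θ₀) ^ 2)
    (R := fun t => r ((extChartAt I x₀).symm t)) hu
    (((hφ.contDiffOn_verticalForm hg hh).contDiffAt
      ((isOpen_extChartAt_target x₀).mem_nhds hu)).differentiableAt (by simp))
    (IsRiemannianMap.verticalForm_symm hg hh hu)
    (((contDiffOn_comp_extChartAt_symm hr x₀).contDiffAt
      ((isOpen_extChartAt_target x₀).mem_nhds hu)).differentiableAt (by simp)) (hrpos _) h0 h1 hc0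
    (by rw [(hode 0 h0mem).2, h0, h1]) ?_
  -- An angle exists only for nonzero vectors; the velocity stays nonzero near `0` by continuity.
  filter_upwards [isOpen_Ioo.mem_nhds h0mem, hdc.eventually_ne (by rwa [h1])] with t ht hne
  obtain ⟨θ, hθ, hsin⟩ := hangle t ht hne
  rw [← hsin, hcl _ _ _ hgeo 0 h0mem t ht θ₀ θ hθ₀ hθ]
  ring

end Clairaut

/-! ### Integrability of the horizontal distribution in charts -/

section Horizontal

variable {E : Type*} [NormedAddCommGroup E] [NormedSpace ℝ E] [FiniteDimensional ℝ E]
  {H : Type*} [TopologicalSpace H] {I : ModelWithCorners ℝ E H} [I.Boundaryless]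
  {M : Type*} [TopologicalSpace M] [ChartedSpace H M] [IsManifold I ∞ M]
  {E' : Type*} [NormedAddCommGroup E'] [NormedSpace ℝ E'] [FiniteDimensional ℝ E']
  {H' : Type*} [TopologicalSpace H'] {J : ModelWithCorners ℝ E' H'} [J.Boundaryless]
  {N : Type*} [TopologicalSpace N] [ChartedSpace H' N] [IsManifold J ∞ N]
  {g : MetricField I M} {h : MetricField J N} {φ : M → N} {x₀ : M} {u : E}

/-- The vector field on `M` with the expression `A` in the preferred chart at `x₀`. -/
def chartField (I : ModelWithCorners ℝ E H) (x₀ : M) (A : E → E) (x : M) : TangentSpace I x :=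
  VectorField.mpullback I 𝓘(ℝ, E) (extChartAt I x₀) A x

theorem inverse_mfderiv_extChartAt (hu : u ∈ (extChartAt I x₀).target) :
    (mfderiv I 𝓘(ℝ, E) (extChartAt I x₀) ((extChartAt I x₀).symm u) : E →L[ℝ] E).inverse
      = chartDeriv I x₀ u := by
  have h1 := mfderiv_extChartAt_comp_mfderivWithin_extChartAt_symm (I := I) hu
  have h2 := mfderivWithin_extChartAt_symm_comp_mfderiv_extChartAt (I := I) hu
  rw [I.range_eq_univ, mfderivWithin_univ] at h1 h2
  exact ContinuousLinearMap.inverse_eq h1 h2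

theorem chartField_apply (A : E → E) (hu : u ∈ (extChartAt I x₀).target) :
    chartField I x₀ A ((extChartAt I x₀).symm u) = chartDeriv I x₀ u (A u) := by
  have h1 : chartField I x₀ A ((extChartAt I x₀).symm u)
      = (mfderiv I 𝓘(ℝ, E) (extChartAt I x₀) ((extChartAt I x₀).symm u) : E →L[ℝ] E).inverse
        (A (extChartAt I x₀ ((extChartAt I x₀).symm u))) := rfl
  rw [h1, inverse_mfderiv_extChartAt hu, (extChartAt I x₀).right_inv hu]
  rfl

theorem isSmoothField_chartField {A : E → E} (hA : ContDiffOn ℝ ∞ A (extChartAt I x₀).target) :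
    IsSmoothField (chartField I x₀ A) (extChartAt I x₀).source := by
  intro x hx
  have hA' : ContDiffAt ℝ ∞ A (extChartAt I x₀ x) :=
    hA.contDiffAt ((isOpen_extChartAt_target x₀).mem_nhds ((extChartAt I x₀).map_source hx))
  exact (ContMDiffAt.mpullback_vectorField_preimage (n := ∞)
    (contMDiffAt_vectorSpace_iff_contDiffAt.2 hA')
    (contMDiffAt_extChartAt' (by rwa [← extChartAt_source I]))
    (isInvertible_mfderiv_extChartAt hx) (by simp)).contMDiffWithinAt

theorem mlieBracket_chartField {A B : E → E} (hu : u ∈ (extChartAt I x₀).target)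
    (hA : ContDiffAt ℝ ∞ A u) (hB : ContDiffAt ℝ ∞ B u) :
    VectorField.mlieBracket I (chartField I x₀ A) (chartField I x₀ B) ((extChartAt I x₀).symm u)
      = chartDeriv I x₀ u (fderiv ℝ B u (A u) - fderiv ℝ A u (B u)) := by
  have hs : (extChartAt I x₀).symm u ∈ (extChartAt I x₀).source := (extChartAt I x₀).map_target hu
  have hr := (extChartAt I x₀).right_inv hu
  have : IsManifold I (minSmoothness ℝ 3) M := by
    rw [minSmoothness_of_isRCLikeNormedField]
    exact IsManifold.of_le (n := ∞) (WithTop.coe_le_coe.2 (le_top : (3 : ℕ∞) ≤ ⊤))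
  have : IsManifold I (minSmoothness ℝ 2) M := by
    rw [minSmoothness_of_isRCLikeNormedField]
    exact IsManifold.of_le (n := ∞) (WithTop.coe_le_coe.2 (le_top : (2 : ℕ∞) ≤ ⊤))
  have hmd : ∀ {C : E → E}, ContDiffAt ℝ ∞ C u →
      MDifferentiableAt 𝓘(ℝ, E) 𝓘(ℝ, E).tangent
        (fun t : E => (⟨t, C t⟩ : TangentBundle 𝓘(ℝ, E) E))
        (extChartAt I x₀ ((extChartAt I x₀).symm u)) := by
    intro C hC
    rw [hr]
    exact (contMDiffAt_vectorSpace_iff_contDiffAt.2 hC).mdifferentiableAt (by simp)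
  have h1 := VectorField.mpullback_mlieBracket (I := I) (I' := 𝓘(ℝ, E)) (n := ∞)
    (f := extChartAt I x₀) (hmd hA) (hmd hB)
    (contMDiffAt_extChartAt' (by rwa [← extChartAt_source I]))
    (by rw [minSmoothness_of_isRCLikeNormedField]
        exact WithTop.coe_le_coe.2 (le_top : (2 : ℕ∞) ≤ ⊤))
  have h2 := chartField_apply (I := I) (x₀ := x₀) (VectorField.mlieBracket 𝓘(ℝ, E) A B) hu
  have h3 : VectorField.mlieBracket 𝓘(ℝ, E) A B = VectorField.lieBracket ℝ A B :=
    (VectorField.mlieBracketWithin_eq_lieBracketWithin (V := A) (W := B) (s := univ)).trans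
      VectorField.lieBracketWithin_univ
  rw [h3] at h2
  refine Eq.trans ?_ h2
  rw [← h3]
  exact h1.symm

/-- The hypothesis speaks of brackets of fields on `M`. It is tested on the horizontal fields `t ↦ c
- P t c` of the chart, whose bracket is the antisymmetrized derivative of `P` up to sign. -/
theorem IsRiemannianMap.fderiv_verticalProj_horizontal (hφ : IsRiemannianMap g h φ)
    (hg : IsSmoothMetric g) (hh : IsSmoothMetric h) (hint : HorizontalIntegrable J g φ)
    (hu : u ∈ (extChartAt I x₀).target) (a b : E) :
    let P := verticalProj g h φ x₀
    P u (fderiv ℝ P u (a - P u a) (b - P u b) - fderiv ℝ P u (b - P u b) (a - P u a)) = 0 := by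
  intro P
  have hPs : ContDiffOn ℝ ∞ P (extChartAt I x₀).target := fun t ht =>
    (hφ.contDiffAt_verticalProj hg hh ht).contDiffWithinAt
  have hPd := differentiableAt_of_contDiffAt (hφ.contDiffAt_verticalProj hg hh hu)
  let fld : E → E → E := fun c t => c - P t c
  have hfld : ∀ c, ContDiffOn ℝ ∞ (fld c) (extChartAt I x₀).target := fun c =>
    contDiffOn_const.sub (hPs.clm_apply contDiffOn_const)
  have hhor : ∀ c, ∀ x ∈ (extChartAt I x₀).source,
      IsHorizontal J g φ x (chartField I x₀ (fld c) x) := by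
    intro c x hx
    have hx' := (extChartAt I x₀).map_source hx
    have := (isHorizontal_chartDeriv_iff (J := J) (g := g) (φ := φ) hx' (fld c _)).2
      (hφ.verticalProj_splitting hg hx' c).1
    rwa [← chartField_apply _ hx', (extChartAt I x₀).left_inv hx] at this
  have hD : ∀ c d, fderiv ℝ (fld c) u d = -fderiv ℝ P u d c := by
    intro c d
    have : fderiv ℝ (fld c) u = fderiv ℝ (fun t => c - P t c) u := rfl
    rw [this, fderiv_const_sub, neg_apply, fderiv_apply_const hPd]
  -- The constants are taken already horizontal at `u`, so that the test fields take these values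
  -- there (`hself`).
  have hbr := hint (extChartAt I x₀).source (isOpen_extChartAt_source x₀)
    (chartField I x₀ (fld (a - P u a))) (chartField I x₀ (fld (b - P u b)))
    (isSmoothField_chartField (hfld _)) (isSmoothField_chartField (hfld _)) (hhor _) (hhor _)
    ((extChartAt I x₀).symm u) ((extChartAt I x₀).map_target hu)
  have hn := (isOpen_extChartAt_target (I := I) x₀).mem_nhds hu
  rw [mlieBracket_chartField hu ((hfld _).contDiffAt hn) ((hfld _).contDiffAt hn),
    isHorizontal_chartDeriv_iff hu] at hbr
  have h0 := hφ.verticalProj_eq_zero hg hu hbr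
  have hself : ∀ c, fld (c - P u c) u = c - P u c := by
    intro c
    have : P u (P u c) = P u c := hφ.verticalProj_idem hg hu c
    simp [fld, this]
  rw [hself, hself, hD, hD] at h0
  have h1 : fderiv ℝ P u (a - P u a) (b - P u b) - fderiv ℝ P u (b - P u b) (a - P u a)
      = -(-fderiv ℝ P u (a - P u a) (b - P u b) - -fderiv ℝ P u (b - P u b) (a - P u a)) := by
    abel
  rw [h1, map_neg, neg_eq_zero]
  exact h0

/-- In charts, a Clairaut Riemannian map with integrable horizontal distribution splits. -/
theorem IsRiemannianMap.isSplittingOn (hφ : IsRiemannianMap g h φ) (hg : IsSmoothMetric g)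
    (hh : IsSmoothMetric h) {r : M → ℝ} (hr : ContMDiff I 𝓘(ℝ, ℝ) ∞ r) (hrpos : ∀ x, 0 < r x)
    (hcl : ∀ (a b : ℝ) (γ : ℝ → M), IsGeodesicOn g γ (Ioo a b) →
      ∀ t₁ ∈ Ioo a b, ∀ t₂ ∈ Ioo a b, ∀ θ₁ θ₂ : ℝ,
        MakesAngle J g φ (γ t₁) (velocity I γ t₁) θ₁ →
        MakesAngle J g φ (γ t₂) (velocity I γ t₂) θ₂ →
        r (γ t₁) * Real.sin θ₁ = r (γ t₂) * Real.sin θ₂)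
    (hint : HorizontalIntegrable J g φ) (x₀ : M) :
    IsSplittingOn (coordMetric g x₀) (verticalForm g h φ x₀)
      (fun t => Real.log (r ((extChartAt I x₀).symm t))) (extChartAt I x₀).target :=
  IsSplittingOn.of_killing (hg x₀) (hφ.contDiffOn_verticalForm hg hh)
    ((contDiffOn_comp_extChartAt_symm hr x₀).log fun _ _ => (hrpos _).ne')
    (fun _ hu => IsRiemannianMap.verticalForm_symm hg hh hu)
    (fun _ hu => hφ.verticalProj_idem hg hu)
    (fun _ hu => hφ.killing hg hh hr hrpos hcl hu)
    (fun _ hu => hφ.fderiv_verticalProj_vertical hg hh hu)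
    (fun _ hu => hφ.fderiv_verticalProj_horizontal hg hh hint hu)

end Horizontal

/-! ### Clairaut Riemannian warped product maps in charts -/

section WarpedMap

variable {E₁ : Type*} [NormedAddCommGroup E₁] [NormedSpace ℝ E₁] [FiniteDimensional ℝ E₁]
  {H₁ : Type*} [TopologicalSpace H₁] {I₁ : ModelWithCorners ℝ E₁ H₁} [I₁.Boundaryless]
  {M₁ : Type*} [TopologicalSpace M₁] [ChartedSpace H₁ M₁] [IsManifold I₁ ∞ M₁]
  {E₂ : Type*} [NormedAddCommGroup E₂] [NormedSpace ℝ E₂] [FiniteDimensional ℝ E₂]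
  {H₂ : Type*} [TopologicalSpace H₂] {I₂ : ModelWithCorners ℝ E₂ H₂} [I₂.Boundaryless]
  {M₂ : Type*} [TopologicalSpace M₂] [ChartedSpace H₂ M₂] [IsManifold I₂ ∞ M₂]
  {E₃ : Type*} [NormedAddCommGroup E₃] [NormedSpace ℝ E₃] [FiniteDimensional ℝ E₃]
  {H₃ : Type*} [TopologicalSpace H₃] {J₁ : ModelWithCorners ℝ E₃ H₃} [J₁.Boundaryless]
  {N₁ : Type*} [TopologicalSpace N₁] [ChartedSpace H₃ N₁] [IsManifold J₁ ∞ N₁]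
  {E₄ : Type*} [NormedAddCommGroup E₄] [NormedSpace ℝ E₄] [FiniteDimensional ℝ E₄]
  {H₄ : Type*} [TopologicalSpace H₄] {J₂ : ModelWithCorners ℝ E₄ H₄} [J₂.Boundaryless]
  {N₂ : Type*} [TopologicalSpace N₂] [ChartedSpace H₄ N₂] [IsManifold J₂ ∞ N₂]
  {g₁ : MetricField I₁ M₁} {g₂ : MetricField I₂ M₂} {h₁ : MetricField J₁ N₁}
  {h₂ : MetricField J₂ N₂} {f : M₁ → ℝ} {ρ : N₁ → ℝ} {φ₁ : M₁ → N₁} {φ₂ : M₂ → N₂}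

namespace IsClairautWarpedProductMap

/-- As `φ₂` has positive rank, some nonzero `a` is horizontal for `φ₂`, and then `(0, a)` is
horizontal for the product. Both `φ₂` and the product being isometric there, `ρ(φ₁ x)² |a|² = f(x)²
|a|²`. The point `y` only serves to supply `a`. -/
theorem comp_eq (hφ : IsClairautWarpedProductMap g₁ g₂ f h₁ h₂ ρ φ₁ φ₂)
    (hg₂ : IsSmoothMetric g₂) (hf : ∀ x, 0 < f x) (hρ : ∀ x, 0 < ρ x) (y : M₂) (x : M₁) :
    ρ (φ₁ x) = f x := by
  have hd₁ : MDifferentiable I₁ J₁ φ₁ := hφ.left.smooth.mdifferentiable (by simp)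
  have hd₂ : MDifferentiable I₂ J₂ φ₂ := hφ.right.smooth.mdifferentiable (by simp)
  obtain ⟨v, hv⟩ : ∃ v, tangentMapAt I₂ J₂ φ₂ y v ≠ 0 := by
    by_contra! hcon
    have h0 := hφ.right.rank_pos y
    have : (mfderiv I₂ J₂ φ₂ y).toLinearMap = 0 := LinearMap.ext hcon
    rw [this, LinearMap.range_zero, finrank_bot] at h0
    exact lt_irrefl _ h0
  obtain ⟨a, b, rfl, ha, hb⟩ := exists_orthogonal_decomposition (formAt g₂ y) (hg₂.pos y)
    (tangentMapAt I₂ J₂ φ₂ y) v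
  have ha0 : a ≠ 0 := by
    rintro rfl
    simp [hb] at hv
  have e₂ : formAt h₂ (φ₂ y) (tangentMapAt I₂ J₂ φ₂ y a) (tangentMapAt I₂ J₂ φ₂ y a)
      = formAt g₂ y a a := hφ.right.isometric y a a ha ha
  have hz : IsHorizontal (J₁.prod J₂) (warpedMetric g₁ g₂ f) (Prod.map φ₁ φ₂) (x, y)
      ((0, a) : E₁ × E₂) := by
    have h : ∀ w : E₁ × E₂,
        tangentMapAt (I₁.prod I₂) (J₁.prod J₂) (Prod.map φ₁ φ₂) (x, y) w = 0 →
        formAt (warpedMetric g₁ g₂ f) (x, y) (0, a) w = 0 := by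
      intro w hw
      rw [tangentMapAt_prodMap (hd₁ _) (hd₂ _)] at hw
      rw [formAt_warpedMetric, ha _ (congrArg Prod.snd hw)]
      simp
    exact h
  have e₃ : formAt (warpedMetric h₁ h₂ ρ) (φ₁ x, φ₂ y)
      (tangentMapAt (I₁.prod I₂) (J₁.prod J₂) (Prod.map φ₁ φ₂) (x, y) (0, a))
      (tangentMapAt (I₁.prod I₂) (J₁.prod J₂) (Prod.map φ₁ φ₂) (x, y) (0, a))
      = formAt (warpedMetric g₁ g₂ f) (x, y) (0, a) (0, a) :=
    hφ.clairaut.1.isometric (x, y) (0, a) (0, a) hz hz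
  rw [tangentMapAt_prodMap (hd₁ _) (hd₂ _), formAt_warpedMetric, formAt_warpedMetric] at e₃
  simp only [map_zero, zero_add, e₂] at e₃
  have h4 : ρ (φ₁ x) ^ 2 = f x ^ 2 := mul_right_cancel₀ (hg₂.pos y a ha0).ne' e₃
  exact (pow_left_inj₀ (hρ _).le (hf _).le two_ne_zero).1 h4

theorem verticalForm_eq (hφ : IsClairautWarpedProductMap g₁ g₂ f h₁ h₂ ρ φ₁ φ₂)
    (hρ : ∀ x, ρ (φ₁ x) = f x) (p : M₁ × M₂) :
    EqOn (verticalForm (warpedMetric g₁ g₂ f) (warpedMetric h₁ h₂ ρ) (Prod.map φ₁ φ₂) p)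
      (warpForm (verticalForm g₁ h₁ φ₁ p.1) (verticalForm g₂ h₂ φ₂ p.2)
        (fun t => f ((extChartAt I₁ p.1).symm t)))
      ((extChartAt I₁ p.1).target ×ˢ (extChartAt I₂ p.2).target) := by
  intro u hu
  refine ContinuousLinearMap.ext fun v => ContinuousLinearMap.ext fun w => ?_
  rw [verticalForm_apply, pullbackMetric_prodMap hρ (hφ.left.smooth.mdifferentiable (by simp))
    (hφ.right.smooth.mdifferentiable (by simp)), coordMetric_warpedMetric _ _ _ _ hu,
    coordMetric_warpedMetric _ _ _ _ hu, warpForm_apply, warpForm_apply, warpForm_apply,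
    verticalForm_apply, verticalForm_apply]
  ring

theorem isSplittingOn_warpForm (hφ : IsClairautWarpedProductMap g₁ g₂ f h₁ h₂ ρ φ₁ φ₂)
    (hg₁ : IsSmoothMetric g₁) (hg₂ : IsSmoothMetric g₂) (hh₁ : IsSmoothMetric h₁)
    (hh₂ : IsSmoothMetric h₂) (hf : ContMDiff I₁ 𝓘(ℝ, ℝ) ∞ f) (hfpos : ∀ x, 0 < f x)
    (hρ : ContMDiff J₁ 𝓘(ℝ, ℝ) ∞ ρ) (hρpos : ∀ x, 0 < ρ x) (hc : ∀ x, ρ (φ₁ x) = f x)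
    (hint : HorizontalIntegrable (J₁.prod J₂) (warpedMetric g₁ g₂ f) (Prod.map φ₁ φ₂)) :
    ∃ r : M₁ × M₂ → ℝ, ContMDiff (I₁.prod I₂) 𝓘(ℝ, ℝ) ∞ r ∧ (∀ p, 0 < r p) ∧
      ∀ p : M₁ × M₂, IsSplittingOn
        (warpForm (coordMetric g₁ p.1) (coordMetric g₂ p.2)
          (fun t => f ((extChartAt I₁ p.1).symm t)))
        (warpForm (verticalForm g₁ h₁ φ₁ p.1) (verticalForm g₂ h₂ φ₂ p.2)
          (fun t => f ((extChartAt I₁ p.1).symm t)))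
        (fun t => Real.log (r ((extChartAt I₁ p.1).symm t.1, (extChartAt I₂ p.2).symm t.2)))
        ((extChartAt I₁ p.1).target ×ˢ (extChartAt I₂ p.2).target) := by
  obtain ⟨hR, r, hr, hrpos, hcl⟩ := hφ.clairaut
  refine ⟨r, hr, hrpos, fun p => ?_⟩
  have h := hR.isSplittingOn (hg₁.warpedMetric hg₂ hf hfpos) (hh₁.warpedMetric hh₂ hρ hρpos) hr
    hrpos hcl hint p
  rw [extChartAt_prod_target] at h
  simp only [extChartAt_prod_symm_apply] at h
  exact h.congr (coordMetric_warpedMetric g₁ g₂ f p).symm (hφ.verticalForm_eq hc p).symm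

/-- In charts, the factors of a Clairaut Riemannian warped product map with integrable horizontal
distribution split. -/
theorem isSplittingOn (hφ : IsClairautWarpedProductMap g₁ g₂ f h₁ h₂ ρ φ₁ φ₂)
    (hg₁ : IsSmoothMetric g₁) (hg₂ : IsSmoothMetric g₂) (hh₁ : IsSmoothMetric h₁)
    (hh₂ : IsSmoothMetric h₂) (hf : ContMDiff I₁ 𝓘(ℝ, ℝ) ∞ f) (hfpos : ∀ x, 0 < f x)
    (hρ : ContMDiff J₁ 𝓘(ℝ, ℝ) ∞ ρ) (hρpos : ∀ x, 0 < ρ x) (hc : ∀ x, ρ (φ₁ x) = f x)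
    (hint : HorizontalIntegrable (J₁.prod J₂) (warpedMetric g₁ g₂ f) (Prod.map φ₁ φ₂)) :
    ∃ ℓ : M₁ × M₂ → ℝ, ContMDiff (I₁.prod I₂) 𝓘(ℝ, ℝ) ∞ ℓ ∧ ∀ (x : M₁) (y : M₂),
      IsSplittingOn (coordMetric g₁ x) (verticalForm g₁ h₁ φ₁ x)
        (fun t => ℓ ((extChartAt I₁ x).symm t, y)) (extChartAt I₁ x).target ∧
      IsSplittingOn (coordMetric g₂ y) (verticalForm g₂ h₂ φ₂ y)
        (fun t => ℓ (x, (extChartAt I₂ y).symm t)) (extChartAt I₂ y).target := by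
  obtain ⟨r, hr, hrpos, h⟩ :=
    hφ.isSplittingOn_warpForm hg₁ hg₂ hh₁ hh₂ hf hfpos hρ hρpos hc hint
  have hlog : ContMDiff (I₁.prod I₂) 𝓘(ℝ, ℝ) ∞ (fun p => Real.log (r p)) := fun p =>
    (Real.contDiffAt_log.2 (hrpos p).ne').contMDiffAt.comp p (hr p)
  refine ⟨fun p => Real.log (r p), hlog, fun x y => ?_⟩
  have hF := contDiffOn_comp_extChartAt_symm hf x
  have hβ₁ := hφ.left.contDiffOn_verticalForm (x₀ := x) hg₁ hh₁
  have hβ₂ := hφ.right.contDiffOn_verticalForm (x₀ := y) hg₂ hh₂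
  constructor
  · have := IsSplittingOn.fst (hg₁ x) (hg₂ y) hF (fun u _ => hfpos _) hβ₁ hβ₂ (h (x, y))
      (mem_extChartAt_target (I := I₂) y)
    simpa only [extChartAt_to_inv] using this
  · have := IsSplittingOn.snd (hg₁ x) (hg₂ y) hF (fun u _ => hfpos _) hβ₁ hβ₂ (h (x, y))
      (mem_extChartAt_target (I := I₁) x)
    simpa only [extChartAt_to_inv] using this

/-- Since `f = ρ ∘ φ₁`, its differential factors through that of `φ₁` and kills vertical vectors. -/
theorem fderiv_warping (hφ : IsClairautWarpedProductMap g₁ g₂ f h₁ h₂ ρ φ₁ φ₂)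
    (hg₁ : IsSmoothMetric g₁) (hρ : ContMDiff J₁ 𝓘(ℝ, ℝ) ∞ ρ) (hc : ∀ x, ρ (φ₁ x) = f x)
    {x₀ : M₁} {u : E₁} (hu : u ∈ (extChartAt I₁ x₀).target) (v : E₁) :
    fderiv ℝ (fun t => f ((extChartAt I₁ x₀).symm t)) u (verticalProj g₁ h₁ φ₁ x₀ u v) = 0 := by
  set y₀ := φ₁ ((extChartAt I₁ x₀).symm u) with hy₀
  have hy : φ₁ ((extChartAt I₁ x₀).symm u) ∈ (extChartAt J₁ y₀).source := mem_extChartAt_source y₀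
  have e : (fun t => f ((extChartAt I₁ x₀).symm t))
      =ᶠ[𝓝 u] fun t => ρ ((extChartAt J₁ y₀).symm (coordMap I₁ J₁ φ₁ x₀ y₀ t)) := by
    filter_upwards [eventually_coordMap_source hu hφ.left.smooth.continuous.continuousAt hy] with t ht
    rw [coordMap_symm ht.2, hc]
  have hd := ((contDiffOn_comp_extChartAt_symm hρ y₀).contDiffAt
    ((isOpen_extChartAt_target y₀).mem_nhds (coordMap_mem hy))).differentiableAt (by simp)
  rw [e.fderiv_eq, fderiv_comp_apply
    (A := fun t => ρ ((extChartAt J₁ y₀).symm t)) hd (differentiableAt_of_contDiffAt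
    (contDiffAt_coordMap hu hφ.left.smooth.contMDiffAt hy)),
    (hφ.left.fderiv_coordMap_eq_zero_iff hu hy _).2 (hφ.left.verticalProj_splitting hg₁ hu v).2,
    map_zero]

end IsClairautWarpedProductMap

end WarpedMap

/-! ### Fibres -/

section Fibre

variable {E : Type*} [NormedAddCommGroup E] [NormedSpace ℝ E] [FiniteDimensional ℝ E]
  {H : Type*} [TopologicalSpace H] {I : ModelWithCorners ℝ E H} [I.Boundaryless]
  {M : Type*} [TopologicalSpace M] [ChartedSpace H M] [IsManifold I ∞ M]
  {E' : Type*} [NormedAddCommGroup E'] [NormedSpace ℝ E'] [FiniteDimensional ℝ E']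
  {H' : Type*} [TopologicalSpace H'] {J : ModelWithCorners ℝ E' H'} [J.Boundaryless]
  {N : Type*} [TopologicalSpace N] [ChartedSpace H' N] [IsManifold J ∞ N]
  {g : MetricField I M} {h : MetricField J N} {φ : M → N}
  {EF : Type*} [NormedAddCommGroup EF] [NormedSpace ℝ EF] [FiniteDimensional ℝ EF]
  {F : Type*} [TopologicalSpace F] [ChartedSpace EF F] [IsManifold 𝓘(ℝ, EF) ∞ F]
  {q : N} {ι : F → M}

/-- The Laplacian of `ℓ`, as a divergence in the preferred charts. -/
def laplacian (g : MetricField I M) (ℓ : M → ℝ) (x : M) : ℝ :=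
  coordDiv (coordMetric g x) (coordGrad (coordMetric g x)
    (fun t => ℓ ((extChartAt I x).symm t))) (extChartAt I x x)

/-- The inner product of the gradients of `f` and `ℓ`. -/
def gradInner (g : MetricField I M) (f ℓ : M → ℝ) (x : M) : ℝ :=
  fderiv ℝ (fun t => f ((extChartAt I x).symm t)) (extChartAt I x x)
    (coordGrad (coordMetric g x) (fun t => ℓ ((extChartAt I x).symm t)) (extChartAt I x x))

theorem ricci_eq (g : MetricField I M) (x : M) (v w : E) :
    ricci g x v w = LinearMap.trace ℝ E
      (coordCurvature (coordMetric g x) univ (extChartAt I x x) v w).toLinearMap := by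
  unfold ricci
  rw [I.range_eq_univ]

theorem coordMap_self_apply (φ : M → N) (x : M) :
    coordMap I J φ x (φ x) (extChartAt I x x) = extChartAt J (φ x) (φ x) := by
  simp [coordMap]

theorem fderiv_coordMap_self {φ : M → N} (hφ : ContMDiff I J ∞ φ) (x : M) (v : E) :
    fderiv ℝ (coordMap I J φ x (φ x)) (extChartAt I x x) v = tangentMapAt I J φ x v := by
  have h := chartDeriv_fderiv_coordMap (x₀ := x) (y₀ := φ x) (mem_extChartAt_target x)
    hφ.contMDiffAt (by rw [extChartAt_to_inv]; exact mem_extChartAt_source _) v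
  rwa [coordMap_self_apply, chartDeriv_self, chartDeriv_self, extChartAt_to_inv] at h

/-- A vector is fixed by the vertical projector when `φ_*` kills it, that is, when it is in the
image of `ι_*`. The chart derivatives are bijective and carry this to coordinates. -/
theorem IsFibre.isIntegralParam (hι : IsFibre (EF := EF) I J φ q ι) (hφ : IsRiemannianMap g h φ)
    (hg : IsSmoothMetric g) (s : F) :
    IsIntegralParam (coordMetric g (ι s)) (verticalForm g h φ (ι s)) (extChartAt I (ι s)).target
      (coordMetric (pullbackMetric 𝓘(ℝ, EF) g ι) s) (extChartAt 𝓘(ℝ, EF) s).target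
      (coordMap 𝓘(ℝ, EF) I ι s (ι s)) (extChartAt 𝓘(ℝ, EF) s s) := by
  have hu : extChartAt 𝓘(ℝ, EF) s s ∈ (extChartAt 𝓘(ℝ, EF) s).target := mem_extChartAt_target s
  have hy : ι ((extChartAt 𝓘(ℝ, EF) s).symm (extChartAt 𝓘(ℝ, EF) s s))
      ∈ (extChartAt I (ι s)).source := by
    rw [extChartAt_to_inv]; exact mem_extChartAt_source _
  have hev := eventually_coordMap_source hu hι.smooth.continuous.continuousAt hy
  refine ⟨hg.pullback hι.smooth hι.immersive s, hu, ?_, ?_, ?_, ?_⟩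
  · filter_upwards [hev] with t ht
    exact contDiffAt_coordMap ht.1 hι.smooth.contMDiffAt ht.2
  · filter_upwards [hev] with t ht
    exact coordMap_mem ht.2
  · filter_upwards [hev] with t ht v w
    exact coordMetric_pullback g ht.1 hι.smooth.contMDiffAt ht.2 v w
  · filter_upwards [hev] with t ht v
    have hm := coordMap_mem (I := 𝓘(ℝ, EF)) (J := I) ht.2
    have e : (extChartAt I (ι s)).symm (coordMap 𝓘(ℝ, EF) I ι s (ι s) t)
        = ι ((extChartAt 𝓘(ℝ, EF) s).symm t) := coordMap_symm ht.2
    have h1 := hφ.verticalProj_eq_self_iff hg hm v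
    have h2 : chartTangentMap I J φ (ι s) (coordMap 𝓘(ℝ, EF) I ι s (ι s) t) v
        = tangentMapAt I J φ (ι ((extChartAt 𝓘(ℝ, EF) s).symm t))
          (chartDeriv I (ι s) (coordMap 𝓘(ℝ, EF) I ι s (ι s) t) v) := by
      unfold chartTangentMap
      rw [e]
      rfl
    have h3 : tangentMapAt I J φ (ι ((extChartAt 𝓘(ℝ, EF) s).symm t))
          (chartDeriv I (ι s) (coordMap 𝓘(ℝ, EF) I ι s (ι s) t) v) = 0 ↔
        ∃ a, tangentMapAt 𝓘(ℝ, EF) I ι ((extChartAt 𝓘(ℝ, EF) s).symm t) a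
          = chartDeriv I (ι s) (coordMap 𝓘(ℝ, EF) I ι s (ι s) t) v := hι.tangent _ _
    have h4 := chartDeriv_fderiv_coordMap ht.1 hι.smooth.contMDiffAt ht.2
    refine (h1.trans ?_)
    rw [h2, h3]
    constructor
    · rintro ⟨a, ha⟩
      obtain ⟨a, rfl⟩ := (chartDeriv_bijective ht.1).2 a
      exact ⟨a, (chartDeriv_bijective hm).1 ((h4 a).trans ha)⟩
    · rintro ⟨a, rfl⟩
      exact ⟨chartDeriv 𝓘(ℝ, EF) s t a, (h4 a).symm⟩

/-- The Ricci tensor along the fibres of a Riemannian map which splits in charts. -/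
theorem IsFibre.ricci_eq (hι : IsFibre (EF := EF) I J φ q ι) (hφ : IsRiemannianMap g h φ)
    (hg : IsSmoothMetric g) {ℓ : M → ℝ} (s : F)
    (hs : IsSplittingOn (coordMetric g (ι s)) (verticalForm g h φ (ι s))
      (fun t => ℓ ((extChartAt I (ι s)).symm t)) (extChartAt I (ι s)).target) (v w : EF) :
    ricci g (ι s) (tangentMapAt 𝓘(ℝ, EF) I ι s v) (tangentMapAt 𝓘(ℝ, EF) I ι s w)
      = ricci (pullbackMetric 𝓘(ℝ, EF) g ι) s v w
        - laplacian g ℓ (ι s) * formAt (pullbackMetric 𝓘(ℝ, EF) g ι) s v w := by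
  have h1 := hs.trace_coordCurvature (hι.isIntegralParam hφ hg s) v w
  rw [fderiv_coordMap_self hι.smooth, fderiv_coordMap_self hι.smooth, coordMap_self_apply,
    coordMetric_eq, chartDeriv_self, extChartAt_to_inv] at h1
  rw [WarpedClairaut.ricci_eq, WarpedClairaut.ricci_eq]
  exact h1

variable {x₀ : M}

/-- The definition uses a different chart at every point. Invariance of gradient and divergence
gives one expression valid throughout a chart, from which smoothness can be read. -/
theorem laplacian_eq (hg : IsSmoothMetric g) {ℓ : M → ℝ} (hℓ : ContMDiff I 𝓘(ℝ, ℝ) ∞ ℓ)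
    {u : E} (hu : u ∈ (extChartAt I x₀).target) :
    laplacian g ℓ ((extChartAt I x₀).symm u)
      = coordDiv (coordMetric g x₀) (coordGrad (coordMetric g x₀)
        (fun t => ℓ ((extChartAt I x₀).symm t))) u := by
  set y₀ := (extChartAt I x₀).symm u with hy₀
  have hy : (extChartAt I x₀).symm u ∈ (extChartAt I y₀).source := mem_extChartAt_source y₀
  have hev := eventually_coordMap_source (φ := (id : M → M)) hu continuousAt_id hy
  have hcd : ∀ z : M, ∀ t ∈ (extChartAt I z).target,
      ContDiffAt ℝ ∞ (fun t => ℓ ((extChartAt I z).symm t)) t := fun z t ht =>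
    (contDiffOn_comp_extChartAt_symm hℓ z).contDiffAt ((isOpen_extChartAt_target z).mem_nhds ht)
  have hm := coordMap_mem (φ := (id : M → M)) (I := I) (J := I) hy
  refine (hg y₀).coordDiv_transform (τ := coordMap I I id x₀ y₀) (hg x₀) hu hm
    (contDiffAt_coordMap hu contMDiffAt_id hy) (bijective_fderiv_coordMap_id hu hy)
    (hev.mono fun t ht v w => coordMetric_change g ht.1 ht.2 v w)
    (differentiableAt_of_contDiffAt ((hg y₀).contDiffAt_coordGrad hm (hcd _ _ hm)))
    (differentiableAt_of_contDiffAt ((hg x₀).contDiffAt_coordGrad hu (hcd _ _ hu))) ?_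
  filter_upwards [hev] with t ht
  have hmt := coordMap_mem (φ := (id : M → M)) (I := I) (J := I) ht.2
  refine (hg y₀).coordGrad_transform (hg x₀) ht.1 hmt (contDiffAt_coordMap ht.1 contMDiffAt_id ht.2)
    (bijective_fderiv_coordMap_id ht.1 ht.2).2 (coordMetric_change g ht.1 ht.2)
    (differentiableAt_of_contDiffAt (hcd _ _ hmt)) ?_
  filter_upwards [eventually_coordMap_source (φ := (id : M → M)) ht.1 continuousAt_id ht.2] with z hz
  rw [coordMap_symm (φ := (id : M → M)) hz.2]
  rfl

theorem gradInner_eq (hg : IsSmoothMetric g) {f ℓ : M → ℝ} (hf : ContMDiff I 𝓘(ℝ, ℝ) ∞ f)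
    (hℓ : ContMDiff I 𝓘(ℝ, ℝ) ∞ ℓ) {u : E} (hu : u ∈ (extChartAt I x₀).target) :
    gradInner g f ℓ ((extChartAt I x₀).symm u)
      = fderiv ℝ (fun t => f ((extChartAt I x₀).symm t)) u
        (coordGrad (coordMetric g x₀) (fun t => ℓ ((extChartAt I x₀).symm t)) u) := by
  set y₀ := (extChartAt I x₀).symm u with hy₀
  have hy : (extChartAt I x₀).symm u ∈ (extChartAt I y₀).source := mem_extChartAt_source y₀
  have hev := eventually_coordMap_source (φ := (id : M → M)) hu continuousAt_id hy
  have hcd : ∀ ℓ : M → ℝ, ContMDiff I 𝓘(ℝ, ℝ) ∞ ℓ → ∀ z : M, ∀ t ∈ (extChartAt I z).target,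
      DifferentiableAt ℝ (fun t => ℓ ((extChartAt I z).symm t)) t := fun ℓ hℓ z t ht =>
    ((contDiffOn_comp_extChartAt_symm hℓ z).contDiffAt
      ((isOpen_extChartAt_target z).mem_nhds ht)).differentiableAt (by simp)
  have hm := coordMap_mem (φ := (id : M → M)) (I := I) (J := I) hy
  have hτ := contDiffAt_coordMap (φ := (id : M → M)) (I := I) (J := I) hu contMDiffAt_id hy
  have e : ∀ ℓ : M → ℝ, (fun t => ℓ ((extChartAt I x₀).symm t))
      =ᶠ[𝓝 u] fun t => ℓ ((extChartAt I y₀).symm (coordMap I I id x₀ y₀ t)) := by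
    intro ℓ
    filter_upwards [hev] with t ht
    rw [coordMap_symm (φ := (id : M → M)) ht.2]
    rfl
  have h1 := (hg y₀).coordGrad_transform (hg x₀) hu hm hτ
    (bijective_fderiv_coordMap_id hu hy).2 (coordMetric_change g hu hy) (hcd ℓ hℓ _ _ hm) (e ℓ)
  have h2 : extChartAt I y₀ y₀ = coordMap I I id x₀ y₀ u := rfl
  unfold gradInner
  rw [h2, h1, (e f).fderiv_eq, fderiv_comp_apply (A := fun t => f ((extChartAt I y₀).symm t))
    (hcd f hf _ _ hm) (differentiableAt_of_contDiffAt hτ)]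

theorem contMDiff_of_coord {w : M → ℝ}
    (hw : ∀ x₀, ContDiffOn ℝ ∞ (fun t => w ((extChartAt I x₀).symm t)) (extChartAt I x₀).target) :
    ContMDiff I 𝓘(ℝ, ℝ) ∞ w := by
  intro x
  have h1 : ContMDiffAt 𝓘(ℝ, E) 𝓘(ℝ, ℝ) ∞ (fun t => w ((extChartAt I x).symm t))
      (extChartAt I x x) := ((hw x).contDiffAt ((isOpen_extChartAt_target x).mem_nhds
        (mem_extChartAt_target x))).contMDiffAt
  refine (h1.comp x (contMDiffAt_extChartAt (I := I) (n := ∞))).congr_of_eventuallyEq ?_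
  filter_upwards [(isOpen_extChartAt_source (I := I) x).mem_nhds (mem_extChartAt_source x)] with y hy
  exact congrArg w ((extChartAt I x).left_inv hy).symm

theorem contMDiff_laplacian (hg : IsSmoothMetric g) {ℓ : M → ℝ} (hℓ : ContMDiff I 𝓘(ℝ, ℝ) ∞ ℓ) :
    ContMDiff I 𝓘(ℝ, ℝ) ∞ (laplacian g ℓ) := by
  refine contMDiff_of_coord fun x₀ => ContDiffOn.congr ?_ fun u hu => laplacian_eq hg hℓ hu
  intro u hu
  refine ContDiffAt.contDiffWithinAt ?_
  have hℓu := (contDiffOn_comp_extChartAt_symm hℓ x₀).contDiffAt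
    ((isOpen_extChartAt_target x₀).mem_nhds hu)
  have hn := (hg x₀).contDiffAt_coordGrad hu hℓu
  have hΓ := (hg x₀).contDiffAt_christoffel hu
  let T : (E →L[ℝ] E) →L[ℝ] ℝ := LinearMap.toContinuousLinearMap
    ((LinearMap.trace ℝ E).comp (ContinuousLinearMap.coeLM ℝ))
  have hflip : ContDiffAt ℝ ∞ (fun t => (christoffel (coordMetric g x₀) univ t).flip) u :=
    ((ContinuousLinearMap.flipₗᵢ ℝ E E E).contDiff.contDiffAt).comp u hΓ
  exact T.contDiff.contDiffAt.comp u ((contDiffAt_fderiv hn).add (hflip.clm_apply hn))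

theorem contMDiff_gradInner (hg : IsSmoothMetric g) {f ℓ : M → ℝ} (hf : ContMDiff I 𝓘(ℝ, ℝ) ∞ f)
    (hℓ : ContMDiff I 𝓘(ℝ, ℝ) ∞ ℓ) : ContMDiff I 𝓘(ℝ, ℝ) ∞ (gradInner g f ℓ) := by
  refine contMDiff_of_coord fun x₀ => ContDiffOn.congr ?_ fun u hu => gradInner_eq hg hf hℓ hu
  intro u hu
  refine ContDiffAt.contDiffWithinAt ?_
  have hn := (isOpen_extChartAt_target (I := I) x₀).mem_nhds hu
  exact (contDiffAt_fderiv ((contDiffOn_comp_extChartAt_symm hf x₀).contDiffAt hn)).clm_apply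
    ((hg x₀).contDiffAt_coordGrad hu ((contDiffOn_comp_extChartAt_symm hℓ x₀).contDiffAt hn))

end Fibre

/-! ### Lie derivatives and Ricci tensors of warped products -/

section LieDeriv

variable {E : Type*} [NormedAddCommGroup E] [NormedSpace ℝ E] [FiniteDimensional ℝ E]
  {H : Type*} [TopologicalSpace H] {I : ModelWithCorners ℝ E H} [I.Boundaryless]
  {M : Type*} [TopologicalSpace M] [ChartedSpace H M] [IsManifold I ∞ M]
  {g : MetricField I M}

/-- The value of a vector field, as an element of the model space. -/
def fieldValue (X : ∀ x : M, TangentSpace I x) (x : M) : E := X x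

/-- The Lie derivative `L_ξ G` of a field of bilinear forms on `E`. -/
def coordLie (G : E → E →L[ℝ] E →L[ℝ] ℝ) (ξ : E → E) (u v w : E) : ℝ :=
  fderiv ℝ G u (ξ u) v w + G u (fderiv ℝ ξ u v) w + G u v (fderiv ℝ ξ u w)

theorem coordLie_congr {G G' : E → E →L[ℝ] E →L[ℝ] ℝ} {ξ ξ' : E → E} {u : E} (hG : G =ᶠ[𝓝 u] G')
    (hξ : ξ =ᶠ[𝓝 u] ξ') (v w : E) : coordLie G ξ u v w = coordLie G' ξ' u v w := by
  simp only [coordLie, hG.fderiv_eq, hξ.fderiv_eq, hG.self_of_nhds, hξ.self_of_nhds]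

theorem coordLie_sub {G : E → E →L[ℝ] E →L[ℝ] ℝ} {ξ ξ' : E → E} {u : E}
    (hξ : DifferentiableAt ℝ ξ u) (hξ' : DifferentiableAt ℝ ξ' u) (v w : E) :
    coordLie G (fun t => ξ t - ξ' t) u v w = coordLie G ξ u v w - coordLie G ξ' u v w := by
  simp only [coordLie, fderiv_fun_sub hξ hξ', sub_apply, map_sub]
  ring

theorem lieDerivMetric_eq (g : MetricField I M) (X : ∀ x : M, TangentSpace I x) (x : M) (v w : E) :
    lieDerivMetric g X x v w
      = coordLie (coordMetric g x) (coordField X x) (extChartAt I x x) v w := by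
  simp only [lieDerivMetric, I.range_eq_univ, fderivWithin_univ]
  rfl

theorem coordField_apply (X : ∀ x : M, TangentSpace I x) (x₀ : M) (u : E) :
    coordField X x₀ u = (chartDeriv I x₀ u).inverse (X ((extChartAt I x₀).symm u)) := by
  unfold coordField
  rw [I.range_eq_univ, VectorField.mpullbackWithin_univ]
  rfl

theorem chartDeriv_coordField (X : ∀ x : M, TangentSpace I x) {x₀ : M} {u : E}
    (hu : u ∈ (extChartAt I x₀).target) :
    chartDeriv I x₀ u (coordField X x₀ u) = fieldValue X ((extChartAt I x₀).symm u) := by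
  have h := isInvertible_mfderivWithin_extChartAt_symm (I := I) (x := x₀) hu
  rw [I.range_eq_univ, mfderivWithin_univ] at h
  have h' : (chartDeriv I x₀ u).IsInvertible := h
  obtain ⟨e, he⟩ := h'
  rw [coordField_apply, ← he, ContinuousLinearMap.inverse_equiv]
  exact e.apply_symm_apply _

theorem coordField_eq_of_chartDeriv {X : ∀ x : M, TangentSpace I x} {x₀ : M} {u z : E}
    (hu : u ∈ (extChartAt I x₀).target)
    (h : chartDeriv I x₀ u z = fieldValue X ((extChartAt I x₀).symm u)) : coordField X x₀ u = z :=
  (chartDeriv_bijective hu).1 ((chartDeriv_coordField X hu).trans h.symm)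

theorem coordField_self (X : ∀ x : M, TangentSpace I x) (x : M) :
    coordField X x (extChartAt I x x) = fieldValue X x := by
  have h := chartDeriv_coordField X (mem_extChartAt_target (I := I) x)
  rwa [chartDeriv_self, extChartAt_to_inv] at h

theorem coordField_sub (X Y : ∀ x : M, TangentSpace I x) (x₀ : M) (u : E) :
    coordField (fun x => X x - Y x) x₀ u = coordField X x₀ u - coordField Y x₀ u := by
  rw [coordField_apply, coordField_apply, coordField_apply]
  exact map_sub (chartDeriv I x₀ u).inverse _ _

theorem IsSmoothField.differentiableAt_coordField {X : ∀ x : M, TangentSpace I x}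
    (hX : IsSmoothField X univ) (x : M) :
    DifferentiableAt ℝ (coordField X x) (extChartAt I x x) := by
  have h1 := VectorField.contMDiffWithinAt_mpullbackWithin_extChartAt_symm (n := ∞) (m := ∞)
    (V := X) (s := univ) (hX x (mem_univ x)) uniqueMDiffOn_univ (mem_univ x) (by simp)
  have h2 := contMDiffWithinAt_vectorSpace_iff_contDiffWithinAt.1 h1
  rw [preimage_univ, inter_univ] at h2
  exact differentiableAt_of_contDiffAt
    (h2.contDiffAt ((isOpen_extChartAt_target x).mem_nhds (mem_extChartAt_target x)))

theorem apply_gradient (hg : IsSmoothMetric g) (f : M → ℝ) (x : M) (z : E) :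
    formAt g x (gradient g f x) z = tangentMapAt I 𝓘(ℝ, ℝ) f x z :=
  congrArg (fun l : E →L[ℝ] ℝ => l z)
    (apply_inverse_of_pos (B := formAt g x) (hg.pos x) (tangentMapAt I 𝓘(ℝ, ℝ) f x))

theorem coordField_smul_gradient (hg : IsSmoothMetric g) {f : M → ℝ}
    (hf : ContMDiff I 𝓘(ℝ, ℝ) ∞ f) (c : ℝ) {x₀ : M} {u : E} (hu : u ∈ (extChartAt I x₀).target) :
    coordField (fun x => (c * f x) • gradient g f x) x₀ u
      = (c * f ((extChartAt I x₀).symm u)) •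
        coordGrad (coordMetric g x₀) (fun t => f ((extChartAt I x₀).symm t)) u := by
  refine coordField_eq_of_chartDeriv hu ?_
  have hgrad : chartDeriv I x₀ u
      (coordGrad (coordMetric g x₀) (fun t => f ((extChartAt I x₀).symm t)) u)
      = gradient g f ((extChartAt I x₀).symm u) := by
    refine eq_of_forall_apply_eq (hg.pos ((extChartAt I x₀).symm u)) fun z => ?_
    obtain ⟨z, rfl⟩ := (chartDeriv_bijective hu).2 z
    have h1 := mfderiv_comp_apply u (hf.mdifferentiable (by simp) _)
      (mdifferentiableAt_extChartAt_symm hu) z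
    rw [mfderiv_eq_fderiv] at h1
    rw [← coordMetric_eq, (hg x₀).apply_coordGrad hu, apply_gradient hg]
    exact h1
  rw [map_smul, hgrad]
  rfl

theorem scaledMetric_form (g : MetricField I M) (c : ℝ) (x : M) (v w : E) :
    formAt (scaledMetric g c) x v w = c ^ 2 * formAt g x v w := rfl

theorem coordMetric_scaledMetric (g : MetricField I M) (c : ℝ) (x₀ : M) :
    coordMetric (scaledMetric g c) x₀ = fun u => c ^ 2 • coordMetric g x₀ u := by
  funext u
  refine ContinuousLinearMap.ext fun v => ContinuousLinearMap.ext fun w => ?_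
  rw [coordMetric_eq, scaledMetric_form, ← coordMetric_eq]
  rfl

theorem lieDerivMetric_scaledMetric (hg : IsSmoothMetric g) (X : ∀ x : M, TangentSpace I x) (c : ℝ)
    (x : M) (v w : E) :
    lieDerivMetric (scaledMetric g c) X x v w = c ^ 2 * lieDerivMetric g X x v w := by
  have h := (hg x).differentiableAt (mem_extChartAt_target x)
  rw [lieDerivMetric_eq, lieDerivMetric_eq, coordMetric_scaledMetric, coordLie, coordLie,
    fderiv_fun_const_smul h]
  simp only [smul_apply, smul_eq_mul]
  ring

theorem IsSmoothMetric.scaledMetric (hg : IsSmoothMetric g) {c : ℝ} (hc : c ≠ 0) :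
    IsSmoothMetric (scaledMetric g c) := by
  intro x₀
  rw [coordMetric_scaledMetric]
  refine ⟨(hg x₀).isOpen, (hg x₀).contDiffOn.const_smul (c ^ 2), fun u hu v w => ?_,
    fun u hu v hv => ?_⟩
  · simp [(hg x₀).symm u hu v w]
  · exact mul_pos (by positivity) ((hg x₀).pos u hu v hv)

/-- A constant factor cancels in the Christoffel symbols, and the curvature as an endomorphism
depends on the metric only through them. -/
theorem ricci_scaledMetric (hg : IsSmoothMetric g) {c : ℝ} (hc : c ≠ 0) (x : M) (v w : E) :
    ricci (scaledMetric g c) x v w = ricci g x v w := by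
  have hΓ : ∀ u ∈ (extChartAt I x).target, christoffel (coordMetric (scaledMetric g c) x) univ u
      = christoffel (coordMetric g x) univ u := by
    intro u hu
    have h1 := hg.scaledMetric hc x
    refine ContinuousLinearMap.ext fun a => ContinuousLinearMap.ext fun b => h1.ext hu fun z => ?_
    have h2 := (hg x).apply_christoffel hu a b z
    rw [h1.apply_christoffel hu, coordMetric_scaledMetric,
      fderiv_fun_const_smul ((hg x).differentiableAt hu)]
    simp only [smul_apply, smul_eq_mul, h2]
    ring
  have hu := mem_extChartAt_target (I := I) x
  have hev : christoffel (coordMetric (scaledMetric g c) x) univ =ᶠ[𝓝 (extChartAt I x x)]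
      christoffel (coordMetric g x) univ := by
    filter_upwards [(hg x).isOpen.mem_nhds hu] with u hu using hΓ u hu
  rw [ricci_eq, ricci_eq]
  simp only [coordCurvature, fderivWithin_univ, hev.fderiv_eq, hΓ _ hu]

end LieDeriv

/-! ### Lie derivatives and the Ricci tensor of a warped metric on vectors tangent to one factor. -/

section WarpedLie

variable {E₁ : Type*} [NormedAddCommGroup E₁] [NormedSpace ℝ E₁] [FiniteDimensional ℝ E₁]
  {H₁ : Type*} [TopologicalSpace H₁] {I₁ : ModelWithCorners ℝ E₁ H₁} [I₁.Boundaryless]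
  {M₁ : Type*} [TopologicalSpace M₁] [ChartedSpace H₁ M₁] [IsManifold I₁ ∞ M₁]
  {E₂ : Type*} [NormedAddCommGroup E₂] [NormedSpace ℝ E₂] [FiniteDimensional ℝ E₂]
  {H₂ : Type*} [TopologicalSpace H₂] {I₂ : ModelWithCorners ℝ E₂ H₂} [I₂.Boundaryless]
  {M₂ : Type*} [TopologicalSpace M₂] [ChartedSpace H₂ M₂] [IsManifold I₂ ∞ M₂]
  {g₁ : MetricField I₁ M₁} {g₂ : MetricField I₂ M₂} {f : M₁ → ℝ}
  {ξ : ∀ p : M₁ × M₂, TangentSpace (I₁.prod I₂) p} {x : M₁} {y : M₂}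

theorem fieldValue_component₁ (ξ : ∀ p : M₁ × M₂, TangentSpace (I₁.prod I₂) p) (x : M₁) (y : M₂) :
    fieldValue (component₁ ξ y) x = (fieldValue ξ (x, y)).1 := by
  have h := mfderiv_fst (I := I₁) (I' := I₂) (x := (x, y))
  exact congrArg (fun L : E₁ × E₂ →L[ℝ] E₁ => L (fieldValue ξ (x, y))) h

theorem fieldValue_component₂ (ξ : ∀ p : M₁ × M₂, TangentSpace (I₁.prod I₂) p) (x : M₁) (y : M₂) :
    fieldValue (component₂ ξ x) y = (fieldValue ξ (x, y)).2 := by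
  have h := mfderiv_snd (I := I₁) (I' := I₂) (x := (x, y))
  exact congrArg (fun L : E₁ × E₂ →L[ℝ] E₂ => L (fieldValue ξ (x, y))) h

theorem chartDeriv_coordField_prod (ξ : ∀ p : M₁ × M₂, TangentSpace (I₁.prod I₂) p) {x : M₁}
    {y : M₂} {t₁ : E₁} {t₂ : E₂} (h₁ : t₁ ∈ (extChartAt I₁ x).target)
    (h₂ : t₂ ∈ (extChartAt I₂ y).target) :
    (chartDeriv I₁ x t₁ (coordField ξ (x, y) (t₁, t₂)).1,
      chartDeriv I₂ y t₂ (coordField ξ (x, y) (t₁, t₂)).2)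
      = fieldValue ξ ((extChartAt I₁ x).symm t₁, (extChartAt I₂ y).symm t₂) := by
  have ht : (t₁, t₂) ∈ (extChartAt (I₁.prod I₂) (x, y)).target := by
    rw [extChartAt_prod_target]; exact ⟨h₁, h₂⟩
  have h := chartDeriv_coordField ξ ht
  rwa [chartDeriv_prod (p := (x, y)) (u := (t₁, t₂)) h₁ h₂, extChartAt_prod_symm_apply] at h

theorem coordField_component₁ (ξ : ∀ p : M₁ × M₂, TangentSpace (I₁.prod I₂) p) (x : M₁) (y : M₂)
    {s : E₁} (hs : s ∈ (extChartAt I₁ x).target) :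
    coordField (component₁ ξ y) x s = (coordField ξ (x, y) (s, extChartAt I₂ y y)).1 := by
  have h := chartDeriv_coordField_prod ξ hs (mem_extChartAt_target (I := I₂) y)
  rw [extChartAt_to_inv] at h
  refine coordField_eq_of_chartDeriv hs ?_
  rw [fieldValue_component₁, ← h]

theorem coordField_component₂ (ξ : ∀ p : M₁ × M₂, TangentSpace (I₁.prod I₂) p) (x : M₁) (y : M₂)
    {s : E₂} (hs : s ∈ (extChartAt I₂ y).target) :
    coordField (component₂ ξ x) y s = (coordField ξ (x, y) (extChartAt I₁ x x, s)).2 := by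
  have h := chartDeriv_coordField_prod ξ (mem_extChartAt_target (I := I₁) x) hs
  rw [extChartAt_to_inv] at h
  refine coordField_eq_of_chartDeriv hs ?_
  rw [fieldValue_component₂, ← h]

theorem IsSmoothField.differentiableAt_coordField' (hξ : IsSmoothField ξ univ) (x : M₁) (y : M₂) :
    DifferentiableAt ℝ (coordField ξ (x, y)) (extChartAt I₁ x x, extChartAt I₂ y y) := by
  have h := hξ.differentiableAt_coordField (x, y)
  rwa [extChartAt_prod_apply] at h

theorem eventually_coordField_component₁ (ξ : ∀ p : M₁ × M₂, TangentSpace (I₁.prod I₂) p)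
    (x : M₁) (y : M₂) : coordField (component₁ ξ y) x =ᶠ[𝓝 (extChartAt I₁ x x)]
      fun s => (coordField ξ (x, y) (s, extChartAt I₂ y y)).1 := by
  filter_upwards [(isOpen_extChartAt_target (I := I₁) x).mem_nhds (mem_extChartAt_target x)]
    with s hs using coordField_component₁ ξ x y hs

theorem eventually_coordField_component₂ (ξ : ∀ p : M₁ × M₂, TangentSpace (I₁.prod I₂) p)
    (x : M₁) (y : M₂) : coordField (component₂ ξ x) y =ᶠ[𝓝 (extChartAt I₂ y y)]
      fun s => (coordField ξ (x, y) (extChartAt I₁ x x, s)).2 := by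
  filter_upwards [(isOpen_extChartAt_target (I := I₂) y).mem_nhds (mem_extChartAt_target y)]
    with s hs using coordField_component₂ ξ x y hs

theorem IsSmoothField.differentiableAt_component₁ (hξ : IsSmoothField ξ univ) (x : M₁) (y : M₂) :
    DifferentiableAt ℝ (coordField (component₁ ξ y) x) (extChartAt I₁ x x) :=
  (((hξ.differentiableAt_coordField' x y).comp (extChartAt I₁ x x)
    (f := fun s => (s, extChartAt I₂ y y)) (by fun_prop)).fst).congr_of_eventuallyEq
      (eventually_coordField_component₁ ξ x y)

theorem eventually_coordMetric_warpedMetric (g₁ : MetricField I₁ M₁) (g₂ : MetricField I₂ M₂)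
    (f : M₁ → ℝ) (x : M₁) (y : M₂) :
    coordMetric (warpedMetric g₁ g₂ f) (x, y) =ᶠ[𝓝 (extChartAt I₁ x x, extChartAt I₂ y y)]
      warpForm (coordMetric g₁ x) (coordMetric g₂ y) (fun t => f ((extChartAt I₁ x).symm t)) :=
  (coordMetric_warpedMetric g₁ g₂ f (x, y)).eventuallyEq_of_mem
    (((isOpen_extChartAt_target x).prod (isOpen_extChartAt_target y)).mem_nhds
      ⟨mem_extChartAt_target x, mem_extChartAt_target y⟩)

theorem fderiv_fst_inl {ζ : E₁ × E₂ → E₁ × E₂} {u₁ : E₁} {u₂ : E₂}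
    (h : DifferentiableAt ℝ ζ (u₁, u₂)) (a : E₁) :
    (fderiv ℝ ζ (u₁, u₂) (a, 0)).1 = fderiv ℝ (fun s => (ζ (s, u₂)).1) u₁ a := by
  have h1 : DifferentiableAt ℝ (fun s => ζ (s, u₂)) u₁ :=
    h.comp u₁ (f := fun s => (s, u₂)) (by fun_prop)
  rw [fderiv_prod_left h, fderiv.fst h1]
  rfl

theorem fderiv_snd_inr {ζ : E₁ × E₂ → E₁ × E₂} {u₁ : E₁} {u₂ : E₂}
    (h : DifferentiableAt ℝ ζ (u₁, u₂)) (a : E₂) :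
    (fderiv ℝ ζ (u₁, u₂) (0, a)).2 = fderiv ℝ (fun s => (ζ (u₁, s)).2) u₂ a := by
  have h1 : DifferentiableAt ℝ (fun s => ζ (u₁, s)) u₂ :=
    h.comp u₂ (f := fun s => (u₁, s)) (by fun_prop)
  rw [fderiv_prod_right h, fderiv.snd h1]
  rfl

theorem lieDerivMetric_warpedMetric_left (hg₁ : IsSmoothMetric g₁) (hg₂ : IsSmoothMetric g₂)
    (hf : ContMDiff I₁ 𝓘(ℝ, ℝ) ∞ f) (hpos : ∀ x, 0 < f x) (hξ : IsSmoothField ξ univ)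
    (x : M₁) (y : M₂) (v w : E₁) :
    lieDerivMetric (warpedMetric g₁ g₂ f) ξ (x, y) ((v, 0) : E₁ × E₂) ((w, 0) : E₁ × E₂)
      = lieDerivMetric g₁ (component₁ ξ y) x v w := by
  have hx := mem_extChartAt_target (I := I₁) x
  have hy := mem_extChartAt_target (I := I₂) y
  have hF := contDiffOn_comp_extChartAt_symm hf x
  have hFd : DifferentiableAt ℝ (fun t => f ((extChartAt I₁ x).symm t)) (extChartAt I₁ x x) :=
    (hF.contDiffAt ((isOpen_extChartAt_target x).mem_nhds hx)).differentiableAt (by simp)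
  have hζ := hξ.differentiableAt_coordField' x y
  have hw := ((hg₁ x).warpForm (hg₂ y) hF fun u _ => hpos _).differentiableAt
    (u := (extChartAt I₁ x x, extChartAt I₂ y y)) ⟨hx, hy⟩
  rw [lieDerivMetric_eq, lieDerivMetric_eq, extChartAt_prod_apply,
    coordLie_congr (eventually_coordMetric_warpedMetric g₁ g₂ f x y) (EventuallyEq.refl _ _),
    coordLie_congr (EventuallyEq.refl _ _) (eventually_coordField_component₁ ξ x y)]
  unfold coordLie
  rw [fderiv_warpForm ((hg₁ x).differentiableAt hx) ((hg₂ y).differentiableAt hy) hFd hw,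
    warpForm_apply, warpForm_apply]
  simp only [fderiv_fst_inl hζ, map_zero, zero_apply, mul_zero, add_zero]

/-- Differentiating the weight `f²` along `ξ` would add `2 f df(ξ₁) g₂`; the assumption `hξf`
removes this term. For vertical `ξ` it holds because `f` is constant on the fibres of `φ₁`. -/
theorem lieDerivMetric_warpedMetric_right (hg₁ : IsSmoothMetric g₁) (hg₂ : IsSmoothMetric g₂)
    (hf : ContMDiff I₁ 𝓘(ℝ, ℝ) ∞ f) (hpos : ∀ x, 0 < f x) (hξ : IsSmoothField ξ univ)
    (x : M₁) (y : M₂)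
    (hξf : fderiv ℝ (fun t => f ((extChartAt I₁ x).symm t)) (extChartAt I₁ x x)
      (fieldValue ξ (x, y)).1 = 0) (v w : E₂) :
    lieDerivMetric (warpedMetric g₁ g₂ f) ξ (x, y) ((0, v) : E₁ × E₂) ((0, w) : E₁ × E₂)
      = f x ^ 2 * lieDerivMetric g₂ (component₂ ξ x) y v w := by
  have hx := mem_extChartAt_target (I := I₁) x
  have hy := mem_extChartAt_target (I := I₂) y
  have hF := contDiffOn_comp_extChartAt_symm hf x
  have hFd : DifferentiableAt ℝ (fun t => f ((extChartAt I₁ x).symm t)) (extChartAt I₁ x x) :=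
    (hF.contDiffAt ((isOpen_extChartAt_target x).mem_nhds hx)).differentiableAt (by simp)
  have hζ := hξ.differentiableAt_coordField' x y
  have hw := ((hg₁ x).warpForm (hg₂ y) hF fun u _ => hpos _).differentiableAt
    (u := (extChartAt I₁ x x, extChartAt I₂ y y)) ⟨hx, hy⟩
  have hself : coordField ξ (x, y) (extChartAt I₁ x x, extChartAt I₂ y y)
      = fieldValue ξ (x, y) := by
    have := coordField_self ξ (x, y)
    rwa [extChartAt_prod_apply] at this
  rw [lieDerivMetric_eq, lieDerivMetric_eq, extChartAt_prod_apply,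
    coordLie_congr (eventually_coordMetric_warpedMetric g₁ g₂ f x y) (EventuallyEq.refl _ _),
    coordLie_congr (EventuallyEq.refl _ _) (eventually_coordField_component₂ ξ x y)]
  unfold coordLie
  rw [← hself] at hξf
  rw [fderiv_warpForm ((hg₁ x).differentiableAt hx) ((hg₂ y).differentiableAt hy) hFd hw,
    warpForm_apply, warpForm_apply]
  simp only [fderiv_snd_inr hζ, map_zero, zero_apply, zero_add, extChartAt_to_inv]
  rw [hξf]
  ring

theorem ricci_warpedMetric_left (hg₁ : IsSmoothMetric g₁) (hg₂ : IsSmoothMetric g₂)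
    (hf : ContMDiff I₁ 𝓘(ℝ, ℝ) ∞ f) (hpos : ∀ x, 0 < f x) (x : M₁) (y : M₂) (v w : E₁) :
    ricci (warpedMetric g₁ g₂ f) (x, y) ((v, 0) : E₁ × E₂) ((w, 0) : E₁ × E₂)
      = ricci g₁ x v w - Module.finrank ℝ E₂ * (f x)⁻¹ *
        coordHess (coordMetric g₁ x) (fun t => f ((extChartAt I₁ x).symm t))
          (extChartAt I₁ x x) v w := by
  rw [ricci_eq, ricci_eq, extChartAt_prod_apply,
    coordCurvature_congr (eventually_coordMetric_warpedMetric g₁ g₂ f x y),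
    IsMetricOn.trace_coordCurvature_warpForm_left (hg₁ x) (hg₂ y)
      (contDiffOn_comp_extChartAt_symm hf x) (fun u _ => hpos _) (mem_extChartAt_target x)
      (mem_extChartAt_target y), extChartAt_to_inv]

theorem ricci_warpedMetric_right (hg₁ : IsSmoothMetric g₁) (hg₂ : IsSmoothMetric g₂)
    (hf : ContMDiff I₁ 𝓘(ℝ, ℝ) ∞ f) (hpos : ∀ x, 0 < f x) (x : M₁) (y : M₂) (v w : E₂) :
    ricci (warpedMetric g₁ g₂ f) (x, y) ((0, v) : E₁ × E₂) ((0, w) : E₁ × E₂)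
      = ricci g₂ y v w - warpCoeff (coordMetric g₁ x) (fun t => f ((extChartAt I₁ x).symm t))
          (Module.finrank ℝ E₂) (extChartAt I₁ x x) * formAt g₂ y v w := by
  rw [ricci_eq, ricci_eq, extChartAt_prod_apply,
    coordCurvature_congr (eventually_coordMetric_warpedMetric g₁ g₂ f x y),
    IsMetricOn.trace_coordCurvature_warpForm_right (hg₁ x) (hg₂ y)
      (contDiffOn_comp_extChartAt_symm hf x) (fun u _ => hpos _) (mem_extChartAt_target x)
      (mem_extChartAt_target y), coordMetric_eq, chartDeriv_self, extChartAt_to_inv]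
  rfl

end WarpedLie

/-! ### Ricci solitons on warped products -/

section Soliton

variable {E₁ : Type*} [NormedAddCommGroup E₁] [NormedSpace ℝ E₁] [FiniteDimensional ℝ E₁]
  {H₁ : Type*} [TopologicalSpace H₁] {I₁ : ModelWithCorners ℝ E₁ H₁} [I₁.Boundaryless]
  {M₁ : Type*} [TopologicalSpace M₁] [ChartedSpace H₁ M₁] [IsManifold I₁ ∞ M₁]
  {E₂ : Type*} [NormedAddCommGroup E₂] [NormedSpace ℝ E₂] [FiniteDimensional ℝ E₂]
  {H₂ : Type*} [TopologicalSpace H₂] {I₂ : ModelWithCorners ℝ E₂ H₂} [I₂.Boundaryless]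
  {M₂ : Type*} [TopologicalSpace M₂] [ChartedSpace H₂ M₂] [IsManifold I₂ ∞ M₂]
  {E₃ : Type*} [NormedAddCommGroup E₃] [NormedSpace ℝ E₃] [FiniteDimensional ℝ E₃]
  {H₃ : Type*} [TopologicalSpace H₃] {J₁ : ModelWithCorners ℝ E₃ H₃} [J₁.Boundaryless]
  {N₁ : Type*} [TopologicalSpace N₁] [ChartedSpace H₃ N₁] [IsManifold J₁ ∞ N₁]
  {E₄ : Type*} [NormedAddCommGroup E₄] [NormedSpace ℝ E₄] [FiniteDimensional ℝ E₄]
  {H₄ : Type*} [TopologicalSpace H₄] {J₂ : ModelWithCorners ℝ E₄ H₄} [J₂.Boundaryless]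
  {N₂ : Type*} [TopologicalSpace N₂] [ChartedSpace H₄ N₂] [IsManifold J₂ ∞ N₂]
  {g₁ : MetricField I₁ M₁} {g₂ : MetricField I₂ M₂} {h₁ : MetricField J₁ N₁}
  {h₂ : MetricField J₂ N₂} {f : M₁ → ℝ} {ρ : N₁ → ℝ} {φ₁ : M₁ → N₁} {φ₂ : M₂ → N₂}
  {ξ : ∀ p : M₁ × M₂, TangentSpace (I₁.prod I₂) p} {lam : ℝ}
  {EF : Type*} [NormedAddCommGroup EF] [NormedSpace ℝ EF] [FiniteDimensional ℝ EF]
  {F : Type*} [TopologicalSpace F] [ChartedSpace EF F] [IsManifold 𝓘(ℝ, EF) ∞ F]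

theorem IsRiemannianMap.verticalProj_self (hφ : IsRiemannianMap g₁ h₁ φ₁)
    (hg : IsSmoothMetric g₁) {x : M₁} {v : E₁} (hv : tangentMapAt I₁ J₁ φ₁ x v = 0) :
    verticalProj g₁ h₁ φ₁ x (extChartAt I₁ x x) v = v := by
  rw [hφ.verticalProj_eq_self_iff hg (mem_extChartAt_target x), chartTangentMap, chartDeriv_self,
    extChartAt_to_inv]
  exact hv

theorem IsFibre.tangentMapAt_eq_zero {q : N₁} {ι : F → M₁}
    (hι : IsFibre (EF := EF) I₁ J₁ φ₁ q ι) (s : F) (a : EF) :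
    tangentMapAt I₁ J₁ φ₁ (ι s) (tangentMapAt 𝓘(ℝ, EF) I₁ ι s a) = 0 :=
  (hι.tangent s _).2 ⟨a, rfl⟩

theorem IsRicciSoliton.left (hsol : IsRicciSoliton (warpedMetric g₁ g₂ f) ξ lam)
    (hg₁ : IsSmoothMetric g₁) (hg₂ : IsSmoothMetric g₂) (hf : ContMDiff I₁ 𝓘(ℝ, ℝ) ∞ f)
    (hpos : ∀ x, 0 < f x) (hξ : IsSmoothField ξ univ) (x : M₁) (y : M₂) (v w : E₁) :
    (1 / 2) * lieDerivMetric g₁ (component₁ ξ y) x v w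
      + (ricci g₁ x v w - Module.finrank ℝ E₂ * (f x)⁻¹ *
        coordHess (coordMetric g₁ x) (fun t => f ((extChartAt I₁ x).symm t))
          (extChartAt I₁ x x) v w) + lam * formAt g₁ x v w = 0 := by
  have h := hsol (x, y) ((v, 0) : E₁ × E₂) ((w, 0) : E₁ × E₂)
  have e : formAt (warpedMetric g₁ g₂ f) (x, y) (v, 0) (w, 0) = formAt g₁ x v w := by
    rw [formAt_warpedMetric]; simp
  rw [lieDerivMetric_warpedMetric_left hg₁ hg₂ hf hpos hξ,
    ricci_warpedMetric_left hg₁ hg₂ hf hpos] at h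
  rw [← e]
  exact h

theorem IsRicciSoliton.right (hsol : IsRicciSoliton (warpedMetric g₁ g₂ f) ξ lam)
    (hg₁ : IsSmoothMetric g₁) (hg₂ : IsSmoothMetric g₂) (hf : ContMDiff I₁ 𝓘(ℝ, ℝ) ∞ f)
    (hpos : ∀ x, 0 < f x) (hξ : IsSmoothField ξ univ) (x : M₁) (y : M₂)
    (hξf : fderiv ℝ (fun t => f ((extChartAt I₁ x).symm t)) (extChartAt I₁ x x)
      (fieldValue ξ (x, y)).1 = 0) (v w : E₂) :
    (1 / 2) * (f x ^ 2 * lieDerivMetric g₂ (component₂ ξ x) y v w)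
      + (ricci g₂ y v w - warpCoeff (coordMetric g₁ x) (fun t => f ((extChartAt I₁ x).symm t))
          (Module.finrank ℝ E₂) (extChartAt I₁ x x) * formAt g₂ y v w)
      + lam * (f x ^ 2 * formAt g₂ y v w) = 0 := by
  have h := hsol (x, y) ((0, v) : E₁ × E₂) ((0, w) : E₁ × E₂)
  have e : formAt (warpedMetric g₁ g₂ f) (x, y) (0, v) (0, w) = f x ^ 2 * formAt g₂ y v w := by
    rw [formAt_warpedMetric]; simp
  rw [lieDerivMetric_warpedMetric_right hg₁ hg₂ hf hpos hξ x y hξf,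
    ricci_warpedMetric_right hg₁ hg₂ hf hpos] at h
  rw [← e]
  exact h

theorem lieDerivMetric_sub_smul_gradient (hg₁ : IsSmoothMetric g₁)
    (hf : ContMDiff I₁ 𝓘(ℝ, ℝ) ∞ f) (hξ : IsSmoothField ξ univ) (c : ℝ) (x : M₁) (y : M₂)
    (v w : E₁) :
    lieDerivMetric g₁ (fun x => component₁ ξ y x - (c * f x) • gradient g₁ f x) x v w
      = lieDerivMetric g₁ (component₁ ξ y) x v w
        - 2 * c * (fderiv ℝ (fun t => f ((extChartAt I₁ x).symm t)) (extChartAt I₁ x x) v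
            * fderiv ℝ (fun t => f ((extChartAt I₁ x).symm t)) (extChartAt I₁ x x) w
          + f x * coordHess (coordMetric g₁ x) (fun t => f ((extChartAt I₁ x).symm t))
            (extChartAt I₁ x x) v w) := by
  have hx := mem_extChartAt_target (I := I₁) x
  have hF : ContDiffAt ℝ ∞ (fun t => f ((extChartAt I₁ x).symm t)) (extChartAt I₁ x x) :=
    (contDiffOn_comp_extChartAt_symm hf x).contDiffAt ((isOpen_extChartAt_target x).mem_nhds hx)
  have hev : coordField (fun x => component₁ ξ y x - (c * f x) • gradient g₁ f x) x
      =ᶠ[𝓝 (extChartAt I₁ x x)] fun u => coordField (component₁ ξ y) x u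
        - (c * f ((extChartAt I₁ x).symm u)) •
          coordGrad (coordMetric g₁ x) (fun t => f ((extChartAt I₁ x).symm t)) u := by
    filter_upwards [(isOpen_extChartAt_target (I := I₁) x).mem_nhds hx] with u hu
    rw [coordField_sub, coordField_smul_gradient hg₁ hf c hu]
  have hd : DifferentiableAt ℝ (fun u => (c * f ((extChartAt I₁ x).symm u)) •
      coordGrad (coordMetric g₁ x) (fun t => f ((extChartAt I₁ x).symm t)) u)
      (extChartAt I₁ x x) :=
    ((differentiableAt_of_contDiffAt hF).const_mul c).smul
      (differentiableAt_of_contDiffAt ((hg₁ x).contDiffAt_coordGrad hx hF))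
  have h := (hg₁ x).lieDeriv_smul_coordGrad hx hF c v w
  rw [extChartAt_to_inv] at h
  rw [lieDerivMetric_eq, lieDerivMetric_eq, coordLie_congr (EventuallyEq.refl _ _) hev,
    coordLie_sub (hξ.differentiableAt_component₁ x y) hd, ← h, coordLie, coordLie,
    extChartAt_to_inv]

theorem IsClairautWarpedProductMap.fderiv_warping_of_isVertical
    (hφ : IsClairautWarpedProductMap g₁ g₂ f h₁ h₂ ρ φ₁ φ₂) (hg₁ : IsSmoothMetric g₁)
    (hρ : ContMDiff J₁ 𝓘(ℝ, ℝ) ∞ ρ) (hc : ∀ x, ρ (φ₁ x) = f x) {x : M₁} {v : E₁}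
    (hv : tangentMapAt I₁ J₁ φ₁ x v = 0) :
    fderiv ℝ (fun t => f ((extChartAt I₁ x).symm t)) (extChartAt I₁ x x) v = 0 := by
  rw [← hφ.left.verticalProj_self hg₁ hv]
  exact hφ.fderiv_warping hg₁ hρ hc (mem_extChartAt_target x) v

/-- Restricted to vertical vectors, the difference of the two Ricci tensors, the Hessian term of the
warped product and the Lie derivative along `m₂ f ∇f` are all multiples of `g₁`, so the soliton
equation of `M` restricts to the fibre. -/
theorem IsClairautWarpedProductMap.isAlmostRicciSolitonOn_left
    (hφ : IsClairautWarpedProductMap g₁ g₂ f h₁ h₂ ρ φ₁ φ₂) (hg₁ : IsSmoothMetric g₁)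
    (hg₂ : IsSmoothMetric g₂) (hf : ContMDiff I₁ 𝓘(ℝ, ℝ) ∞ f) (hpos : ∀ x, 0 < f x)
    (hρ : ContMDiff J₁ 𝓘(ℝ, ℝ) ∞ ρ) (hc : ∀ x, ρ (φ₁ x) = f x) (hξ : IsSmoothField ξ univ)
    (hsol : IsRicciSoliton (warpedMetric g₁ g₂ f) ξ lam) {y : M₂} {ℓ : M₁ → ℝ}
    (hℓ : ContMDiff I₁ 𝓘(ℝ, ℝ) ∞ ℓ)
    (hs : ∀ x, IsSplittingOn (coordMetric g₁ x) (verticalForm g₁ h₁ φ₁ x)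
      (fun t => ℓ ((extChartAt I₁ x).symm t)) (extChartAt I₁ x).target)
    {q : N₁} {ι : F → M₁} (hι : IsFibre (EF := EF) I₁ J₁ φ₁ q ι) :
    IsAlmostRicciSolitonOn (EF := EF) g₁ (fun x => component₁ ξ y x
      - ((Module.finrank ℝ E₂ : ℝ) * f x) • gradient g₁ f x) ι := by
  set m : ℝ := ((Module.finrank ℝ E₂ : ℕ) : ℝ)
  -- In order: the soliton constant; the change from `Ric₁` to the Ricci tensor of the fibre; then,
  -- with `Hess f = ⟨∇f, ∇ℓ⟩ g₁` on vertical vectors, `1 / f` from the warped Ricci tensor and `f`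
  -- from the potential.
  refine ⟨fun s => lam - laplacian g₁ ℓ (ι s)
    - m * ((f (ι s))⁻¹ - f (ι s)) * gradInner g₁ f ℓ (ι s), ?_, ?_⟩
  · have hf' := hf.comp hι.smooth
    have hinv : ContMDiff 𝓘(ℝ, EF) 𝓘(ℝ, ℝ) ∞ (fun s => (f (ι s))⁻¹) := fun s =>
      ((contDiffAt_inv ℝ (hpos (ι s)).ne').contMDiffAt (n := ∞)).comp s (hf' s)
    have hl := (contMDiff_laplacian hg₁ hℓ).comp hι.smooth
    have hgi := (contMDiff_gradInner hg₁ hf hℓ).comp hι.smooth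
    exact (contMDiff_const.sub hl).sub ((contMDiff_const.mul (hinv.sub hf')).mul hgi)
  · have key : ∀ (s : F) (a b : EF),
        (1 / 2) * lieDerivMetric g₁ (fun x => component₁ ξ y x - (m * f x) • gradient g₁ f x) (ι s)
            (tangentMapAt 𝓘(ℝ, EF) I₁ ι s a) (tangentMapAt 𝓘(ℝ, EF) I₁ ι s b)
          + ricci (pullbackMetric 𝓘(ℝ, EF) g₁ ι) s a b
          + (lam - laplacian g₁ ℓ (ι s) - m * ((f (ι s))⁻¹ - f (ι s)) * gradInner g₁ f ℓ (ι s))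
            * formAt (pullbackMetric 𝓘(ℝ, EF) g₁ ι) s a b = 0 := by
      intro s a b
      have hx := mem_extChartAt_target (I := I₁) (ι s)
      have hFs := (contDiffOn_comp_extChartAt_symm hf (ι s)).contDiffAt
        ((isOpen_extChartAt_target (ι s)).mem_nhds hx)
      have hv := hι.tangentMapAt_eq_zero s
      have hsol' := hsol.left hg₁ hg₂ hf hpos hξ (ι s) y (tangentMapAt 𝓘(ℝ, EF) I₁ ι s a)
        (tangentMapAt 𝓘(ℝ, EF) I₁ ι s b)
      have hess := (hs (ι s)).coordHess_vertical hx hFs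
        (((isOpen_extChartAt_target (I := I₁) (ι s)).eventually_mem hx).mono fun t ht =>
          hφ.fderiv_warping hg₁ hρ hc ht)
        (hφ.left.verticalProj_self hg₁ (hv a)) (hφ.left.verticalProj_self hg₁ (hv b))
      have hgi : fderiv ℝ (fun t => f ((extChartAt I₁ (ι s)).symm t)) (extChartAt I₁ (ι s) (ι s))
          (coordGrad (coordMetric g₁ (ι s)) (fun t => ℓ ((extChartAt I₁ (ι s)).symm t))
            (extChartAt I₁ (ι s) (ι s))) = gradInner g₁ f ℓ (ι s) := rfl
      rw [hgi, coordMetric_eq, chartDeriv_self, extChartAt_to_inv] at hess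
      simp only [ContinuousLinearMap.id_apply] at hess
      rw [lieDerivMetric_sub_smul_gradient hg₁ hf hξ,
        hφ.fderiv_warping_of_isVertical hg₁ hρ hc (hv a), formAt_pullbackMetric]
      rw [hι.ricci_eq hφ.left hg₁ s (hs (ι s)), formAt_pullbackMetric] at hsol'
      rw [hess] at hsol' ⊢
      linear_combination hsol'
    exact key

/-- The equation satisfied by the fibres of the second factor. -/
theorem IsClairautWarpedProductMap.soliton_right
    (hφ : IsClairautWarpedProductMap g₁ g₂ f h₁ h₂ ρ φ₁ φ₂) (hg₁ : IsSmoothMetric g₁)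
    (hg₂ : IsSmoothMetric g₂) (hf : ContMDiff I₁ 𝓘(ℝ, ℝ) ∞ f) (hpos : ∀ x, 0 < f x)
    (hρ : ContMDiff J₁ 𝓘(ℝ, ℝ) ∞ ρ) (hc : ∀ x, ρ (φ₁ x) = f x) (hξ : IsSmoothField ξ univ)
    (hξ_vert : ∀ p, IsVertical (I₁.prod I₂) (J₁.prod J₂) (Prod.map φ₁ φ₂) p (ξ p))
    (hsol : IsRicciSoliton (warpedMetric g₁ g₂ f) ξ lam) (x : M₁) {ℓ : M₂ → ℝ}
    (hℓ : ContMDiff I₂ 𝓘(ℝ, ℝ) ∞ ℓ)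
    (hs : ∀ y, IsSplittingOn (coordMetric g₂ y) (verticalForm g₂ h₂ φ₂ y)
      (fun t => ℓ ((extChartAt I₂ y).symm t)) (extChartAt I₂ y).target)
    {q : N₂} {ι : F → M₂} (hι : IsFibre (EF := EF) I₂ J₂ φ₂ q ι) :
    ∃ A : F → ℝ, ContMDiff 𝓘(ℝ, EF) 𝓘(ℝ, ℝ) ∞ A ∧ ∀ (s : F) (a b : EF),
      (1 / 2) * (f x ^ 2 * lieDerivMetric g₂ (component₂ ξ x) (ι s)
          (tangentMapAt 𝓘(ℝ, EF) I₂ ι s a) (tangentMapAt 𝓘(ℝ, EF) I₂ ι s b))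
        + ricci (pullbackMetric 𝓘(ℝ, EF) g₂ ι) s a b
        + A s * formAt (pullbackMetric 𝓘(ℝ, EF) g₂ ι) s a b = 0 := by
  refine ⟨fun s => lam * f x ^ 2 - warpCoeff (coordMetric g₁ x)
    (fun t => f ((extChartAt I₁ x).symm t)) (Module.finrank ℝ E₂) (extChartAt I₁ x x)
    - laplacian g₂ ℓ (ι s), ?_, fun s a b => ?_⟩
  · exact contMDiff_const.sub ((contMDiff_laplacian hg₂ hℓ).comp hι.smooth)
  -- Verticality of `ξ` is componentwise; its first component makes `df(ξ₁)` vanish.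
  · have hξ₁ : tangentMapAt I₁ J₁ φ₁ x (fieldValue ξ (x, ι s)).1 = 0 := by
      have h : tangentMapAt (I₁.prod I₂) (J₁.prod J₂) (Prod.map φ₁ φ₂) (x, ι s)
        (fieldValue ξ (x, ι s)) = 0 := hξ_vert (x, ι s)
      rw [tangentMapAt_prodMap (hφ.left.smooth.mdifferentiable (by simp) _)
        (hφ.right.smooth.mdifferentiable (by simp) _)] at h
      exact congrArg Prod.fst h
    have hsol' := hsol.right hg₁ hg₂ hf hpos hξ x (ι s)
      (hφ.fderiv_warping_of_isVertical hg₁ hρ hc hξ₁) (tangentMapAt 𝓘(ℝ, EF) I₂ ι s a)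
      (tangentMapAt 𝓘(ℝ, EF) I₂ ι s b)
    rw [hι.ricci_eq hφ.right hg₂ s (hs (ι s)), formAt_pullbackMetric] at hsol'
    rw [formAt_pullbackMetric]
    linear_combination hsol'

theorem IsClairautWarpedProductMap.exists_soliton_right
    (hφ : IsClairautWarpedProductMap g₁ g₂ f h₁ h₂ ρ φ₁ φ₂) (hg₁ : IsSmoothMetric g₁)
    (hg₂ : IsSmoothMetric g₂) (hh₁ : IsSmoothMetric h₁) (hh₂ : IsSmoothMetric h₂)
    (hf : ContMDiff I₁ 𝓘(ℝ, ℝ) ∞ f) (hpos : ∀ x, 0 < f x)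
    (hρ : ContMDiff J₁ 𝓘(ℝ, ℝ) ∞ ρ) (hρpos : ∀ x, 0 < ρ x) (hξ : IsSmoothField ξ univ)
    (hξ_vert : ∀ p, IsVertical (I₁.prod I₂) (J₁.prod J₂) (Prod.map φ₁ φ₂) p (ξ p))
    (hsol : IsRicciSoliton (warpedMetric g₁ g₂ f) ξ lam)
    (hint : HorizontalIntegrable (J₁.prod J₂) (warpedMetric g₁ g₂ f) (Prod.map φ₁ φ₂)) (x : M₁)
    {q : N₂} {ι : F → M₂} (hι : IsFibre (EF := EF) I₂ J₂ φ₂ q ι) :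
    ∃ A : F → ℝ, ContMDiff 𝓘(ℝ, EF) 𝓘(ℝ, ℝ) ∞ A ∧ ∀ (s : F) (a b : EF),
      (1 / 2) * (f x ^ 2 * lieDerivMetric g₂ (component₂ ξ x) (ι s)
          (tangentMapAt 𝓘(ℝ, EF) I₂ ι s a) (tangentMapAt 𝓘(ℝ, EF) I₂ ι s b))
        + ricci (pullbackMetric 𝓘(ℝ, EF) g₂ ι) s a b
        + A s * formAt (pullbackMetric 𝓘(ℝ, EF) g₂ ι) s a b = 0 := by
  -- The identity `ρ ∘ φ₁ = f` needs a point of the second factor, and any point of the fibre gives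
  -- one. For empty `F` there is nothing to prove.
  by_cases hF : Nonempty F
  · obtain ⟨s⟩ := hF
    have hc := hφ.comp_eq hg₂ hpos hρpos (ι s)
    obtain ⟨ℓ, hℓ, hs⟩ := hφ.isSplittingOn hg₁ hg₂ hh₁ hh₂ hf hpos hρ hρpos hc hint
    exact hφ.soliton_right hg₁ hg₂ hf hpos hρ hc hξ hξ_vert hsol x
      (hℓ.comp (contMDiff_const.prodMk contMDiff_id)) (fun y => (hs x y).2) hι
  · exact ⟨fun _ => 0, contMDiff_const, fun s => absurd ⟨s⟩ hF⟩

/-- Rescaling multiplies the Lie derivative by `c²` and leaves the Ricci tensor of the fibre alone,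
so the assumed equation already is the one for `c² g₂`, with `A` divided by `c²`. -/
theorem isAlmostRicciSolitonOn_scaledMetric {X : ∀ y : M₂, TangentSpace I₂ y} {c : ℝ} (hc : c ≠ 0)
    (hg₂ : IsSmoothMetric g₂) {q : N₂} {ι : F → M₂} (hι : IsFibre (EF := EF) I₂ J₂ φ₂ q ι)
    {A : F → ℝ} (hA : ContMDiff 𝓘(ℝ, EF) 𝓘(ℝ, ℝ) ∞ A)
    (h : ∀ (s : F) (a b : EF),
      (1 / 2) * (c ^ 2 * lieDerivMetric g₂ X (ι s)
          (tangentMapAt 𝓘(ℝ, EF) I₂ ι s a) (tangentMapAt 𝓘(ℝ, EF) I₂ ι s b))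
        + ricci (pullbackMetric 𝓘(ℝ, EF) g₂ ι) s a b
        + A s * formAt (pullbackMetric 𝓘(ℝ, EF) g₂ ι) s a b = 0) :
    IsAlmostRicciSolitonOn (EF := EF) (scaledMetric g₂ c) X ι := by
  have hpb : pullbackMetric 𝓘(ℝ, EF) (scaledMetric g₂ c) ι
      = scaledMetric (pullbackMetric 𝓘(ℝ, EF) g₂ ι) c := rfl
  refine ⟨fun s => A s / c ^ 2, hA.div_const (c ^ 2), ?_⟩
  have key : ∀ (s : F) (a b : EF),
      (1 / 2) * lieDerivMetric (scaledMetric g₂ c) X (ι s)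
          (tangentMapAt 𝓘(ℝ, EF) I₂ ι s a) (tangentMapAt 𝓘(ℝ, EF) I₂ ι s b)
        + ricci (pullbackMetric 𝓘(ℝ, EF) (scaledMetric g₂ c) ι) s a b
        + A s / c ^ 2 * formAt (pullbackMetric 𝓘(ℝ, EF) (scaledMetric g₂ c) ι) s a b = 0 := by
    intro s a b
    rw [hpb, lieDerivMetric_scaledMetric hg₂,
      ricci_scaledMetric (hg₂.pullback hι.smooth hι.immersive) hc, scaledMetric_form, ← h s a b]
    field_simp
  exact key

/-- The weights `(1 - d) / (c - d)` and `(c - 1) / (c - d)` have sum `1`, which preserves the Ricci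
term, and bring the coefficient of the Lie derivative to `1`. -/
theorem isAlmostRicciSolitonOn_of_two {X : ∀ y : M₂, TangentSpace I₂ y} {c d : ℝ} (hcd : c ≠ d)
    {ι : F → M₂} {A B : F → ℝ} (hA : ContMDiff 𝓘(ℝ, EF) 𝓘(ℝ, ℝ) ∞ A)
    (hB : ContMDiff 𝓘(ℝ, EF) 𝓘(ℝ, ℝ) ∞ B)
    (h : ∀ (s : F) (a b : EF),
      (1 / 2) * (c * lieDerivMetric g₂ X (ι s)
          (tangentMapAt 𝓘(ℝ, EF) I₂ ι s a) (tangentMapAt 𝓘(ℝ, EF) I₂ ι s b))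
        + ricci (pullbackMetric 𝓘(ℝ, EF) g₂ ι) s a b
        + A s * formAt (pullbackMetric 𝓘(ℝ, EF) g₂ ι) s a b = 0)
    (h' : ∀ (s : F) (a b : EF),
      (1 / 2) * (d * lieDerivMetric g₂ X (ι s)
          (tangentMapAt 𝓘(ℝ, EF) I₂ ι s a) (tangentMapAt 𝓘(ℝ, EF) I₂ ι s b))
        + ricci (pullbackMetric 𝓘(ℝ, EF) g₂ ι) s a b
        + B s * formAt (pullbackMetric 𝓘(ℝ, EF) g₂ ι) s a b = 0) :
    IsAlmostRicciSolitonOn (EF := EF) g₂ X ι := by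
  have hne : c - d ≠ 0 := sub_ne_zero.2 hcd
  -- The same affine combination of `A` and `B`.
  refine ⟨fun s => A s - (c - 1) / (c - d) * (A s - B s),
    hA.sub (contMDiff_const.mul (hA.sub hB)), ?_⟩
  have key : ∀ (s : F) (a b : EF),
      (1 / 2) * lieDerivMetric g₂ X (ι s)
          (tangentMapAt 𝓘(ℝ, EF) I₂ ι s a) (tangentMapAt 𝓘(ℝ, EF) I₂ ι s b)
        + ricci (pullbackMetric 𝓘(ℝ, EF) g₂ ι) s a b
        + (A s - (c - 1) / (c - d) * (A s - B s))
          * formAt (pullbackMetric 𝓘(ℝ, EF) g₂ ι) s a b = 0 := by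
    intro s a b
    field_simp
    linear_combination 2 * (1 - d) * h s a b - 2 * (1 - c) * h' s a b
  exact key

end Soliton

end WarpedClairaut

end

/-! ### The theorem. -/

open WarpedClairaut in
theorem mainTheorem4
    {E₁ : Type*} [NormedAddCommGroup E₁] [NormedSpace ℝ E₁] [FiniteDimensional ℝ E₁]
    {M₁ : Type*} [TopologicalSpace M₁] [T2Space M₁] [SecondCountableTopology M₁]
    [ChartedSpace E₁ M₁] [IsManifold 𝓘(ℝ, E₁) ∞ M₁]
    {E₂ : Type*} [NormedAddCommGroup E₂] [NormedSpace ℝ E₂] [FiniteDimensional ℝ E₂]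
    {M₂ : Type*} [TopologicalSpace M₂] [T2Space M₂] [SecondCountableTopology M₂]
    [ChartedSpace E₂ M₂] [IsManifold 𝓘(ℝ, E₂) ∞ M₂]
    {E₃ : Type*} [NormedAddCommGroup E₃] [NormedSpace ℝ E₃] [FiniteDimensional ℝ E₃]
    {N₁ : Type*} [TopologicalSpace N₁] [T2Space N₁] [SecondCountableTopology N₁]
    [ChartedSpace E₃ N₁] [IsManifold 𝓘(ℝ, E₃) ∞ N₁]
    {E₄ : Type*} [NormedAddCommGroup E₄] [NormedSpace ℝ E₄] [FiniteDimensional ℝ E₄]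
    {N₂ : Type*} [TopologicalSpace N₂] [T2Space N₂] [SecondCountableTopology N₂]
    [ChartedSpace E₄ N₂] [IsManifold 𝓘(ℝ, E₄) ∞ N₂]
    (g₁ : Bundle.ContMDiffRiemannianMetric 𝓘(ℝ, E₁) ∞ E₁
      (fun x : M₁ => TangentSpace 𝓘(ℝ, E₁) x))
    (g₂ : Bundle.ContMDiffRiemannianMetric 𝓘(ℝ, E₂) ∞ E₂
      (fun x : M₂ => TangentSpace 𝓘(ℝ, E₂) x))
    (h₁ : Bundle.ContMDiffRiemannianMetric 𝓘(ℝ, E₃) ∞ E₃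
      (fun x : N₁ => TangentSpace 𝓘(ℝ, E₃) x))
    (h₂ : Bundle.ContMDiffRiemannianMetric 𝓘(ℝ, E₄) ∞ E₄
      (fun x : N₂ => TangentSpace 𝓘(ℝ, E₄) x))
    (f : M₁ → ℝ) (hf : ContMDiff 𝓘(ℝ, E₁) 𝓘(ℝ, ℝ) ∞ f) (hf_pos : ∀ x, 0 < f x)
    (ρ : N₁ → ℝ) (hρ : ContMDiff 𝓘(ℝ, E₃) 𝓘(ℝ, ℝ) ∞ ρ) (hρ_pos : ∀ x, 0 < ρ x)
    (φ₁ : M₁ → N₁) (φ₂ : M₂ → N₂)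
    (hφ : IsClairautWarpedProductMap g₁.inner g₂.inner f h₁.inner h₂.inner ρ φ₁ φ₂)
    (ξ : ∀ p : M₁ × M₂, TangentSpace (𝓘(ℝ, E₁).prod 𝓘(ℝ, E₂)) p)
    (hξ : IsSmoothField ξ univ)
    (hξ_vert : ∀ p, IsVertical (𝓘(ℝ, E₁).prod 𝓘(ℝ, E₂)) (𝓘(ℝ, E₃).prod 𝓘(ℝ, E₄))
      (Prod.map φ₁ φ₂) p (ξ p))
    (lam : ℝ) (hsol : IsRicciSoliton (warpedMetric g₁.inner g₂.inner f) ξ lam)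
    (hint : HorizontalIntegrable (𝓘(ℝ, E₃).prod 𝓘(ℝ, E₄)) (warpedMetric g₁.inner g₂.inner f)
      (Prod.map φ₁ φ₂)) :
    (∀ (y : M₂) (q : N₁)
      {EF : Type*} [NormedAddCommGroup EF] [NormedSpace ℝ EF] [FiniteDimensional ℝ EF]
      {F : Type*} [TopologicalSpace F] [ChartedSpace EF F] [IsManifold 𝓘(ℝ, EF) ∞ F]
      (ι : F → M₁), IsFibre (EF := EF) 𝓘(ℝ, E₁) 𝓘(ℝ, E₃) φ₁ q ι →
      IsAlmostRicciSolitonOn (EF := EF) g₁.inner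
        (fun x => component₁ ξ y x
          - ((Module.finrank ℝ E₂ : ℝ) * f x) • gradient g₁.inner f x) ι) ∧
    (∀ (x : M₁) (q : N₂)
      {EF : Type*} [NormedAddCommGroup EF] [NormedSpace ℝ EF] [FiniteDimensional ℝ EF]
      {F : Type*} [TopologicalSpace F] [ChartedSpace EF F] [IsManifold 𝓘(ℝ, EF) ∞ F]
      (ι : F → M₂), IsFibre (EF := EF) 𝓘(ℝ, E₂) 𝓘(ℝ, E₄) φ₂ q ι →
      IsAlmostRicciSolitonOn (EF := EF) (scaledMetric g₂.inner (f x)) (component₂ ξ x) ι) ∧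
    ((∀ x x' : M₁, component₂ ξ x = component₂ ξ x') →
      ((∃ x, f x = 1) ∨ ∃ x x', f x ≠ f x') →
      ∀ (x : M₁) (q : N₂)
      {EF : Type*} [NormedAddCommGroup EF] [NormedSpace ℝ EF] [FiniteDimensional ℝ EF]
      {F : Type*} [TopologicalSpace F] [ChartedSpace EF F] [IsManifold 𝓘(ℝ, EF) ∞ F]
      (ι : F → M₂), IsFibre (EF := EF) 𝓘(ℝ, E₂) 𝓘(ℝ, E₄) φ₂ q ι →
      IsAlmostRicciSolitonOn (EF := EF) g₂.inner (component₂ ξ x) ι) := by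
  have hg₁ := isSmoothMetric_inner g₁
  have hg₂ := isSmoothMetric_inner g₂
  have hh₁ := isSmoothMetric_inner h₁
  have hh₂ := isSmoothMetric_inner h₂
  refine ⟨?_, ?_, ?_⟩
  · intro y q EF _ _ _ F _ _ _ ι hι
    have hc := hφ.comp_eq hg₂ hf_pos hρ_pos y
    obtain ⟨ℓ, hℓ, hs⟩ := hφ.isSplittingOn hg₁ hg₂ hh₁ hh₂ hf hf_pos hρ hρ_pos hc hint
    -- The potential of the splitting on `M₁` is `ℓ(·, y)`, the restriction to the leaf through `y`.
    exact hφ.isAlmostRicciSolitonOn_left hg₁ hg₂ hf hf_pos hρ hc hξ hsol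
      (hℓ.comp (contMDiff_id.prodMk contMDiff_const)) (fun x => (hs x y).1) hι
  · intro x q EF _ _ _ F _ _ _ ι hι
    obtain ⟨A, hA, h⟩ :=
        hφ.exists_soliton_right hg₁ hg₂ hh₁ hh₂ hf hf_pos hρ hρ_pos hξ hξ_vert hsol hint x hι
    exact isAlmostRicciSolitonOn_scaledMetric (hf_pos x).ne' hg₂ hι hA h
  · intro hlift hcase x q EF _ _ _ F _ _ _ ι hι
    rcases hcase with ⟨x₁, hx₁⟩ | ⟨x₁, x₂, hne⟩
    · obtain ⟨A, hA, h⟩ :=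
        hφ.exists_soliton_right hg₁ hg₂ hh₁ hh₂ hf hf_pos hρ hρ_pos hξ hξ_vert hsol hint x₁ hι
      -- The lifted component is the same at `x` and at `x₁`, and at `x₁` the coefficient `f²` is
      -- already `1`.
      rw [hlift x x₁]
      refine ⟨A, hA, fun s a b => ?_⟩
      have := h s a b
      rw [hx₁, one_pow, one_mul] at this
      exact this
    · obtain ⟨A, hA, h⟩ :=
        hφ.exists_soliton_right hg₁ hg₂ hh₁ hh₂ hf hf_pos hρ hρ_pos hξ hξ_vert hsol hint x₁ hι
      obtain ⟨B, hB, h'⟩ :=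
        hφ.exists_soliton_right hg₁ hg₂ hh₁ hh₂ hf hf_pos hρ hρ_pos hξ hξ_vert hsol hint x₂ hι
      rw [hlift x₁ x] at h
      rw [hlift x₂ x] at h'
      -- The coefficients are the squares of two different positive values of `f`, hence different.
      exact isAlmostRicciSolitonOn_of_two
        (fun e => hne ((pow_left_inj₀ (hf_pos x₁).le (hf_pos x₂).le two_ne_zero).1 e)) hA hB h h'
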